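/- **Setting.** Let $M=(\mathcal S,\mathcal A,p,r,\gamma)$ be a discounted Markov decision process with finite non-empty sets $\mathcal S$ of states and $\mathcal A$ of actions ($S=|\mathcal S|$, $A=|\mathcal A|$), transition probabilities $p(s'|s,a)$, rewards $r[s,a]\in[0,1]$ and discount factor $\gamma\in[0,1)$; put $\Gamma=(1-\gamma)^{-1}$. For $\pi:\mathcal S\to\mathcal A$ let $v^\pi[s]=\mathbb E\big[\sum_{t\ge0}\gamma^t r[s_t,\pi(s_t)]\,\big|\,s_0=s\big]$, where $s_{t+1}\sim p(\cdot|s_t,\pi(s_t))$, and let $v^*[s]=\max_\pi v^\pi[s]$. For $v\in\mathbb R^{\mathcal S}$ put $(Pv)[s,a]=\sum_{s'}p(s'|s,a)v[s']$. The transition probabilities are accessed through a quantum generative model: a unitary $\mathcal O$ on $\mathbb C^{\mathcal S}\otimes\mathbb C^{\mathcal A}\otimes\mathbb C^{\mathcal S}\otimes\mathbb C^{J}$ with $$\mathcal O|s\rangle|a\rangle|0\rangle|0\rangle=|s\rangle|a\rangle\sum_{s'}\sqrt{p(s'|s,a)}\,|s'\rangle|\psi_{s',s,a}\rangle$$ for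 some unit vectors $\psi_{s',s,a}$ (and otherwise arbitrary), where $|0\rangle$ denotes fixed basis vectors. **Mean estimation.** Given $v\in\mathbb R^{\mathcal S}$, $u,\eta>0$ and $f\in(0,1)$, the circuit $\mathsf{qEst1}_f(Pv,\eta)$ with range $u$ performs, coherently on $|s\rangle|a\rangle$ and on separate workspaces, $2m+1$ runs of amplitude estimation, $m=\lceil 18\ln(1/f)\rceil$. One run uses the preparation $V$ consisting of one application of $\mathcal O$ followed by the rotation of a flag qubit, controlled on $|s'\rangle$, by the angle $\arcsin\sqrt{v[s']/u}$ (with $v[s']/u$ clamped to $[0,1]$); it applies phase estimation with $N=\lceil 8u/\eta\rceil+1$ points, by the quantum Fourier transform on $\mathbb C^{N}$, to the operator $V(2\Pi_0-1)V^{-1}F$, where $\Pi_0$ projects on the all-zero workspace and $F$ flips the phase of flag $1$. A phase label $y$ represents the estimate $u\sin^2(\pi y/N)$, and the labels of all the runs represent the median $\hat\mu$ of these estimates. **Maximum finding.** A (possibly faulty) quantum oracle for a vector in $\mathbb R^{\mathcal A}$ is a unitary $U$ on $\mathbb C^{\mathcal A}\otimes\mathbb C^W$, an initial basis vector $|0_W\rangle$,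 and a function $\mathrm{val}$ that assigns a real number to every basis label $(a,w)$. Let $|\phi\rangle=A^{-1/2}\sum_a|a\rangle|0_W\rangle$ and, for $t\in\mathbb R$, let $G_t=U(2|\phi\rangle\langle\phi|-1)U^{-1}F_t$, where $F_t$ flips the phase of the labels with $\mathrm{val}>t$. The routine $\mathsf{qArgmax}_f$ measures $U|\phi\rangle$ to get a first label $x$ (one query) and sets $k=0$. It then repeats: choose $j$ uniformly among the nonnegative integers below $\min\{(6/5)^k,\sqrt A\}$; if $2j+1$ more queries would exceed the budget of $c_{\max}\sqrt A\ln(1/f)$ queries to $U$ and $U^{-1}$, where $c_{\max}=10^4$, stop; otherwise measure $G_{\mathrm{val}(x)}^{\,j}U|\phi\rangle$ to get a label $x'$; if $\mathrm{val}(x')>\mathrm{val}(x)$ replace $x$ by $x'$ and set $k=0$, else increase $k$ by one. It returns the action $a^*$ contained in the final label $x$ and the value $\mathrm{val}(x)$ read from the oracle. **Algorithm $\mathsf{SolveMdp2}(M,\epsilon,\delta)$**, for $\epsilon\in(0,\Gamma]$ and $\delta\in(0,1)$. Let $$L=\big\lceil\Gamma\lceil\ln(4\Gamma/\epsilon)\rceil\big\rceil+1,\qquad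 \eta=\frac{(1-\gamma)\epsilon}4,\qquad X=\frac{4c_{\max}LSA^{3/2}}{\delta},\qquad f=\frac{1}{2X\ln X}.$$ Start with $v_0=0$, an arbitrary $\pi_0:\mathcal S\to\mathcal A$, and for each $s$ the exact oracle of $q_{0,s}=0\in\mathbb R^{\mathcal A}$. For $l=1,\dots,L$: 1. independently for every $s$, run $\mathsf{qArgmax}_f$ on the oracle of $q_{l-1,s}$, obtaining an action $\tilde\pi_l[s]$ and a value $\tilde v_l[s]$; 2. for every $s$, if $\tilde v_l[s]\ge v_{l-1}[s]$ set $v_l[s]=\tilde v_l[s]$, $\pi_l[s]=\tilde\pi_l[s]$, else set $v_l[s]=v_{l-1}[s]$, $\pi_l[s]=\pi_{l-1}[s]$; 3. for every $s$, create the oracle of $q_{l,s}$: its unitary is the circuit $\mathsf{qEst1}_f(Pv_l,\eta)$ with range $u=\Gamma$ and first register $|s\rangle$, and a label with action $a$ and estimate $\hat\mu$ has the value $\max\{r[s,a]+\gamma(\hat\mu-\eta),0\}$. Output $\hat v=v_L$ and $\hat\pi=\pi_L$. **Theorem.** For every such $M$, every quantum generative model $\mathcal O$ of $M$, every $\epsilon\in(0,\Gamma]$,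 every $\delta\in(0,1)$ and every $\pi_0$, the outputs of $\mathsf{SolveMdp2}(M,\epsilon,\delta)$ satisfy, with probability at least $1-\delta$, the entrywise inequalities $$v^*-\epsilon\le\hat v\le v^{\hat\pi}\le v^* .$$ -/

import Mathlib

open scoped ENNReal

noncomputable section

namespace QMDP

/-! ### Discounted Markov decision processes -/

/-- A finite discounted Markov decision process with rewards in `[0,1]` and discount factor
`γ ∈ [0,1)`. -/
structure MDP (S A : Type*) where
  /-- transition probabilities: `p s a` is the distribution `p(· | s, a)` -/
  p : S → A → PMF S
  /-- rewards -/
  r : S → A → ℝ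
  r_nonneg : ∀ s a, 0 ≤ r s a
  r_le_one : ∀ s a, r s a ≤ 1
  /-- discount factor -/
  γ : ℝ
  γ_nonneg : 0 ≤ γ
  γ_lt_one : γ < 1

namespace MDP

variable {S A : Type*}

/-- The effective time horizon `Γ = 1 / (1 - γ)`. -/
def horizon (M : MDP S A) : ℝ := (1 - M.γ)⁻¹

/-- The one-step transition kernel of the Markov chain driven by the policy `π`; the finite state
space carries the discrete σ-algebra. -/
def stepKernel [Fintype S] (M : MDP S A) (π : S → A) :
    @ProbabilityTheory.Kernel S S ⊤ ⊤ :=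
  letI : MeasurableSpace S := ⊤
  ⟨fun s => (M.p s (π s)).toMeasure, measurable_from_top⟩

instance [Fintype S] (M : MDP S A) (π : S → A) :
    @ProbabilityTheory.IsMarkovKernel S S ⊤ ⊤ (M.stepKernel π) :=
  letI : MeasurableSpace S := ⊤
  ⟨fun s => PMF.toMeasure.isProbabilityMeasure (M.p s (π s))⟩

/-- The law of the infinite trajectory `s₀, s₁, s₂, …` started at `s₀ = s`, in which
`sₜ₊₁ ∼ p(· | sₜ, π(sₜ))`. -/
def trajectory [Fintype S] (M : MDP S A) (π : S → A) (s : S) :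
    @MeasureTheory.Measure (ℕ → S) (@MeasurableSpace.pi ℕ (fun _ => S) fun _ => ⊤) :=
  letI : MeasurableSpace S := ⊤
  ProbabilityTheory.Kernel.traj (X := fun _ => S)
    (fun n => (M.stepKernel π).comap
      (fun h : (i : Finset.Iic n) → S => h ⟨n, Finset.mem_Iic.2 le_rfl⟩) (measurable_pi_apply _))
    0 (fun _ => s)

/-- The value function `v^π[s] = 𝔼[∑ₜ γᵗ r[sₜ, π(sₜ)] | s₀ = s]`. -/
def value [Fintype S] (M : MDP S A) (π : S → A) (s : S) : ℝ :=
  letI : MeasurableSpace S := ⊤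
  ∫ ω, ∑' t : ℕ, M.γ ^ t * M.r (ω t) (π (ω t)) ∂(M.trajectory π s)

/-- The optimal value function `v*`. -/
def optValue [Fintype S] (M : MDP S A) (s : S) : ℝ := ⨆ π : S → A, M.value π s

end MDP

/-! ### Unitaries, registers and measurements

The state space of a system of registers with (finite) set of basis labels `I` is `I → ℂ`. -/

section Circuits

variable {I ι κ : Type*} [Fintype I] [DecidableEq I] [Fintype ι] [DecidableEq ι]
  [Fintype κ] [DecidableEq κ]

/-- The registers `I` are split by `e` into the registers `ι` and `κ`; controlled on the basis label
`k` of `κ`, the unitary `U k` is applied to `ι`. -/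
def ctrl (e : I ≃ ι × κ) (U : κ → Matrix.unitaryGroup ι ℂ) : Matrix.unitaryGroup I ℂ :=
  ⟨(Matrix.blockDiagonal fun k => (U k : Matrix ι ι ℂ)).submatrix e e, by
    have h : ∀ k, (U k : Matrix ι ι ℂ) * (star (U k : Matrix ι ι ℂ)) = 1 :=
      fun k => Matrix.mem_unitaryGroup_iff.1 (U k).2
    rw [Matrix.mem_unitaryGroup_iff, Matrix.star_eq_conjTranspose, Matrix.conjTranspose_submatrix,
      Matrix.submatrix_mul_equiv, Matrix.blockDiagonal_conjTranspose, ← Matrix.blockDiagonal_mul]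
    simp only [Matrix.star_eq_conjTranspose] at h
    simp only [h]
    have : (fun _ : κ => (1 : Matrix ι ι ℂ)) = 1 := rfl
    rw [this, Matrix.blockDiagonal_one, Matrix.submatrix_one_equiv]⟩

/-- `U` applied to the part `ι` of the registers `I ≃ ι × κ`, that is `U ⊗ 1`. -/
def onReg (e : I ≃ ι × κ) (U : Matrix.unitaryGroup ι ℂ) : Matrix.unitaryGroup I ℂ :=
  ctrl e fun _ => U

open Classical in
/-- The phase flip `|i⟩ ↦ -|i⟩` on the basis labels with `P i`, and `|i⟩ ↦ |i⟩` on the others. -/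
def flip (P : I → Prop) : Matrix.unitaryGroup I ℂ :=
  ⟨Matrix.diagonal fun i => if P i then -1 else 1, by
    rw [Matrix.mem_unitaryGroup_iff, Matrix.star_eq_conjTranspose, Matrix.diagonal_conjTranspose,
      Matrix.diagonal_mul_diagonal, ← Matrix.diagonal_one]
    congr 1
    funext i
    by_cases h : P i <;> simp [h]⟩

/-- A unit vector. -/
def IsState (ψ : I → ℂ) : Prop := ∑ i, ‖ψ i‖ ^ 2 = 1

theorem isState_iff {I : Type*} [Fintype I] {ψ : I → ℂ} : IsState ψ ↔ star ψ ⬝ᵥ ψ = 1 := by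
  have : star ψ ⬝ᵥ ψ = ((∑ i, ‖ψ i‖ ^ 2 : ℝ) : ℂ) := by
    simp [dotProduct, Complex.conj_mul']
  rw [this, IsState]
  norm_cast

theorem IsState.mulVec {ψ : I → ℂ} (h : IsState ψ) (U : Matrix.unitaryGroup I ℂ) :
    IsState ((U : Matrix I I ℂ).mulVec ψ) := by
  rw [isState_iff] at *
  have hU : star (U : Matrix I I ℂ) * (U : Matrix I I ℂ) = 1 := Matrix.mem_unitaryGroup_iff'.1 U.2
  rw [Matrix.star_mulVec, ← Matrix.dotProduct_mulVec, Matrix.mulVec_mulVec,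
    ← Matrix.star_eq_conjTranspose, hU, Matrix.one_mulVec, h]

/-- The reflection `2|ψ⟩⟨ψ| - 1`. -/
def reflection (ψ : I → ℂ) (h : IsState ψ) : Matrix.unitaryGroup I ℂ :=
  ⟨(2 : ℂ) • Matrix.vecMulVec ψ (star ψ) - 1, by
    have h1 : Matrix.vecMulVec ψ (star ψ) * Matrix.vecMulVec ψ (star ψ) =
        Matrix.vecMulVec ψ (star ψ) := by
      rw [Matrix.vecMulVec_mul_vecMulVec, isState_iff.1 h, one_smul]
    have h2 : star ((2 : ℂ) • Matrix.vecMulVec ψ (star ψ) - 1 : Matrix I I ℂ) =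
        (2 : ℂ) • Matrix.vecMulVec ψ (star ψ) - 1 := by
      rw [star_sub, star_one, star_smul, Matrix.star_eq_conjTranspose,
        Matrix.conjTranspose_vecMulVec, star_star]
      simp
    rw [Matrix.mem_unitaryGroup_iff, h2, sub_mul, mul_sub, smul_mul_smul_comm, h1]
    simp only [mul_one, one_mul]
    module⟩

/-- Measurement of the state `ψ` in the standard basis (Born rule). -/
def measure (ψ : I → ℂ) (h : IsState ψ) : PMF I :=
  PMF.ofFintype (fun i => ENNReal.ofReal (‖ψ i‖ ^ 2)) (by
    rw [← ENNReal.ofReal_sum_of_nonneg fun i _ => by positivity, show ∑ i, ‖ψ i‖ ^ 2 = 1 from h,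
      ENNReal.ofReal_one])

end Circuits

/-- The quantum Fourier transform on `ℂ^(n+1)`. -/
def dft (n : ℕ) : Matrix.unitaryGroup (Fin (n + 1)) ℂ :=
  ⟨Matrix.of fun x y => Complex.exp (2 * Real.pi * Complex.I * x.val * y.val / (n + 1)) /
      (Real.sqrt (n + 1) : ℂ), by
    have hn : ((n : ℂ) + 1) ≠ 0 := by exact_mod_cast Nat.succ_ne_zero n
    have hs : (Real.sqrt (n + 1) : ℂ) * (Real.sqrt (n + 1) : ℂ) = n + 1 := by
      rw [← Complex.ofReal_mul, Real.mul_self_sqrt (by positivity)]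
      push_cast; ring
    rw [Matrix.mem_unitaryGroup_iff]
    ext x y
    have key : ∀ k : Fin (n + 1),
        Complex.exp (2 * Real.pi * Complex.I * x.val * k.val / (n + 1)) / (Real.sqrt (n + 1) : ℂ) *
          star (Complex.exp (2 * Real.pi * Complex.I * y.val * k.val / (n + 1)) /
            (Real.sqrt (n + 1) : ℂ)) =
        Complex.exp (2 * Real.pi * Complex.I * ((x.val : ℤ) - (y.val : ℤ) : ℤ) / (n + 1)) ^ k.val /
          (n + 1) := by
      intro k
      rw [star_div₀, Complex.star_def, ← Complex.exp_conj, Complex.conj_ofReal,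
        div_mul_div_comm, hs, ← Complex.exp_add, ← Complex.exp_nat_mul]
      congr 2
      simp only [map_div₀, map_mul, map_add, Complex.conj_I, Complex.conj_ofReal, map_natCast,
        map_ofNat, map_one]
      push_cast
      field_simp
      ring
    rw [Matrix.mul_apply]
    simp only [Matrix.star_apply, Matrix.of_apply, key]
    rw [← Finset.sum_div, Fin.sum_univ_eq_sum_range (fun k => _ ^ k)]
    by_cases hxy : x = y
    · subst hxy
      simp [hn]
    · rw [Matrix.one_apply_ne hxy, geom_sum_eq, ← Complex.exp_nat_mul]
      · have : ((n + 1 : ℕ) : ℂ) * (2 * Real.pi * Complex.I * ((x.val : ℤ) - (y.val : ℤ) : ℤ) /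
            (n + 1)) = (((x.val : ℤ) - (y.val : ℤ) : ℤ) : ℂ) * (2 * Real.pi * Complex.I) := by
          push_cast; field_simp
        rw [this, Complex.exp_int_mul_two_pi_mul_I]
        simp
      · intro h
        rw [Complex.exp_eq_one_iff] at h
        obtain ⟨j, hj⟩ := h
        have hp : (2 * Real.pi * Complex.I : ℂ) ≠ 0 := Complex.two_pi_I_ne_zero
        have h2 : (((x.val : ℤ) - (y.val : ℤ) : ℤ) : ℂ) = ((j * (n + 1) : ℤ) : ℂ) := by
          have h3 := (div_eq_iff hn).1 hj
          apply mul_left_cancel₀ hp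
          rw [h3]; push_cast; ring
        have h4 : (x.val : ℤ) - y.val = j * (n + 1) := by exact_mod_cast h2
        have hx := x.isLt
        have hy := y.isLt
        apply hxy
        have h5 : j = 0 := by
          by_contra hj0
          rcases lt_or_gt_of_ne hj0 with h | h
          · nlinarith
          · nlinarith
        subst h5
        ext; omega⟩

/-- The rotation `|0⟩ ↦ cos θ |0⟩ + sin θ |1⟩`, `|1⟩ ↦ - sin θ |0⟩ + cos θ |1⟩` of one qubit. -/
def rotation (θ : ℝ) : Matrix.unitaryGroup Bool ℂ :=
  ⟨Matrix.of fun x y => if x = y then (Real.cos θ : ℂ) else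
      if x = true then (Real.sin θ : ℂ) else -(Real.sin θ : ℂ), by
    have h : (Real.cos θ : ℂ) * Real.cos θ + Real.sin θ * Real.sin θ = 1 := by
      norm_cast; nlinarith [Real.sin_sq_add_cos_sq θ]
    rw [Matrix.mem_unitaryGroup_iff]
    ext x y
    cases x <;> cases y <;>
      simp [Matrix.mul_apply, Matrix.star_apply, -Complex.ofReal_cos, -Complex.ofReal_sin,
        Complex.conj_ofReal]
    · linear_combination h
    · ring
    · ring
    · linear_combination h⟩

/-! ### The quantum generative model -/

/-- `O` is a quantum generative model of `M` with initial labels `s₀`, `j₀`: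
`O |s⟩|a⟩|s₀⟩|j₀⟩ = |s⟩|a⟩ ∑ₜ √p(t|s,a) |t⟩|ψ t s a⟩` for some unit vectors `ψ t s a`. -/
def IsGenerativeModel {S A J : Type*} [Fintype S] [DecidableEq S] [Fintype A] [DecidableEq A]
    [Fintype J] [DecidableEq J] (M : MDP S A) (s₀ : S) (j₀ : J)
    (O : Matrix.unitaryGroup (S × A × S × J) ℂ) : Prop :=
  ∃ ψ : S → S → A → J → ℂ, (∀ t s a, IsState (ψ t s a)) ∧
    ∀ s a, (O : Matrix (S × A × S × J) (S × A × S × J) ℂ).mulVec (Pi.single (s, a, s₀, j₀) 1) =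
      fun x => if x.1 = s ∧ x.2.1 = a then
        (Real.sqrt (M.p s a x.2.2.1).toReal : ℂ) * ψ x.2.2.1 s a x.2.2.2 else 0

/-! ### Quantum mean estimation: amplitude estimation and median -/

section MeanEstimation

variable {S A J : Type*} [Fintype S] [DecidableEq S] [Fintype A] [DecidableEq A]
  [Fintype J] [DecidableEq J]

/-- The registers of the state preparation circuit: those of the generative model and a flag qubit. -/
abbrev PrepReg (S A J : Type*) := (S × A × S × J) × Bool

/-- One query to `O`, then a rotation of the flag qubit controlled on the sampled state. For
`0 ≤ v ≤ u` it maps `|s,a,s₀,j₀⟩|0⟩` to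
`|s,a⟩ ∑ₜ √p(t|s,a) |t⟩|ψ t s a⟩ (√(1 - v[t]/u) |0⟩ + √(v[t]/u) |1⟩)`, so that the flag is `1` with
probability `(p_{s,a}ᵀ v) / u`. -/
def prep (O : Matrix.unitaryGroup (S × A × S × J) ℂ) (u : ℝ) (v : S → ℝ) :
    Matrix.unitaryGroup (PrepReg S A J) ℂ :=
  ctrl (Equiv.prodComm _ _) (fun x : S × A × S × J => rotation (Real.arcsin √(v x.2.2.1 / u))) *
    onReg (Equiv.refl _) O

/-- The amplitude amplification operator
`prep (2|s₀,j₀,0⟩⟨s₀,j₀,0| - 1) prep⁻¹ (phase flip of flag 1)`. -/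
def ampOp (O : Matrix.unitaryGroup (S × A × S × J) ℂ) (s₀ : S) (j₀ : J) (u : ℝ) (v : S → ℝ) :
    Matrix.unitaryGroup (PrepReg S A J) ℂ :=
  prep O u v *
    flip (fun x : PrepReg S A J => ¬ (x.1.2.2.1 = s₀ ∧ x.1.2.2.2 = j₀ ∧ x.2 = false)) *
    (prep O u v)⁻¹ * flip (fun x : PrepReg S A J => x.2 = true)

/-- Amplitude estimation with `n + 1` evaluation points: phase estimation of `ampOp` on the state
produced by `prep`. Reading `y` from the last register, the estimate of the amplitude is
`sin² (π y / (n + 1))`. -/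
def ampEst (O : Matrix.unitaryGroup (S × A × S × J) ℂ) (s₀ : S) (j₀ : J) (u : ℝ) (v : S → ℝ)
    (n : ℕ) : Matrix.unitaryGroup (PrepReg S A J × Fin (n + 1)) ℂ :=
  (onReg (Equiv.prodComm _ _) (dft n))⁻¹ *
    ctrl (Equiv.refl _) (fun y : Fin (n + 1) => ampOp O s₀ j₀ u v ^ y.val) *
    onReg (Equiv.prodComm _ _) (dft n) *
    onReg (Equiv.refl _) (prep O u v)

/-- The workspace of one run of amplitude estimation. -/
abbrev RunReg (S J : Type*) (n : ℕ) := (S × J) × Bool × Fin (n + 1)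

/-- The registers of `2m + 1` runs of amplitude estimation on a common pair `(s, a)`. -/
abbrev EstReg (S J : Type*) (n m : ℕ) := S × (Fin (2 * m + 1) → RunReg S J n)

instance {S' J' : Type*} [DecidableEq S'] [DecidableEq J'] (n m : ℕ) :
    DecidableEq (EstReg S' J' n m) :=
  instDecidableEqProd

/-- The registers used by run number `i`, separated from the workspaces of the other runs. -/
def runEquiv (n m : ℕ) (i : Fin (2 * m + 1)) :
    A × EstReg S J n m ≃
      (PrepReg S A J × Fin (n + 1)) × ({j : Fin (2 * m + 1) // j ≠ i} → RunReg S J n) where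
  toFun x := ((((x.2.1, x.1, (x.2.2 i).1.1, (x.2.2 i).1.2), (x.2.2 i).2.1), (x.2.2 i).2.2),
    fun j => x.2.2 j)
  invFun z := (z.1.1.1.2.1, z.1.1.1.1, (Equiv.funSplitAt i (RunReg S J n)).symm
    (((z.1.1.1.2.2.1, z.1.1.1.2.2.2), z.1.1.2, z.1.2), z.2))
  left_inv x := by
    refine Prod.ext rfl (Prod.ext rfl ?_)
    exact (Equiv.funSplitAt i (RunReg S J n)).symm_apply_apply x.2.2
  right_inv z := by
    have h := (Equiv.funSplitAt i (RunReg S J n)).apply_symm_apply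
      (((z.1.1.1.2.2.1, z.1.1.1.2.2.2), z.1.1.2, z.1.2), z.2)
    have h1 := congrArg Prod.fst h
    have h2 := congrArg Prod.snd h
    simp only [Equiv.funSplitAt_apply] at h1 h2
    refine Prod.ext ?_ h2
    simp only [h1]

/-- `2m + 1` runs of amplitude estimation, coherently and on separate workspaces. -/
def estCircuit (O : Matrix.unitaryGroup (S × A × S × J) ℂ) (s₀ : S) (j₀ : J) (u : ℝ) (v : S → ℝ)
    (n m : ℕ) : Matrix.unitaryGroup (A × EstReg S J n m) ℂ :=
  (List.ofFn fun i : Fin (2 * m + 1) => onReg (runEquiv n m i) (ampEst O s₀ j₀ u v n)).prod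

/-- The median of an odd number of reals. -/
def median {m : ℕ} (x : Fin (2 * m + 1) → ℝ) : ℝ := x (Tuple.sort x ⟨m, by omega⟩)

/-- The estimate of the mean represented by a basis label of the registers of the `2m + 1` runs:
the median of the estimates of the single runs. -/
def estimate (u : ℝ) {n m : ℕ} (w : EstReg S J n m) : ℝ :=
  median fun i => u * Real.sin (Real.pi * ((w.2 i).2.2.val : ℝ) / (n + 1)) ^ 2

/-- Number of evaluation points (minus one) of a single run with range `u` and error `η`. -/
def numPoints (u η : ℝ) : ℕ := ⌈8 * u / η⌉₊

/-- `2 * numRuns f + 1` runs are used for failure probability `f`. -/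
def numRuns (f : ℝ) : ℕ := ⌈18 * Real.log (1 / f)⌉₊

end MeanEstimation

/-! ### Quantum oracles for real vectors and quantum maximum finding -/

/-- A (possibly faulty) quantum oracle for a vector in `ℝ^A`: a unitary `U` on `ℂ^A ⊗ ℂ^W`, an
initial label of the workspace, and the number `val (a, w)` that a basis label represents. It
encodes `q ∈ ℝ^A` exactly if `U |a⟩|init⟩` is supported on labels `(a, w)` with
`val (a, w) = q[a]`; in a faulty oracle other values may occur. -/
structure ValueOracle (A : Type*) [Fintype A] [DecidableEq A] where
  /-- basis labels of the workspace -/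
  W : Type*
  [fintypeW : Fintype W]
  [decEqW : DecidableEq W]
  /-- the circuit -/
  U : Matrix.unitaryGroup (A × W) ℂ
  /-- initial label of the workspace -/
  init : W
  /-- the number represented by a basis label -/
  val : A × W → ℝ

attribute [instance] ValueOracle.fintypeW ValueOracle.decEqW

namespace ValueOracle

variable {A : Type*} [Fintype A] [DecidableEq A]

/-- The exact oracle that encodes a known vector `q ∈ ℝ^A`. -/
def exact (q : A → ℝ) : ValueOracle A where
  W := PUnit
  U := 1
  init := PUnit.unit
  val x := q x.1

/-- `A^(-1/2) ∑ₐ |a⟩|init⟩`. -/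
def start (Q : ValueOracle A) : A × Q.W → ℂ :=
  fun x => if x.2 = Q.init then 1 / (Real.sqrt (Fintype.card A) : ℂ) else 0

theorem isState_start [Nonempty A] (Q : ValueOracle A) : IsState Q.start := by
  have hA : (0 : ℝ) < Fintype.card A := by exact_mod_cast Fintype.card_pos
  have : ∀ x : A × Q.W, ‖Q.start x‖ ^ 2 = if x.2 = Q.init then 1 / (Fintype.card A : ℝ) else 0 := by
    intro x
    unfold start
    split_ifs
    · rw [norm_div, norm_one, Complex.norm_real, Real.norm_of_nonneg (Real.sqrt_nonneg _), div_pow,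
        one_pow, Real.sq_sqrt hA.le]
    · simp
  unfold IsState
  simp only [this, Fintype.sum_prod_type, Finset.sum_ite_eq', Finset.mem_univ, if_true,
    Finset.sum_const, Finset.card_univ, nsmul_eq_mul]
  field_simp

variable [Nonempty A]

/-- The Grover iterate for threshold `t`: phase flip of the labels with value `> t`, then
the reflection about `U |start⟩`. -/
def grover (Q : ValueOracle A) (t : ℝ) : Matrix.unitaryGroup (A × Q.W) ℂ :=
  Q.U * reflection Q.start Q.isState_start * Q.U⁻¹ * flip (fun x => t < Q.val x)

/-- Measurement of all registers after `j` Grover iterations with threshold `t`. This uses the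
oracle `U` or its inverse `2j + 1` times. -/
def groverMeasure (Q : ValueOracle A) (t : ℝ) (j : ℕ) : PMF (A × Q.W) :=
  measure _ (Q.isState_start.mulVec (Q.grover t ^ j * Q.U))

/-- The exponential search bound `min ((6/5)^k, √A)` on the number of Grover iterations. -/
def searchBound (A : Type*) [Fintype A] (k : ℕ) : ℝ :=
  min ((6 / 5) ^ k) (Real.sqrt (Fintype.card A))

theorem range_searchBound_nonempty {A : Type*} [Fintype A] [Nonempty A] (k : ℕ) : (Finset.range ⌈searchBound A k⌉₊).Nonempty := by
  have hA : (0 : ℝ) < Fintype.card A := by exact_mod_cast Fintype.card_pos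
  rw [Finset.nonempty_range_iff, ← Nat.pos_iff_ne_zero, Nat.ceil_pos]
  exact lt_min (by positivity) (Real.sqrt_pos.2 hA)

/-- One round of maximum finding with query budget `B`. The state `(x, k, c)` consists of the best
outcome so far, the number `k` of consecutive unsuccessful rounds and the number `c` of queries
so far. The number `j` of Grover iterations is uniform among the nonnegative integers below
`searchBound A k`; nothing is measured (and the search has stopped) if the budget would be
exceeded. -/
def searchStep (Q : ValueOracle A) (B : ℝ) (σ : (A × Q.W) × ℕ × ℕ) :
    PMF ((A × Q.W) × ℕ × ℕ) :=
  (PMF.uniformOfFinset (Finset.range ⌈searchBound A σ.2.1⌉₊)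
      (range_searchBound_nonempty σ.2.1)).bind fun j =>
    if B < ((σ.2.2 + (2 * j + 1) : ℕ) : ℝ) then PMF.pure (σ.1, σ.2.1, σ.2.2 + (2 * j + 1))
    else (Q.groverMeasure (Q.val σ.1) j).map fun y =>
      if Q.val σ.1 < Q.val y then (y, 0, σ.2.2 + (2 * j + 1))
      else (σ.1, σ.2.1 + 1, σ.2.2 + (2 * j + 1))

/-- A number of rounds of maximum finding. -/
def searchLoop (Q : ValueOracle A) (B : ℝ) :
    ℕ → (A × Q.W) × ℕ × ℕ → PMF ((A × Q.W) × ℕ × ℕ)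
  | 0, σ => PMF.pure σ
  | n + 1, σ => (Q.searchStep B σ).bind (Q.searchLoop B n)

end ValueOracle

/-- The universal constant of quantum maximum finding. -/
def cMax : ℝ := 10000

/-- The query budget `c_max √A log(1/f)` of maximum finding. -/
def queryBudget (A : Type*) [Fintype A] (f : ℝ) : ℝ :=
  cMax * Real.sqrt (Fintype.card A) * Real.log (1 / f)

/-- Quantum maximum finding with failure probability `f`: the threshold is initialized
by measuring `U |start⟩` and then raised by exponential Grover search until the query
budget is exhausted (every round costs at least one query). The result is a basis label `x`; the
index found is `x.1` and its value, as read from the oracle, is `val x`. -/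
def qArgmax {A : Type*} [Fintype A] [DecidableEq A] [Nonempty A] (Q : ValueOracle A) (f : ℝ) :
    PMF (A × Q.W) :=
  ((Q.groverMeasure 0 0).bind fun x =>
    Q.searchLoop (queryBudget A f) ⌈queryBudget A f⌉₊ (x, 0, 1)).map Prod.fst

/-- The joint law of independent random variables with finitely many values. -/
def indep {ι : Type*} [Fintype ι] [DecidableEq ι] {β : ι → Type*} [∀ i, Fintype (β i)]
    (P : ∀ i, PMF (β i)) : PMF (∀ i, β i) :=
  PMF.ofFintype (fun x => ∏ i, P i (x i)) (by
    have h := (Finset.prod_univ_sum (fun i => (Finset.univ : Finset (β i))) fun i y => P i y).symm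
    rw [Fintype.piFinset_univ] at h
    rw [h]
    refine Finset.prod_eq_one fun i _ => ?_
    rw [← tsum_fintype (L := .unconditional _)]
    exact (P i).tsum_coe)

/-! ### The algorithm -/

section SolveMdp

variable {S A J : Type*} [Fintype S] [DecidableEq S] [Fintype A] [DecidableEq A] [Nonempty A]
  [Fintype J] [DecidableEq J]

/-- The number of iterations `L = ⌈Γ ⌈log (4Γ/ε)⌉⌉ + 1`. -/
def numIter (M : MDP S A) (ε : ℝ) : ℕ :=
  ⌈M.horizon * (⌈Real.log (4 * M.horizon / ε)⌉ : ℝ)⌉₊ + 1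

/-- The failure probability of the subroutines,
`f = δ / (4 c_max L S A^(3/2) ℓ)` with `ℓ = 2 log (4 c_max L S A^(3/2) / δ)`. -/
def failProb (M : MDP S A) (ε δ : ℝ) : ℝ :=
  δ / (4 * cMax * numIter M ε * Fintype.card S * (Fintype.card A : ℝ) ^ (3 / 2 : ℝ) *
    (2 * Real.log (4 * cMax * numIter M ε * Fintype.card S *
      (Fintype.card A : ℝ) ^ (3 / 2 : ℝ) / δ)))

/-- The estimation error `η = (1 - γ) ε / 4`. -/
def estError (M : MDP S A) (ε : ℝ) : ℝ := (1 - M.γ) * ε / 4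

/-- The quantum oracle for `q_{l,s}`, where `q_{l,s}[a] = max {r[s,a] + γ z_{l,s}[a], 0}` and
`z_{l,s}[a]` is the mean estimate of `(P v)[s,a]` with range `[0, Γ]`, error `η` and failure
probability `f`, minus `η`. -/
def qOracle (M : MDP S A) (O : Matrix.unitaryGroup (S × A × S × J) ℂ) (s₀ : S) (j₀ : J)
    (η f : ℝ) (v : S → ℝ) (s : S) : ValueOracle A where
  W := EstReg S J (numPoints M.horizon η) (numRuns f)
  U := estCircuit O s₀ j₀ M.horizon v (numPoints M.horizon η) (numRuns f)
  init := (s, fun _ => ((s₀, j₀), false, 0))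
  val x := max (M.r s x.1 + M.γ * (estimate M.horizon x.2 - η)) 0

/-- The oracles available after iteration `l`, at the end of which the value vector is `v`: the
exact oracle of `q_{0,s} = 0` for `l = 0`, and those built by mean estimation for `l ≥ 1`. -/
def oracleAt (M : MDP S A) (O : Matrix.unitaryGroup (S × A × S × J) ℂ) (s₀ : S) (j₀ : J)
    (η f : ℝ) : ℕ → (S → ℝ) → S → ValueOracle A
  | 0, _, _ => ValueOracle.exact fun _ => 0
  | _ + 1, v, s => qOracle M O s₀ j₀ η f v s

/-- The joint law of `(v_l, π_l)`. -/
def iterate (M : MDP S A) (O : Matrix.unitaryGroup (S × A × S × J) ℂ) (s₀ : S) (j₀ : J)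
    (η f : ℝ) (π₀ : S → A) : ℕ → PMF ((S → ℝ) × (S → A))
  | 0 => PMF.pure (fun _ => 0, π₀)
  | l + 1 => (iterate M O s₀ j₀ η f π₀ l).bind fun vπ =>
      (indep fun s => qArgmax (oracleAt M O s₀ j₀ η f l vπ.1 s) f).map fun x =>
        (fun s =>
          if vπ.1 s ≤ (oracleAt M O s₀ j₀ η f l vπ.1 s).val (x s)
          then (oracleAt M O s₀ j₀ η f l vπ.1 s).val (x s) else vπ.1 s,
        fun s =>
          if vπ.1 s ≤ (oracleAt M O s₀ j₀ η f l vπ.1 s).val (x s) then (x s).1 else vπ.2 s)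

/-- The law of the output `(v̂, π̂) = (v_L, π_L)` of the algorithm. -/
def solveMdp2 (M : MDP S A) (O : Matrix.unitaryGroup (S × A × S × J) ℂ) (s₀ : S) (j₀ : J)
    (ε δ : ℝ) (π₀ : S → A) : PMF ((S → ℝ) × (S → A)) :=
  iterate M O s₀ j₀ (estError M ε) (failProb M ε δ) π₀ (numIter M ε)

end SolveMdp

end QMDP

end

/-! ### Value functions: Bellman equation, maximum principle, contraction -/

noncomputable section

namespace QMDP

open Finset MeasureTheory ProbabilityTheory

namespace MDP

variable {S A : Type*}

/-! The algorithm is value iteration with one-sided errors. Call a round good if in every state the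
value `w` found for the action `a` satisfies `w ≤ r[s,a] + γ (P v)[s,a]` and, from the second round
on, `w ≥ r[s,b] + γ ((P v)[s,b] - 2η)` for all `b`. Since `v` never decreases, good rounds preserve
the inequality `v ≤ r + γ P v` along the current policy, even in states that keep their old action
(`Sound.succ`). A maximum principle turns it into `v ≤ v^π` (`MDP.le_value_of_le_update`). The lower
bound contracts `v* - v` by `γ` up to an error `2γη` (`MDP.optValue_sub_le`), so that after `L` good
rounds the gap is at most `ε/4 + ε/2`.

It remains to bound the probability that a call of maximum finding is not good. Both quantum
subroutines reduce to a rotation by `2θ` in the plane of a state and its marked part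
(`pow_mulVec_of_reflection`). For amplitude estimation this shows that the phase label has the
average of two phase estimation laws, at `θ` and `-θ`. One run is therefore wrong with probability
at most `1/4`, and the median with probability at most `f` (`sum_law_qOracle_err_le`).

A call can fail in two ways. It can return a label whose estimate is wrong by more than `η`, hence
possibly too large. Such labels have total probability at most `f` in `U|φ⟩`, but the search
amplifies large values. A round with `j` iterations amplifies by at most `(2j+1)²`; charged to the
`2j+1` queries of the round, this gives a failure probability of at most `f · 3√A · budget`
(`ValueOracle.qArgmax_bad_le`). The faulty oracle is never compared with an exact one. The call can
also stay below the target `q` given by the best action. Labels of value at least `q` have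
probability at least `1/(2A)`, since an accurate label of the best action reaches `q`. Exponential
search then needs `O(√A)` expected queries, and an exponential supermartingale turns this into an
exponential tail in `budget / √A` (`ValueOracle.qArgmax_lt_le`). The choice of `f` makes the sum of
both bounds at most `δ / (L S)` (`callError_le`), and a union bound over rounds and states finishes
the proof. -/

theorem horizon_pos (M : MDP S A) : 0 < M.horizon := inv_pos.2 (by linarith [M.γ_lt_one])

theorem one_sub_mul_horizon (M : MDP S A) : (1 - M.γ) * M.horizon = 1 :=
  mul_inv_cancel₀ (by linarith [M.γ_lt_one])

variable [Fintype S]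

/-- The expectation of `g` after one step with action `a` in state `s`. -/
def stepMean (M : MDP S A) (s : S) (a : A) (g : S → ℝ) : ℝ := ∑ t, (M.p s a t).toReal * g t

theorem sum_toReal_p (M : MDP S A) (s : S) (a : A) : ∑ t, (M.p s a t).toReal = 1 := by
  rw [← ENNReal.toReal_sum fun t _ => (M.p s a).apply_ne_top t,
    ← tsum_fintype (L := .unconditional _), (M.p s a).tsum_coe, ENNReal.toReal_one]

theorem stepMean_mono (M : MDP S A) (s : S) (a : A) {g h : S → ℝ} (hgh : ∀ t, g t ≤ h t) :
    M.stepMean s a g ≤ M.stepMean s a h :=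
  sum_le_sum fun t _ => mul_le_mul_of_nonneg_left (hgh t) ENNReal.toReal_nonneg

theorem stepMean_const (M : MDP S A) (s : S) (a : A) (c : ℝ) :
    M.stepMean s a (fun _ => c) = c := by
  rw [stepMean, ← sum_mul, sum_toReal_p, one_mul]

theorem stepMean_sub (M : MDP S A) (s : S) (a : A) (g h : S → ℝ) :
    M.stepMean s a (fun t => g t - h t) = M.stepMean s a g - M.stepMean s a h := by
  simp only [stepMean, mul_sub, sum_sub_distrib]

theorem stepMean_nonneg (M : MDP S A) (s : S) (a : A) {g : S → ℝ} (hg : ∀ t, 0 ≤ g t) :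
    0 ≤ M.stepMean s a g :=
  sum_nonneg fun t _ => mul_nonneg ENNReal.toReal_nonneg (hg t)

theorem stepMean_le (M : MDP S A) (s : S) (a : A) {g : S → ℝ} {c : ℝ} (hg : ∀ t, g t ≤ c) :
    M.stepMean s a g ≤ c :=
  (M.stepMean_mono s a hg).trans (M.stepMean_const s a c).le

theorem integral_trajectory_zero (M : MDP S A) (π : S → A) (s : S) (g : S → ℝ) :
    letI : MeasurableSpace S := ⊤
    ∫ ω, g (ω 0) ∂(M.trajectory π s) = g s := by
  let _ : MeasurableSpace S := ⊤
  have : DiscreteMeasurableSpace S := ⟨fun _ => trivial⟩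
  unfold trajectory
  have hm : Measurable fun ω : ℕ → S => g (ω 0) :=
    (measurable_from_top (f := g)).comp (measurable_pi_apply 0)
  rw [Kernel.integral_traj _ hm.aestronglyMeasurable]
  simp [Function.updateFinset]

instance (M : MDP S A) (π : S → A) (s : S) :
    @IsProbabilityMeasure _ (@MeasurableSpace.pi ℕ (fun _ => S) fun _ => ⊤)
      (M.trajectory π s) := by
  let _ : MeasurableSpace S := ⊤
  unfold trajectory
  infer_instance

/-- This is the Markov property. The law of the coordinates up to time `n + 1` is the law of those
up to `n` composed with a kernel that sees only the coordinate `n`; integrating out the last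
coordinate leaves a one-step mean. -/
theorem integral_trajectory_succ (M : MDP S A) (π : S → A) (s : S) (g : S → ℝ) (n : ℕ) :
    letI : MeasurableSpace S := ⊤
    ∫ ω, g (ω (n + 1)) ∂(M.trajectory π s) =
      ∫ ω, M.stepMean (ω n) (π (ω n)) g ∂(M.trajectory π s) := by
  let _ : MeasurableSpace S := ⊤
  have : DiscreteMeasurableSpace S := ⟨fun _ => trivial⟩
  have hg : Measurable g := measurable_from_top
  set κ : (n : ℕ) → Kernel ((i : Iic n) → S) S := fun n => (M.stepKernel π).comap
      (fun h : (i : Finset.Iic n) → S => h ⟨n, Finset.mem_Iic.2 le_rfl⟩) (measurable_pi_apply _)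
    with hκ
  have htraj : M.trajectory π s = Kernel.traj (X := fun _ => S) κ 0 (fun _ => s) := rfl
  have hstep : ∀ h : (i : Iic n) → S, ∫ y, g y ∂(κ n h) =
      M.stepMean (h ⟨n, mem_Iic.2 le_rfl⟩) (π (h ⟨n, mem_Iic.2 le_rfl⟩)) g := by
    intro h
    have : κ n h = (M.p (h ⟨n, mem_Iic.2 le_rfl⟩) (π (h ⟨n, mem_Iic.2 le_rfl⟩))).toMeasure := rfl
    rw [this, PMF.integral_eq_sum]
    rfl
  obtain ⟨C, hC⟩ : ∃ C, ∀ t, ‖g t‖ ≤ C := by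
    obtain ⟨C, hC⟩ := (Set.finite_range fun t => ‖g t‖).bddAbove
    exact ⟨C, fun t => hC ⟨t, rfl⟩⟩
  have hpc := Kernel.partialTraj_compProd_eq_map_traj (X := fun _ => S) (κ := κ) (Nat.zero_le n)
    (x₀ := fun _ => s)
  have h1 : ∫ ω, g (ω (n + 1)) ∂(M.trajectory π s) =
      ∫ x, g x.2 ∂((Kernel.partialTraj (X := fun _ => S) κ 0 n (fun _ => s)) ⊗ₘ (κ n)) := by
    have hgm : Measurable fun x : ((i : Iic n) → S) × S => g x.2 := hg.comp measurable_snd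
    rw [hpc, integral_map (Measurable.aemeasurable (by fun_prop)) hgm.aestronglyMeasurable, htraj]
  rw [h1, Measure.integral_compProd]
  · simp only [hstep]
    rw [← Kernel.traj_map_frestrictLe_apply (X := fun _ => S), integral_map, htraj]
    · rfl
    · exact (Preorder.measurable_frestrictLe n).aemeasurable
    · exact Measurable.aestronglyMeasurable ((measurable_from_top
        (f := fun t => M.stepMean t (π t) g)).comp (measurable_pi_apply _))
  · refine Integrable.of_bound (hg.comp measurable_snd).aestronglyMeasurable C ?_
    exact Filter.Eventually.of_forall fun x => hC _

/-- The expected reward of policy `π` at time `n`. -/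
def meanReward (M : MDP S A) (π : S → A) (n : ℕ) : S → ℝ :=
  (fun g s => M.stepMean s (π s) g)^[n] fun s => M.r s (π s)

theorem meanReward_succ (M : MDP S A) (π : S → A) (n : ℕ) (s : S) :
    M.meanReward π (n + 1) s = M.stepMean s (π s) (M.meanReward π n) := by
  rw [meanReward, Function.iterate_succ_apply']
  rfl

theorem meanReward_nonneg (M : MDP S A) (π : S → A) (n : ℕ) (s : S) :
    0 ≤ M.meanReward π n s := by
  induction n generalizing s with
  | zero => exact M.r_nonneg _ _
  | succ n ih => rw [meanReward_succ]; exact M.stepMean_nonneg _ _ ih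

theorem meanReward_le_one (M : MDP S A) (π : S → A) (n : ℕ) (s : S) :
    M.meanReward π n s ≤ 1 := by
  induction n generalizing s with
  | zero => exact M.r_le_one _ _
  | succ n ih => rw [meanReward_succ]; exact M.stepMean_le _ _ ih

theorem integral_trajectory_reward (M : MDP S A) (π : S → A) (s : S) (n : ℕ) :
    letI : MeasurableSpace S := ⊤
    ∫ ω, M.r (ω n) (π (ω n)) ∂(M.trajectory π s) = M.meanReward π n s := by
  let _ : MeasurableSpace S := ⊤
  -- The integrand is generalised because each step of the induction absorbs the last transition
  -- into it.
  have : ∀ (n : ℕ) (g : S → ℝ), ∫ ω, g (ω n) ∂(M.trajectory π s) =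
      ((fun g s => M.stepMean s (π s) g)^[n] g) s := by
    intro n
    induction n with
    | zero => exact fun g => M.integral_trajectory_zero π s g
    | succ n ih =>
      intro g
      rw [M.integral_trajectory_succ π s g n, Function.iterate_succ_apply]
      exact ih fun s => M.stepMean s (π s) g
  exact this n fun s => M.r s (π s)

theorem summable_discounted (M : MDP S A) (π : S → A) (s : S) :
    Summable fun n => M.γ ^ n * M.meanReward π n s := by
  refine Summable.of_nonneg_of_le
    (fun n => mul_nonneg (pow_nonneg M.γ_nonneg n) (M.meanReward_nonneg π n s)) (fun n => ?_)
    (summable_geometric_of_lt_one M.γ_nonneg M.γ_lt_one)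
  exact mul_le_of_le_one_right (pow_nonneg M.γ_nonneg n) (M.meanReward_le_one π n s)

/-- Integral and series may be exchanged since the `n`-th term is at most `γ ^ n`. From here on
values are series and no measure theory is needed. -/
theorem value_eq_tsum (M : MDP S A) (π : S → A) (s : S) :
    M.value π s = ∑' n, M.γ ^ n * M.meanReward π n s := by
  let _ : MeasurableSpace S := ⊤
  have hm : ∀ n, Measurable fun ω : ℕ → S => M.γ ^ n * M.r (ω n) (π (ω n)) := fun n =>
    (measurable_from_top (f := fun t => M.γ ^ n * M.r t (π t))).comp (measurable_pi_apply n)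
  have hb : ∀ n (ω : ℕ → S), ‖M.γ ^ n * M.r (ω n) (π (ω n))‖ ≤ M.γ ^ n := by
    intro n ω
    rw [Real.norm_of_nonneg (mul_nonneg (pow_nonneg M.γ_nonneg n) (M.r_nonneg _ _))]
    exact mul_le_of_le_one_right (pow_nonneg M.γ_nonneg n) (M.r_le_one _ _)
  have hi : ∀ n, Integrable (fun ω : ℕ → S => M.γ ^ n * M.r (ω n) (π (ω n)))
      (M.trajectory π s) := fun n =>
    Integrable.of_bound (hm n).aestronglyMeasurable (M.γ ^ n)
      (Filter.Eventually.of_forall fun ω => hb n ω)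
  have hsum : Summable fun n => ∫ ω, ‖M.γ ^ n * M.r (ω n) (π (ω n))‖ ∂(M.trajectory π s) := by
    refine Summable.of_nonneg_of_le (fun n => integral_nonneg fun ω => norm_nonneg _)
      (fun n => ?_) (summable_geometric_of_lt_one M.γ_nonneg M.γ_lt_one)
    calc _ ≤ ∫ ω, M.γ ^ n ∂(M.trajectory π s) :=
          integral_mono (hi n).norm (integrable_const _) fun ω => hb n ω
      _ = M.γ ^ n := by simp
  have h := integral_tsum_of_summable_integral_norm hi hsum
  rw [value, ← h]
  refine tsum_congr fun n => ?_
  rw [integral_const_mul, M.integral_trajectory_reward π s n]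

theorem value_eq (M : MDP S A) (π : S → A) (s : S) :
    M.value π s = M.r s (π s) + M.γ * M.stepMean s (π s) (M.value π) := by
  rw [value_eq_tsum, (M.summable_discounted π s).tsum_eq_zero_add]
  congr 1
  · simp [meanReward]
  · simp only [stepMean, value_eq_tsum, meanReward_succ]
    simp only [← tsum_mul_left]
    rw [← Summable.tsum_finsetSum fun t _ => ((M.summable_discounted π t).mul_left _),
      ← tsum_mul_left]
    refine tsum_congr fun n => ?_
    rw [mul_sum, mul_sum]
    refine sum_congr rfl fun t _ => ?_
    ring

theorem value_le_horizon (M : MDP S A) (π : S → A) (s : S) : M.value π s ≤ M.horizon := by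
  rw [value_eq_tsum, horizon, ← tsum_geometric_of_lt_one M.γ_nonneg M.γ_lt_one]
  refine (M.summable_discounted π s).tsum_le_tsum (fun n => ?_)
    (summable_geometric_of_lt_one M.γ_nonneg M.γ_lt_one)
  exact mul_le_of_le_one_right (pow_nonneg M.γ_nonneg n) (M.meanReward_le_one π n s)

/-- A vector that is at most its Bellman update for `π` is at most the value of `π`. -/
theorem le_value_of_le_update (M : MDP S A) (π : S → A) (v : S → ℝ)
    (h : ∀ s, v s ≤ M.r s (π s) + M.γ * M.stepMean s (π s) v) (s : S) : v s ≤ M.value π s := by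
  have : Nonempty S := ⟨s⟩
  -- Maximum principle: where the excess `d = v - v^π` is largest, subtracting the Bellman equation
  -- gives `d ≤ γ d`, hence `d ≤ 0`.
  obtain ⟨t, ht⟩ := Finite.exists_max fun t => v t - M.value π t
  suffices v t - M.value π t ≤ 0 by linarith [ht s]
  have h1 := h t
  have h2 := M.value_eq π t
  have h3 := M.stepMean_le t (π t) ht
  rw [stepMean_sub] at h3
  have h4 := mul_le_mul_of_nonneg_left h3 M.γ_nonneg
  have h5 := M.γ_lt_one
  nlinarith

theorem value_le_optValue [Fintype A] (M : MDP S A) (π : S → A) (s : S) :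
    M.value π s ≤ M.optValue s :=
  le_ciSup (f := fun π => M.value π s)
    ⟨M.horizon, by rintro _ ⟨π, rfl⟩; exact M.value_le_horizon π s⟩ π

theorem optValue_le [Nonempty A] (M : MDP S A) {s : S} {c : ℝ} (h : ∀ π, M.value π s ≤ c) :
    M.optValue s ≤ c :=
  ciSup_le h

/-- One step of approximate value iteration contracts the distance to the optimal value. -/
theorem optValue_sub_le [Fintype A] [Nonempty A] (M : MDP S A) {v w : S → ℝ} {c e : ℝ}
    (hv : ∀ s, M.optValue s - v s ≤ c)
    (hw : ∀ s a, M.r s a + M.γ * (M.stepMean s a v - e) ≤ w s) (s : S) :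
    M.optValue s - w s ≤ M.γ * (c + e) := by
  have : M.optValue s ≤ w s + M.γ * (c + e) := by
    -- Each policy is compared with `w` separately through its own Bellman equation, so neither an
    -- optimal policy nor the optimality equation is needed.
    refine M.optValue_le fun π => ?_
    have h1 := M.value_eq π s
    have h2 : M.stepMean s (π s) (fun t => M.value π t - v t) ≤ c :=
      M.stepMean_le s (π s) fun t => by linarith [M.value_le_optValue π t, hv t]
    rw [stepMean_sub] at h2
    have h3 := mul_le_mul_of_nonneg_left h2 M.γ_nonneg
    have h4 := hw s (π s)
    change M.value π s = M.r s (π s) + M.γ * M.stepMean s (π s) (fun t => M.value π t) at h1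
    nlinarith
  linarith

end MDP

end QMDP

end

/-! ### Action of the circuits on vectors; amplitude amplification -/

noncomputable section

namespace QMDP

open Finset Matrix

section Circuits

variable {I ι κ : Type*} [Fintype I] [DecidableEq I] [Fintype ι] [DecidableEq ι]
  [Fintype κ] [DecidableEq κ]

theorem ctrl_mulVec_apply (e : I ≃ ι × κ) (U : κ → Matrix.unitaryGroup ι ℂ) (ψ : I → ℂ) (i : I) :
    ((ctrl e U : Matrix I I ℂ) *ᵥ ψ) i =
      ((U (e i).2 : Matrix ι ι ℂ) *ᵥ fun x => ψ (e.symm (x, (e i).2))) (e i).1 := by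
  simp only [ctrl, mulVec, dotProduct, submatrix_apply, blockDiagonal_apply]
  rw [← e.symm.sum_comp, Fintype.sum_prod_type]
  simp

theorem onReg_mulVec_apply (e : I ≃ ι × κ) (U : Matrix.unitaryGroup ι ℂ) (ψ : I → ℂ) (i : I) :
    ((onReg e U : Matrix I I ℂ) *ᵥ ψ) i =
      ((U : Matrix ι ι ℂ) *ᵥ fun x => ψ (e.symm (x, (e i).2))) (e i).1 :=
  ctrl_mulVec_apply e (fun _ => U) ψ i

theorem onReg_inv (e : I ≃ ι × κ) (U : Matrix.unitaryGroup ι ℂ) :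
    (onReg e U)⁻¹ = onReg e U⁻¹ := by
  rw [inv_eq_iff_mul_eq_one]
  apply Subtype.ext
  refine Matrix.ext_iff_mulVec.2 fun ψ => ?_
  ext i
  rw [Matrix.UnitaryGroup.mul_val, ← mulVec_mulVec, onReg_mulVec_apply]
  simp only [onReg_mulVec_apply, Equiv.apply_symm_apply]
  rw [mulVec_mulVec, ← Matrix.UnitaryGroup.mul_val, mul_inv_cancel]
  simp

theorem flip_mulVec_apply (P : I → Prop) [DecidablePred P] (ψ : I → ℂ) (i : I) :
    ((flip P : Matrix I I ℂ) *ᵥ ψ) i = if P i then -ψ i else ψ i := by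
  rw [flip]
  simp only [mulVec_diagonal]
  by_cases h : P i <;> simp [h]

theorem reflection_mulVec (ψ : I → ℂ) (h : IsState ψ) (φ : I → ℂ) :
    (reflection ψ h : Matrix I I ℂ) *ᵥ φ = (2 * (star ψ ⬝ᵥ φ)) • ψ - φ := by
  simp only [reflection, sub_mulVec, smul_mulVec, one_mulVec, vecMulVec_mulVec]
  ext i
  simp
  ring

theorem mulVec_inv_mulVec (U : Matrix.unitaryGroup I ℂ) (ψ : I → ℂ) :
    (U : Matrix I I ℂ) *ᵥ ((U⁻¹ : Matrix.unitaryGroup I ℂ) : Matrix I I ℂ) *ᵥ ψ = ψ := by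
  rw [mulVec_mulVec, ← Matrix.UnitaryGroup.mul_val, mul_inv_cancel]
  simp

theorem inv_mulVec_mulVec (U : Matrix.unitaryGroup I ℂ) (ψ : I → ℂ) :
    ((U⁻¹ : Matrix.unitaryGroup I ℂ) : Matrix I I ℂ) *ᵥ (U : Matrix I I ℂ) *ᵥ ψ = ψ := by
  rw [mulVec_mulVec, ← Matrix.UnitaryGroup.mul_val, inv_mul_cancel]
  simp

theorem star_dotProduct_inv_mulVec (U : Matrix.unitaryGroup I ℂ) (ψ φ : I → ℂ) :
    star ψ ⬝ᵥ ((U⁻¹ : Matrix.unitaryGroup I ℂ) : Matrix I I ℂ) *ᵥ φ =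
      star ((U : Matrix I I ℂ) *ᵥ ψ) ⬝ᵥ φ := by
  rw [star_mulVec, ← dotProduct_mulVec]
  rfl

/-- The coefficients of the state after `j` rounds of amplitude amplification, relative to the
initial state, on the marked and on the unmarked labels. -/
def ampCoeff (θ : ℝ) : ℕ → ℝ × ℝ
  | 0 => (1, 1)
  | j + 1 =>
    (Real.cos (2 * θ) * (ampCoeff θ j).1 + 2 * Real.cos θ ^ 2 * (ampCoeff θ j).2,
      Real.cos (2 * θ) * (ampCoeff θ j).2 - 2 * Real.sin θ ^ 2 * (ampCoeff θ j).1)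

/-- The recursion is the addition theorem for the angle `2θ`. The product form stays meaningful when
`sin θ` or `cos θ` vanishes. -/
theorem ampCoeff_mul (θ : ℝ) (j : ℕ) :
    (ampCoeff θ j).1 * Real.sin θ = Real.sin ((2 * j + 1) * θ) ∧
      (ampCoeff θ j).2 * Real.cos θ = Real.cos ((2 * j + 1) * θ) := by
  induction j with
  | zero => simp [ampCoeff]
  | succ j ih =>
    have h : (2 * ((j + 1 : ℕ) : ℝ) + 1) * θ = (2 * j + 1) * θ + 2 * θ := by push_cast; ring
    rw [h, Real.sin_add, Real.cos_add, Real.sin_two_mul, ampCoeff, ← ih.1, ← ih.2]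
    constructor <;> simp only <;> ring

/-- Only the action of `R` on the span of `ψ` and its marked part matters. This covers the rank-one
reflection of Grover search as well as the reflection in amplitude estimation, which fixes one
vector for every pair `(s, a)`. -/
theorem pow_mulVec_of_reflection {R : Matrix I I ℂ} {P : I → Prop} [DecidablePred P] {ψ : I → ℂ} {θ : ℝ}
    (h1 : R *ᵥ ψ = ψ)
    (h2 : R *ᵥ (fun i => if P i then ψ i else 0) =
      ((2 * Real.sin θ ^ 2 : ℝ) : ℂ) • ψ - fun i => if P i then ψ i else 0) (j : ℕ) :
    (R * (flip P : Matrix I I ℂ)) ^ j *ᵥ ψ =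
      fun i => if P i then ((ampCoeff θ j).1 : ℂ) * ψ i else ((ampCoeff θ j).2 : ℂ) * ψ i := by
  induction j with
  | zero => simp [ampCoeff]
  | succ j ih =>
    rw [pow_succ', ← mulVec_mulVec, ih, ← mulVec_mulVec]
    have h3 : (flip P : Matrix I I ℂ) *ᵥ (fun i => if P i then ((ampCoeff θ j).1 : ℂ) * ψ i
        else ((ampCoeff θ j).2 : ℂ) * ψ i) = ((ampCoeff θ j).2 : ℂ) • ψ -
          (((ampCoeff θ j).1 : ℂ) + (ampCoeff θ j).2) • (fun i => if P i then ψ i else 0) := by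
      ext i
      rw [flip_mulVec_apply]
      by_cases h : P i
      · simp [h]; ring
      · simp [h]
    rw [h3, mulVec_sub, mulVec_smul, mulVec_smul, h1, h2]
    have hc : ((Real.cos (2 * θ) : ℝ) : ℂ) = 1 - 2 * (Real.sin θ : ℂ) ^ 2 := by
      rw [Real.cos_two_mul, Real.cos_sq']; push_cast; ring
    have hc2 : (Real.cos θ : ℂ) ^ 2 = 1 - (Real.sin θ : ℂ) ^ 2 := by
      rw [← Complex.ofReal_pow, Real.cos_sq']; push_cast; ring
    ext i
    simp only [ampCoeff, Pi.sub_apply, Pi.smul_apply, smul_eq_mul, Complex.ofReal_add,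
      Complex.ofReal_sub, Complex.ofReal_mul, Complex.ofReal_pow, hc, hc2, Complex.ofReal_ofNat]
    by_cases h : P i
    · simp only [h, if_true]; ring
    · simp only [h, if_false]; ring

end Circuits

theorem star_dotProduct_marked {I : Type*} [Fintype I] (P : I → Prop) [DecidablePred P] (ψ : I → ℂ) :
    star ψ ⬝ᵥ (fun i => if P i then ψ i else 0) =
      ((∑ i, if P i then ‖ψ i‖ ^ 2 else 0 : ℝ) : ℂ) := by
  simp only [dotProduct, Complex.ofReal_sum]
  refine sum_congr rfl fun i _ => ?_
  split_ifs
  · simp [Complex.conj_mul']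
  · simp

end QMDP

end

/-! ### Tail bound for the phase estimation kernel -/

noncomputable section

namespace QMDP

open Finset

/-- The amplitude of the outcome `y` in phase estimation with `n + 1` points, for an eigenvalue
`exp (2πi x / (n + 1))`. -/
def phaseAmp (n : ℕ) (x : ℝ) (y : Fin (n + 1)) : ℂ :=
  (∑ z ∈ range (n + 1), Complex.exp (Complex.I * ((2 * Real.pi * (x - y.val) / (n + 1) : ℝ) : ℂ)) ^ z) /
    (n + 1)

/-- The amplitude is a geometric sum with ratio `w` on the unit circle, so its numerator is at most
`2`. Shifting `y` by `k` periods brings it within half a period of `x`, where Jordan's inequality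
gives `‖w - 1‖ ≥ 4|d| / (n + 1)`. -/
theorem norm_phaseAmp_sq_le (n : ℕ) (x : ℝ) (y : Fin (n + 1)) (k : ℤ)
    (h : |x - (y.val + k * (n + 1))| ≤ (n + 1 : ℝ) / 2)
    (h0 : x - (y.val + k * (n + 1)) ≠ 0) :
    ‖phaseAmp n x y‖ ^ 2 ≤ 1 / (4 * (x - (y.val + k * (n + 1))) ^ 2) := by
  have hN : (0 : ℝ) < n + 1 := by positivity
  have hNc : ((n : ℂ) + 1) ≠ 0 := by exact_mod_cast hN.ne'
  set d : ℝ := x - (y.val + k * (n + 1)) with hd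
  set w : ℂ := Complex.exp (Complex.I * ((2 * Real.pi * (x - y.val) / (n + 1) : ℝ) : ℂ)) with hw
  have hw' : w = Complex.exp (Complex.I * ((2 * Real.pi * d / (n + 1) : ℝ) : ℂ)) := by
    have : Complex.I * ((2 * Real.pi * (x - y.val) / (n + 1) : ℝ) : ℂ) =
        Complex.I * ((2 * Real.pi * d / (n + 1) : ℝ) : ℂ) + k * (2 * Real.pi * Complex.I) := by
      rw [hd]; push_cast; field_simp; ring
    rw [hw, this, Complex.exp_add, Complex.exp_int_mul_two_pi_mul_I, mul_one]
  have hw1 : 4 * |d| / (n + 1) ≤ ‖w - 1‖ := by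
    have h2 : |Real.pi * d / (n + 1)| = Real.pi * |d| / (n + 1) := by
      rw [abs_div, abs_mul, abs_of_pos Real.pi_pos, abs_of_pos hN]
    have h3 : Real.pi * |d| / (n + 1) ≤ Real.pi / 2 := by
      rw [div_le_iff₀ hN]; nlinarith [Real.pi_pos]
    have h4 := Real.mul_le_sin (x := Real.pi * |d| / (n + 1)) (by positivity) h3
    rw [hw', Complex.norm_exp_I_mul_ofReal_sub_one, Real.norm_eq_abs, abs_mul, abs_two,
      show 2 * Real.pi * d / (n + 1) / 2 = Real.pi * d / (n + 1) by ring]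
    have h5 : Real.sin (Real.pi * |d| / (n + 1)) ≤ |Real.sin (Real.pi * d / (n + 1))| := by
      rw [← h2]
      rcases abs_cases (Real.pi * d / (n + 1)) with h | h
      · rw [h.1]; exact le_abs_self _
      · rw [h.1, Real.sin_neg]; exact neg_le_abs _
    have h6 : 2 / Real.pi * (Real.pi * |d| / (n + 1)) = 2 * |d| / (n + 1) := by
      field_simp
    rw [h6] at h4
    have h7 : 4 * |d| / (n + 1) = 2 * (2 * |d| / (n + 1)) := by ring
    rw [h7]; linarith
  have hd0 : 0 < |d| := abs_pos.2 h0
  have hpos : 0 < 4 * |d| / (n + 1) := by positivity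
  have hwne : w ≠ 1 := by
    intro h1; rw [h1, sub_self, norm_zero] at hw1; linarith
  have hnorm : ‖phaseAmp n x y‖ ≤ 1 / (2 * |d|) := by
    rw [phaseAmp, ← hw, geom_sum_eq hwne, norm_div, norm_div]
    have h8 : ‖w ^ (n + 1) - 1‖ ≤ 2 := by
      have hw2 : ‖w‖ = 1 := by rw [hw, Complex.norm_exp_I_mul_ofReal]
      calc _ ≤ ‖w ^ (n + 1)‖ + ‖(1 : ℂ)‖ := norm_sub_le _ _
        _ = 2 := by rw [norm_pow, hw2]; norm_num
    have h9 : ‖(n + 1 : ℂ)‖ = n + 1 := by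
      rw [← Nat.cast_add_one, Complex.norm_natCast]; push_cast; rfl
    rw [h9]
    calc ‖w ^ (n + 1) - 1‖ / ‖w - 1‖ / (n + 1) ≤ 2 / (4 * |d| / (n + 1)) / (n + 1) := by gcongr
      _ = 1 / (2 * |d|) := by field_simp; norm_num
  calc ‖phaseAmp n x y‖ ^ 2 ≤ (1 / (2 * |d|)) ^ 2 := by gcongr
    _ = 1 / (4 * d ^ 2) := by rw [div_pow, mul_pow, sq_abs]; norm_num

/-- Telescoping: `1/d² ≤ 1/(d² - 1/4) = 1/(d - 1/2) - 1/(d + 1/2)`. -/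
theorem sum_inv_sq_le (x c : ℝ) (hc : 1 / 2 < c) (Z : Finset ℤ) (hZ : ∀ z ∈ Z, c < z - x) :
    ∑ z ∈ Z, 1 / ((z : ℝ) - x) ^ 2 ≤ 1 / (c - 1 / 2) := by
  suffices ∀ a : ℤ, c < a - x → ∀ m : ℕ,
      ∑ i ∈ range m, 1 / (((a + i : ℤ) : ℝ) - x) ^ 2 ≤
        1 / (a - x - 1 / 2) - 1 / (a + m - x - 1 / 2) by
    rcases Z.eq_empty_or_nonempty with rfl | hne
    · simp; linarith
    set a := Z.min' hne
    set b := Z.max' hne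
    have ha : c < a - x := hZ _ (Z.min'_mem hne)
    have hm : (0 : ℝ) ≤ ((b - a + 1).toNat : ℝ) := by positivity
    have hsub : Z ⊆ (range (b - a + 1).toNat).image fun i : ℕ => a + (i : ℤ) := by
      intro z hz
      have h1 := Z.min'_le z hz
      have h2 := Z.le_max' z hz
      rw [mem_image]
      refine ⟨(z - a).toNat, ?_, ?_⟩
      · rw [mem_range]; omega
      · omega
    calc ∑ z ∈ Z, 1 / ((z : ℝ) - x) ^ 2
        ≤ ∑ z ∈ (range (b - a + 1).toNat).image (fun i : ℕ => a + (i : ℤ)),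
          1 / ((z : ℝ) - x) ^ 2 :=
          sum_le_sum_of_subset_of_nonneg hsub fun _ _ _ => by positivity
      _ = ∑ i ∈ range (b - a + 1).toNat, 1 / (((a + i : ℤ) : ℝ) - x) ^ 2 :=
          sum_image fun i _ j _ hij => by simpa using hij
      _ ≤ 1 / (a - x - 1 / 2) - 1 / (a + (b - a + 1).toNat - x - 1 / 2) := this a ha _
      _ ≤ 1 / (a - x - 1 / 2) := by
          have : 0 ≤ 1 / ((a : ℝ) + (b - a + 1).toNat - x - 1 / 2) := by
            apply one_div_nonneg.2; linarith
          linarith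
      _ ≤ 1 / (c - 1 / 2) := one_div_le_one_div_of_le (by linarith) (by linarith)
  intro a ha m
  induction m with
  | zero => simp
  | succ m ih =>
    rw [sum_range_succ]
    set d : ℝ := a + m - x with hd
    have hdc : c < d := by
      have : (0 : ℝ) ≤ m := by positivity
      linarith
    have h1 : 1 / (((a + m : ℤ) : ℝ) - x) ^ 2 ≤ 1 / (d - 1 / 2) - 1 / (d + 1 / 2) := by
      have h2 : ((a + m : ℤ) : ℝ) - x = d := by push_cast; rfl
      have h3 : 1 / (d - 1 / 2) - 1 / (d + 1 / 2) = 1 / ((d - 1 / 2) * (d + 1 / 2)) := by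
        have h5 : d - 1 / 2 ≠ 0 := by linarith
        have h6 : d + 1 / 2 ≠ 0 := by linarith
        rw [div_sub_div _ _ h5 h6]
        congr 1; ring
      rw [h2, h3]
      refine one_div_le_one_div_of_le (mul_pos (by linarith) (by linarith)) (by nlinarith)
    have h4 : (a : ℝ) + (m + 1 : ℕ) - x - 1 / 2 = d + 1 / 2 := by push_cast; rw [hd]; ring
    rw [h4]
    linarith

/-- Replacing each `y` by its representative nearest to `x` modulo `n + 1` is injective and gives
integers at distance more than `5/2` from `x`. Either side of `x` contributes at most `1/(5/2 - 1/2)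
= 1/2` to the sum of inverse squares, and each term carries a factor `1/4`. -/
theorem sum_norm_phaseAmp_sq_le (n : ℕ) (x : ℝ) (Y : Finset (Fin (n + 1)))
    (hY : ∀ y ∈ Y, ∀ k : ℤ, 5 / 2 < |x - (y.val + k * (n + 1))|) :
    ∑ y ∈ Y, ‖phaseAmp n x y‖ ^ 2 ≤ 1 / 4 := by
  have hN : (0 : ℝ) < n + 1 := by positivity
  set k : Fin (n + 1) → ℤ := fun y => round ((x - y.val) / (n + 1))
  set f : Fin (n + 1) → ℤ := fun y => y.val + k y * (n + 1)
  have hf : ∀ y, (f y : ℝ) = y.val + k y * (n + 1) := fun y => by simp [f]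
  have hfinj : Function.Injective f := by
    intro y y' h
    have h1 : (f y) % (n + 1) = (y.val : ℤ) := by
      rw [Int.add_mul_emod_self_right, Int.emod_eq_of_lt (by omega) (by omega)]
    have h2 : (f y') % (n + 1) = (y'.val : ℤ) := by
      rw [Int.add_mul_emod_self_right, Int.emod_eq_of_lt (by omega) (by omega)]
    rw [h, h2] at h1
    ext; exact_mod_cast h1.symm
  have hdist : ∀ y, |x - (y.val + k y * (n + 1))| ≤ (n + 1 : ℝ) / 2 := by
    intro y
    have h1 := abs_sub_round ((x - y.val) / (n + 1 : ℝ))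
    have h2 : x - (y.val + k y * (n + 1)) = ((x - y.val) / (n + 1) - k y) * (n + 1) := by
      field_simp; ring
    rw [h2, abs_mul, abs_of_pos hN]
    have := mul_le_mul_of_nonneg_right h1 hN.le
    linarith
  have hterm : ∀ y ∈ Y, ‖phaseAmp n x y‖ ^ 2 ≤ 1 / 4 * (1 / ((f y : ℝ) - x) ^ 2) := by
    intro y hy
    have h1 := hY y hy (k y)
    have h2 := norm_phaseAmp_sq_le n x y (k y) (hdist y) (by
      intro h; rw [h, abs_zero] at h1; linarith)
    rw [hf]
    calc _ ≤ _ := h2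
      _ = _ := by rw [← neg_sq (x - _), neg_sub, one_div_mul_one_div]
  have hsplit : ∑ z ∈ Y.image f, 1 / ((z : ℝ) - x) ^ 2 ≤ 1 := by
    rw [← sum_filter_add_sum_filter_not (Y.image f) fun z : ℤ => x < z]
    have habs : ∀ z ∈ Y.image f, 5 / 2 < |x - z| := by
      intro z hz
      obtain ⟨y, hy, rfl⟩ := mem_image.1 hz
      rw [hf]; exact hY y hy _
    have h1 := sum_inv_sq_le x (5 / 2) (by norm_num) ((Y.image f).filter fun z : ℤ => x < z) (by
      intro z hz
      obtain ⟨hz, hxz⟩ := mem_filter.1 hz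
      have := habs z hz
      rw [abs_of_neg (by linarith)] at this
      linarith)
    have h2 := sum_inv_sq_le (-x) (5 / 2) (by norm_num)
      (((Y.image f).filter fun z : ℤ => ¬ x < z).image fun z => -z) (by
      intro z hz
      obtain ⟨z', hz', rfl⟩ := mem_image.1 hz
      obtain ⟨hz, hxz⟩ := mem_filter.1 hz'
      have := habs z' hz
      rw [abs_of_nonneg (by linarith)] at this
      push_cast
      linarith)
    rw [sum_image fun i _ j _ hij => by simpa using hij] at h2
    have h3 : ∀ z : ℤ, 1 / (((-z : ℤ) : ℝ) - -x) ^ 2 = 1 / ((z : ℝ) - x) ^ 2 := by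
      intro z; push_cast; rw [← neg_sq]; ring_nf
    simp only [h3] at h2
    norm_num at h1 h2 ⊢
    linarith
  calc ∑ y ∈ Y, ‖phaseAmp n x y‖ ^ 2 ≤ ∑ y ∈ Y, 1 / 4 * (1 / ((f y : ℝ) - x) ^ 2) :=
        sum_le_sum hterm
    _ = 1 / 4 * ∑ z ∈ Y.image f, 1 / ((z : ℝ) - x) ^ 2 := by
        rw [← mul_sum, sum_image fun i _ j _ hij => hfinj hij]
    _ ≤ 1 / 4 := by linarith

end QMDP

end

/-! ### State preparation and the amplification operator -/

noncomputable section

namespace QMDP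

open Finset Matrix

section MeanEstimation

variable {S A J : Type*} [Fintype S] [DecidableEq S] [Fintype A] [DecidableEq A]
  [Fintype J] [DecidableEq J]

theorem prep_mulVec_single (O : Matrix.unitaryGroup (S × A × S × J) ℂ) (u : ℝ) (v : S → ℝ)
    (X : S × A × S × J) (x : PrepReg S A J) :
    ((prep O u v).1 *ᵥ Pi.single (X, false) 1) x =
      (O.1 *ᵥ Pi.single X 1) x.1 *
        ((if x.2 = true then Real.sin (Real.arcsin √(v x.1.2.2.1 / u))
          else Real.cos (Real.arcsin √(v x.1.2.2.1 / u)) : ℝ) : ℂ) := by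
  have h : ∀ y : PrepReg S A J, ((onReg (Equiv.refl (PrepReg S A J)) O).1 *ᵥ Pi.single (X, false) 1) y =
      if y.2 = false then (O.1 *ᵥ Pi.single X 1) y.1
      else 0 := by
    rintro ⟨y, b⟩
    rw [onReg_mulVec_apply]
    simp only [Equiv.refl_symm, Equiv.refl_apply]
    cases b
    · rw [if_pos rfl]
      congr 1
      ext z
      simp only [Pi.single_apply, Prod.mk.injEq, and_true]
    · rw [if_neg (by simp)]
      have : (fun z : S × A × S × J => (Pi.single (X, false) (1 : ℂ) : PrepReg S A J → ℂ)
          (z, true)) = 0 := by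
        ext z; simp
      rw [this, mulVec_zero, Pi.zero_apply]
  obtain ⟨x, b⟩ := x
  rw [prep, Matrix.UnitaryGroup.mul_val, ← mulVec_mulVec, ctrl_mulVec_apply]
  simp only [Equiv.prodComm_apply, Prod.swap_prod_mk, Equiv.prodComm_symm, rotation, mulVec,
    dotProduct, Fintype.univ_bool]
  have h1 := h (x, false)
  have h2 := h (x, true)
  simp only [mulVec, dotProduct] at h1 h2
  rw [sum_insert (by simp), sum_singleton, h1, h2]
  cases b <;> simp [mul_comm]

variable {M : MDP S A} {s₀ : S} {j₀ : J} {O : Matrix.unitaryGroup (S × A × S × J) ℂ}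

/-- The state prepared for the pair `(s, a)`. -/
def prepState (O : Matrix.unitaryGroup (S × A × S × J) ℂ) (s₀ : S) (j₀ : J) (u : ℝ) (v : S → ℝ)
    (s : S) (a : A) : PrepReg S A J → ℂ :=
  (prep O u v : Matrix (PrepReg S A J) (PrepReg S A J) ℂ) *ᵥ Pi.single ((s, a, s₀, j₀), false) 1

theorem isState_single {I : Type*} [Fintype I] [DecidableEq I] (i : I) :
    IsState (Pi.single i 1 : I → ℂ) := by
  rw [isState_iff]
  simp

theorem isState_prepState (u : ℝ) (v : S → ℝ) (s : S) (a : A) :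
    IsState (prepState O s₀ j₀ u v s a) :=
  (isState_single _).mulVec _

/-- The registers `s` and `a` are never altered; hence the states of different pairs have disjoint
supports and do not interfere. -/
theorem prepState_eq_zero (hO : IsGenerativeModel M s₀ j₀ O) (u : ℝ) (v : S → ℝ) (s : S) (a : A)
    (x : PrepReg S A J) (hx : ¬ (x.1.1 = s ∧ x.1.2.1 = a)) : prepState O s₀ j₀ u v s a x = 0 := by
  obtain ⟨ψ, -, h⟩ := hO
  rw [prepState, prep_mulVec_single, h]
  simp only [if_neg hx, zero_mul]

/-- The flag is raised with probability `(p_{s,a}ᵀ v) / u`. -/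
theorem sum_flag_prepState (hO : IsGenerativeModel M s₀ j₀ O) {u : ℝ} {v : S → ℝ} (hu : 0 < u)
    (hv0 : ∀ t, 0 ≤ v t) (hvu : ∀ t, v t ≤ u) (s : S) (a : A) :
    (∑ x, if x.2 = true then ‖prepState O s₀ j₀ u v s a x‖ ^ 2 else 0) =
      M.stepMean s a v / u := by
  obtain ⟨ψ, hψ, h⟩ := hO
  have hsin : ∀ t, Real.sin (Real.arcsin √(v t / u)) = √(v t / u) := fun t =>
    Real.sin_arcsin (by linarith [Real.sqrt_nonneg (v t / u)])
      (Real.sqrt_le_one.2 ((div_le_one hu).2 (hvu t)))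
  have hterm : ∀ (x : S × A × S × J), ‖prepState O s₀ j₀ u v s a (x, true)‖ ^ 2 =
      if x.1 = s then if x.2.1 = a then
        (M.p s a x.2.2.1).toReal * (v x.2.2.1 / u) * ‖ψ x.2.2.1 s a x.2.2.2‖ ^ 2 else 0 else 0 := by
    intro x
    rw [prepState, prep_mulVec_single, h]
    by_cases h1 : x.1 = s <;> by_cases h2 : x.2.1 = a
    · simp only [h1, h2, and_self, if_true, hsin, norm_mul, mul_pow, Complex.norm_real,
        Real.norm_eq_abs, sq_abs, Real.sq_sqrt ENNReal.toReal_nonneg,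
        Real.sq_sqrt (div_nonneg (hv0 _) hu.le)]
      ring
    all_goals simp [h1, h2]
  rw [Fintype.sum_prod_type]
  simp only [Fintype.sum_bool, if_true, Bool.false_eq_true, if_false, add_zero, hterm]
  simp only [Fintype.sum_prod_type, sum_ite_irrel, sum_const_zero, sum_ite_eq', mem_univ, if_true,
    ← mul_sum]
  rw [MDP.stepMean, sum_div]
  refine sum_congr rfl fun t _ => ?_
  rw [show ∑ j, ‖ψ t s a j‖ ^ 2 = 1 from hψ t s a]
  ring

/-- The reflection is about the span of the prepared states of all pairs `(s', a')`. Those of the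
other pairs are orthogonal to the flagged part of this one, so the rotation stays in the plane of a
single pair. -/
theorem ampOp_pow_mulVec (hO : IsGenerativeModel M s₀ j₀ O) (u : ℝ) (v : S → ℝ) (s : S) (a : A)
    {θ : ℝ} (hθ : (∑ x, if x.2 = true then ‖prepState O s₀ j₀ u v s a x‖ ^ 2 else 0) =
      Real.sin θ ^ 2) (k : ℕ) (x : PrepReg S A J) :
    ((ampOp O s₀ j₀ u v ^ k).1 *ᵥ prepState O s₀ j₀ u v s a) x =
      if x.2 = true then ((ampCoeff θ k).1 : ℂ) * prepState O s₀ j₀ u v s a x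
      else ((ampCoeff θ k).2 : ℂ) * prepState O s₀ j₀ u v s a x := by
  set ψ := prepState O s₀ j₀ u v s a with hψ
  set V := prep O u v with hV
  set Z : Matrix.unitaryGroup (PrepReg S A J) ℂ :=
    flip (fun x : PrepReg S A J => ¬ (x.1.2.2.1 = s₀ ∧ x.1.2.2.2 = j₀ ∧ x.2 = false)) with hZ
  set e : PrepReg S A J → ℂ := Pi.single ((s, a, s₀, j₀), false) 1 with he
  set g : PrepReg S A J → ℂ := fun x => if x.2 = true then ψ x else 0 with hg
  have hVe : V.1 *ᵥ e = ψ := rfl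
  have hmul : ∀ φ, (V * Z * V⁻¹).1 *ᵥ φ = V.1 *ᵥ Z.1 *ᵥ (V⁻¹).1 *ᵥ φ := by
    intro φ
    rw [Matrix.UnitaryGroup.mul_val, Matrix.UnitaryGroup.mul_val, ← mulVec_mulVec, ← mulVec_mulVec]
  have h1 : (V * Z * V⁻¹).1 *ᵥ ψ = ψ := by
    rw [hmul, ← hVe, inv_mulVec_mulVec]
    congr 1
    ext z
    rw [hZ, flip_mulVec_apply]
    split_ifs with hz
    · rfl
    · have : e z = 0 := by
        rw [he, Pi.single_apply, if_neg]
        rintro rfl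
        exact hz ⟨rfl, rfl, rfl⟩
      rw [this, neg_zero]
  have h2 : (V * Z * V⁻¹).1 *ᵥ g =
      ((2 * Real.sin θ ^ 2 : ℝ) : ℂ) • ψ - g := by
    set g' : PrepReg S A J → ℂ :=
      (V⁻¹).1 *ᵥ g with hg'
    -- These are all the components of `V⁻¹ g` whose sign the flip leaves unchanged; only the one of
    -- the pair `(s, a)` is allowed to be nonzero.
    have hcoef : ∀ s' a', g' ((s', a', s₀, j₀), false) =
        ((Real.sin θ ^ 2 : ℝ) : ℂ) * e ((s', a', s₀, j₀), false) := by
      intro s' a'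
      have h3 : g' ((s', a', s₀, j₀), false) = star (prepState O s₀ j₀ u v s' a') ⬝ᵥ g := by
        rw [prepState, ← star_dotProduct_inv_mulVec, ← Pi.single_star, star_one,
          single_one_dotProduct]
      rw [h3]
      by_cases hsa : s' = s ∧ a' = a
      · obtain ⟨rfl, rfl⟩ := hsa
        rw [hg, ← hψ, star_dotProduct_marked]
        rw [he, Pi.single_eq_same, mul_one, ← hθ]
      · have h4 : e ((s', a', s₀, j₀), false) = 0 := by
          rw [he, Pi.single_apply, if_neg]
          simp only [Prod.mk.injEq, and_true]
          exact hsa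
        rw [h4, mul_zero]
        refine sum_eq_zero fun x _ => ?_
        by_cases hx : x.1.1 = s ∧ x.1.2.1 = a
        · rw [Pi.star_apply, prepState_eq_zero hO, star_zero, zero_mul]
          rintro ⟨rfl, rfl⟩
          exact hsa hx
        · have : g x = 0 := by
            simp only [hg, hψ]
            rw [prepState_eq_zero hO _ _ _ _ _ hx, ite_self]
          rw [this, mul_zero]
    have h5 : Z.1 *ᵥ g' = ((2 * Real.sin θ ^ 2 : ℝ) : ℂ) • e - g' := by
      ext z
      rw [hZ, flip_mulVec_apply, Pi.sub_apply, Pi.smul_apply, smul_eq_mul]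
      split_ifs with hz
      · obtain ⟨⟨s', a', t, j⟩, b⟩ := z
        obtain ⟨rfl, rfl, rfl⟩ := hz
        rw [hcoef]
        push_cast
        ring
      · have : e z = 0 := by
          rw [he, Pi.single_apply, if_neg]
          rintro rfl
          exact hz ⟨rfl, rfl, rfl⟩
        rw [this, mul_zero, zero_sub]
    rw [hmul, h5, mulVec_sub, mulVec_smul, hVe, hg', mulVec_inv_mulVec]
  have h3 := pow_mulVec_of_reflection (P := fun x : PrepReg S A J => x.2 = true) h1 h2 k
  have h4 : (ampOp O s₀ j₀ u v ^ k).1 =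
      ((V * Z * V⁻¹).1 *
        (flip (fun x : PrepReg S A J => x.2 = true)).1) ^ k := by
    rw [← Matrix.UnitaryGroup.mul_val]
    rfl
  rw [h4, h3]

end MeanEstimation

end QMDP

end

/-! ### Error of one run of amplitude estimation -/

noncomputable section

namespace QMDP

open Finset Matrix

/-- Coefficient `y` of the inverse Fourier transform, as used in phase estimation, of `f`. -/
def phaseCoeff (n : ℕ) (f : ℕ → ℂ) (y : Fin (n + 1)) : ℂ :=
  (∑ z ∈ range (n + 1), Complex.exp (-(2 * Real.pi * Complex.I * z * y.val / (n + 1))) * f z) /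
    (n + 1)

/-- Of the odd multiple `2 z + 1`, the `1` gives only a global phase; the factor `2` makes the
measured position `(n + 1) θ / π`. -/
theorem phaseCoeff_exp (n : ℕ) (θ : ℝ) (y : Fin (n + 1)) :
    phaseCoeff n (fun z => Complex.exp (((2 * z + 1) * θ : ℝ) * Complex.I)) y =
      Complex.exp (θ * Complex.I) * phaseAmp n ((n + 1) * θ / Real.pi) y := by
  have hn : ((n : ℂ) + 1) ≠ 0 := by exact_mod_cast Nat.succ_ne_zero n
  have hpi : (Real.pi : ℂ) ≠ 0 := by exact_mod_cast Real.pi_ne_zero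
  rw [phaseCoeff, phaseAmp, ← mul_div_assoc, mul_sum]
  congr 1
  refine sum_congr rfl fun z _ => ?_
  rw [← Complex.exp_nat_mul, ← Complex.exp_add, ← Complex.exp_add]
  congr 1
  push_cast
  field_simp
  ring

/-- Sine and cosine are combinations of the exponentials at `θ` and `-θ`; the parallelogram law
removes the cross terms. -/
theorem phaseCoeff_sin_cos (n : ℕ) (θ : ℝ) (y : Fin (n + 1)) :
    ‖phaseCoeff n (fun z => (Real.sin ((2 * z + 1) * θ) : ℂ)) y‖ ^ 2 +
      ‖phaseCoeff n (fun z => (Real.cos ((2 * z + 1) * θ) : ℂ)) y‖ ^ 2 =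
    (‖phaseAmp n ((n + 1) * θ / Real.pi) y‖ ^ 2 + ‖phaseAmp n ((n + 1) * (-θ) / Real.pi) y‖ ^ 2) /
      2 := by
  set E := phaseCoeff n (fun z => Complex.exp (((2 * z + 1) * θ : ℝ) * Complex.I)) y with hE
  set F := phaseCoeff n (fun z => Complex.exp (((2 * z + 1) * (-θ) : ℝ) * Complex.I)) y with hF
  have hnE : ‖E‖ = ‖phaseAmp n ((n + 1) * θ / Real.pi) y‖ := by
    rw [hE, phaseCoeff_exp, norm_mul, Complex.norm_exp_ofReal_mul_I, one_mul]
  have hnF : ‖F‖ = ‖phaseAmp n ((n + 1) * (-θ) / Real.pi) y‖ := by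
    rw [hF, phaseCoeff_exp, norm_mul, Complex.norm_exp_ofReal_mul_I, one_mul]
  have hsin : phaseCoeff n (fun z => (Real.sin ((2 * z + 1) * θ) : ℂ)) y =
      (F - E) * Complex.I / 2 := by
    simp only [hE, hF, phaseCoeff, div_eq_mul_inv, sub_mul, sum_mul, ← sum_sub_distrib]
    refine sum_congr rfl fun z _ => ?_
    rw [Complex.ofReal_sin, Complex.sin]
    push_cast
    ring_nf
  have hcos : phaseCoeff n (fun z => (Real.cos ((2 * z + 1) * θ) : ℂ)) y = (F + E) / 2 := by
    simp only [hE, hF, phaseCoeff, div_eq_mul_inv, add_mul, sum_mul, ← sum_add_distrib]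
    refine sum_congr rfl fun z _ => ?_
    rw [Complex.ofReal_cos, Complex.cos]
    push_cast
    ring_nf
  have h := parallelogram_law_with_norm ℝ F E
  rw [hsin, hcos, norm_div, norm_div, norm_mul, Complex.norm_I, ← hnE, ← hnF, mul_one, div_pow,
    div_pow, show ‖(2 : ℂ)‖ = 2 by simp]
  nlinarith

theorem abs_sin_sq_sub_sin_sq_le (x y : ℝ) : |Real.sin x ^ 2 - Real.sin y ^ 2| ≤ |x - y| := by
  have h : Real.sin x ^ 2 - Real.sin y ^ 2 = Real.sin (x - y) * Real.sin (x + y) := by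
    rw [Real.sin_sub, Real.sin_add]
    linear_combination Real.sin y ^ 2 * Real.sin_sq_add_cos_sq x -
      Real.sin x ^ 2 * Real.sin_sq_add_cos_sq y
  rw [h, abs_mul]
  calc _ ≤ |Real.sin (x - y)| * 1 :=
        mul_le_mul_of_nonneg_left (Real.abs_sin_le_one _) (abs_nonneg _)
    _ ≤ |x - y| := by rw [mul_one]; exact Real.abs_sin_le_abs

/-- `sin²` is 1-Lipschitz with period `π`, and `k` periods of `y` shift the angle by `k π`. An error
above `8 / (n + 1)` thus forces `π |d| > 8`, and `8 / 3.15 > 5/2`. -/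
theorem five_half_lt_of_sin_sq (n : ℕ) (θ ε : ℝ) (hε : 8 / (n + 1 : ℝ) ≤ ε) (y : Fin (n + 1))
    (hy : ε < |Real.sin (Real.pi * (y.val : ℝ) / (n + 1)) ^ 2 - Real.sin θ ^ 2|) (k : ℤ) :
    5 / 2 < |(n + 1) * θ / Real.pi - (y.val + k * (n + 1))| := by
  have hN : (0 : ℝ) < n + 1 := by positivity
  set d := (n + 1) * θ / Real.pi - (y.val + k * (n + 1)) with hd
  have h1 : Real.sin (Real.pi * (y.val : ℝ) / (n + 1)) ^ 2 =
      Real.sin (Real.pi * (y.val : ℝ) / (n + 1) + k * Real.pi) ^ 2 := by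
    rcases Int.even_or_odd k with hk | hk
    · obtain ⟨m, rfl⟩ := hk
      rw [show Real.pi * (y.val : ℝ) / (n + 1) + ((m + m : ℤ) : ℝ) * Real.pi =
        Real.pi * (y.val : ℝ) / (n + 1) + m * (2 * Real.pi) by push_cast; ring,
        Real.sin_add_int_mul_two_pi]
    · obtain ⟨m, rfl⟩ := hk
      rw [show Real.pi * (y.val : ℝ) / (n + 1) + ((2 * m + 1 : ℤ) : ℝ) * Real.pi =
        Real.pi * (y.val : ℝ) / (n + 1) + Real.pi + m * (2 * Real.pi) by push_cast; ring,
        Real.sin_add_int_mul_two_pi, Real.sin_add_pi, neg_sq]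
  have h2 := abs_sin_sq_sub_sin_sq_le (Real.pi * (y.val : ℝ) / (n + 1) + k * Real.pi) θ
  have h3 : Real.pi * (y.val : ℝ) / (n + 1) + k * Real.pi - θ = -(Real.pi / (n + 1) * d) := by
    rw [hd]; field_simp; ring
  rw [h3, abs_neg, abs_mul, abs_of_pos (show 0 < Real.pi / (n + 1) by positivity)] at h2
  rw [h1] at hy
  have h4 : 8 / (n + 1 : ℝ) < Real.pi / (n + 1) * |d| := by linarith
  have h5 : Real.pi / (n + 1) * |d| = Real.pi * |d| / (n + 1) := by ring
  rw [h5, div_lt_div_iff_of_pos_right hN] at h4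
  nlinarith [Real.pi_lt_d2, abs_nonneg d]

section MeanEstimation

variable {S A J : Type*} [Fintype S] [DecidableEq S] [Fintype A] [DecidableEq A]
  [Fintype J] [DecidableEq J]
variable {M : MDP S A} {s₀ : S} {j₀ : J} {O : Matrix.unitaryGroup (S × A × S × J) ℂ}

/-- The state produced by one run of amplitude estimation for the pair `(s, a)`. -/
def ampEstState (O : Matrix.unitaryGroup (S × A × S × J) ℂ) (s₀ : S) (j₀ : J) (u : ℝ) (v : S → ℝ)
    (n : ℕ) (s : S) (a : A) : PrepReg S A J × Fin (n + 1) → ℂ :=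
  (ampEst O s₀ j₀ u v n).1 *ᵥ Pi.single (((s, a, s₀, j₀), false), 0) 1

theorem dft_zero_right (n : ℕ) (y : Fin (n + 1)) :
    (dft n).1 y 0 = 1 / (Real.sqrt (n + 1) : ℂ) := by
  simp [dft]

theorem dft_inv_apply (n : ℕ) (y z : Fin (n + 1)) :
    ((dft n)⁻¹).1 y z =
      Complex.exp (-(2 * Real.pi * Complex.I * z.val * y.val / (n + 1))) /
        (Real.sqrt (n + 1) : ℂ) := by
  change star ((dft n).1 z y) = _
  simp only [dft, of_apply]
  rw [star_div₀, Complex.star_def, ← Complex.exp_conj, Complex.conj_ofReal]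
  simp only [map_div₀, map_mul, map_add, Complex.conj_I, Complex.conj_ofReal, map_natCast,
    map_ofNat, map_one]
  congr 2
  ring

theorem ampEstState_apply_eq_sum (u : ℝ) (v : S → ℝ) (n : ℕ) (s : S) (a : A) (x : PrepReg S A J)
    (y : Fin (n + 1)) :
    ampEstState O s₀ j₀ u v n s a (x, y) =
      (∑ z : Fin (n + 1), Complex.exp (-(2 * Real.pi * Complex.I * z.val * y.val / (n + 1))) *
        ((ampOp O s₀ j₀ u v ^ z.val).1 *ᵥ prepState O s₀ j₀ u v s a) x) / (n + 1) := by
  have hs : (Real.sqrt (n + 1) : ℂ) * (Real.sqrt (n + 1) : ℂ) = n + 1 := by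
    rw [← Complex.ofReal_mul, Real.mul_self_sqrt (by positivity)]
    push_cast; ring
  have h1 : ∀ x y, ((onReg (Equiv.refl (PrepReg S A J × Fin (n + 1))) (prep O u v)).1 *ᵥ
      Pi.single (((s, a, s₀, j₀), false), 0) 1) (x, y) =
      if y = 0 then prepState O s₀ j₀ u v s a x else 0 := by
    intro x y
    rw [onReg_mulVec_apply]
    simp only [Equiv.refl_symm, Equiv.refl_apply]
    split_ifs with hy
    · subst hy
      rw [prepState]
      congr 1
      ext z
      simp only [Pi.single_apply, Prod.mk.injEq, and_true]
    · have : (fun z : PrepReg S A J => (Pi.single (((s, a, s₀, j₀), false), 0) (1 : ℂ) :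
          PrepReg S A J × Fin (n + 1) → ℂ) (z, y)) = 0 := by
        ext z; simp [hy]
      rw [this, mulVec_zero, Pi.zero_apply]
  have h2 : ∀ x y, ((onReg (Equiv.prodComm (PrepReg S A J) (Fin (n + 1))) (dft n)).1 *ᵥ
      (onReg (Equiv.refl (PrepReg S A J × Fin (n + 1))) (prep O u v)).1 *ᵥ
      Pi.single (((s, a, s₀, j₀), false), 0) 1) (x, y) =
      1 / (Real.sqrt (n + 1) : ℂ) * prepState O s₀ j₀ u v s a x := by
    intro x y
    rw [onReg_mulVec_apply]
    simp only [Equiv.prodComm_apply, Prod.swap_prod_mk, Equiv.prodComm_symm, h1]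
    simp only [mulVec, dotProduct, mul_ite, mul_zero, sum_ite_eq', mem_univ, if_true,
      dft_zero_right]
  rw [ampEstState, ampEst, onReg_inv, Matrix.UnitaryGroup.mul_val, Matrix.UnitaryGroup.mul_val,
    Matrix.UnitaryGroup.mul_val, ← mulVec_mulVec, ← mulVec_mulVec, ← mulVec_mulVec,
    onReg_mulVec_apply]
  simp only [Equiv.prodComm_apply, Prod.swap_prod_mk, Equiv.prodComm_symm, ctrl_mulVec_apply,
    Equiv.refl_symm, Equiv.refl_apply, h2]
  rw [mulVec, dotProduct, sum_div]
  refine sum_congr rfl fun z _ => ?_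
  have h3 : (fun x : PrepReg S A J => 1 / (Real.sqrt (n + 1) : ℂ) * prepState O s₀ j₀ u v s a x) =
      (1 / (Real.sqrt (n + 1) : ℂ)) • prepState O s₀ j₀ u v s a := rfl
  rw [dft_inv_apply, h3, mulVec_smul, Pi.smul_apply, smul_eq_mul, ← hs]
  ring

theorem isState_ampEstState (u : ℝ) (v : S → ℝ) (n : ℕ) (s : S) (a : A) :
    IsState (ampEstState O s₀ j₀ u v n s a) :=
  (isState_single _).mulVec _

theorem ampEstState_apply (hO : IsGenerativeModel M s₀ j₀ O) (u : ℝ) (v : S → ℝ) (n : ℕ) (s : S)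
    (a : A) {θ : ℝ} (hθ : (∑ x, if x.2 = true then ‖prepState O s₀ j₀ u v s a x‖ ^ 2 else 0) =
      Real.sin θ ^ 2) (x : PrepReg S A J) (y : Fin (n + 1)) :
    ampEstState O s₀ j₀ u v n s a (x, y) =
      phaseCoeff n (fun z => if x.2 = true then ((ampCoeff θ z).1 : ℂ) else (ampCoeff θ z).2) y *
        prepState O s₀ j₀ u v s a x := by
  rw [ampEstState_apply_eq_sum, phaseCoeff, div_mul_eq_mul_div, sum_mul,
    ← Fin.sum_univ_eq_sum_range (fun z => Complex.exp (-(2 * Real.pi * Complex.I * z * y.val /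
      (n + 1))) * (if x.2 = true then ((ampCoeff θ z).1 : ℂ) else (ampCoeff θ z).2) *
        prepState O s₀ j₀ u v s a x)]
  congr 1
  refine sum_congr rfl fun z _ => ?_
  rw [ampOp_pow_mulVec hO u v s a hθ]
  split_ifs <;> ring

/-- The flagged part of the initial state has mass `sin² θ` and the coefficient with `sin ((2z+1)θ)
/ sin θ`, the other part similarly with cosines. Summing the two masses gives the average of two
phase estimation laws, without diagonalising the operator. -/
theorem sum_norm_ampEstState_sq (hO : IsGenerativeModel M s₀ j₀ O) (u : ℝ) (v : S → ℝ) (n : ℕ)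
    (s : S) (a : A) {θ : ℝ}
    (hθ : (∑ x, if x.2 = true then ‖prepState O s₀ j₀ u v s a x‖ ^ 2 else 0) =
      Real.sin θ ^ 2) (y : Fin (n + 1)) :
    ∑ x, ‖ampEstState O s₀ j₀ u v n s a (x, y)‖ ^ 2 =
      (‖phaseAmp n ((n + 1) * θ / Real.pi) y‖ ^ 2 +
        ‖phaseAmp n ((n + 1) * (-θ) / Real.pi) y‖ ^ 2) / 2 := by
  set C := phaseCoeff n (fun z => ((ampCoeff θ z).1 : ℂ)) y with hC
  set D := phaseCoeff n (fun z => ((ampCoeff θ z).2 : ℂ)) y with hD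
  have hcos : (∑ x, if x.2 = true then 0 else ‖prepState O s₀ j₀ u v s a x‖ ^ 2) =
      Real.cos θ ^ 2 := by
    have h1 : ∑ x, ‖prepState O s₀ j₀ u v s a x‖ ^ 2 = 1 := isState_prepState u v s a
    have h2 : (∑ x, if x.2 = true then ‖prepState O s₀ j₀ u v s a x‖ ^ 2 else 0) +
        (∑ x, if x.2 = true then 0 else ‖prepState O s₀ j₀ u v s a x‖ ^ 2) = 1 := by
      rw [← sum_add_distrib, ← h1]
      refine sum_congr rfl fun x _ => ?_
      split_ifs <;> simp
    rw [hθ] at h2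
    linarith [Real.sin_sq_add_cos_sq θ]
  have hx : ∀ x : PrepReg S A J, ‖ampEstState O s₀ j₀ u v n s a (x, y)‖ ^ 2 =
      ‖C‖ ^ 2 * (if x.2 = true then ‖prepState O s₀ j₀ u v s a x‖ ^ 2 else 0) +
      ‖D‖ ^ 2 * (if x.2 = true then 0 else ‖prepState O s₀ j₀ u v s a x‖ ^ 2) := by
    intro x
    rw [ampEstState_apply hO u v n s a hθ, norm_mul, mul_pow]
    by_cases h : x.2 = true
    · simp only [h, if_true, mul_zero, add_zero, hC]
    · simp [h, hD]
  have hmul : ∀ (f : ℕ → ℂ) (c : ℂ), phaseCoeff n f y * c = phaseCoeff n (fun z => f z * c) y := by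
    intro f c
    rw [phaseCoeff, phaseCoeff, div_mul_eq_mul_div, sum_mul]
    simp only [mul_assoc]
  have hCs : ‖C‖ ^ 2 * Real.sin θ ^ 2 =
      ‖phaseCoeff n (fun z => (Real.sin ((2 * z + 1) * θ) : ℂ)) y‖ ^ 2 := by
    have : C * (Real.sin θ : ℂ) = phaseCoeff n (fun z => (Real.sin ((2 * z + 1) * θ) : ℂ)) y := by
      rw [hC, hmul]
      congr 1
      ext z
      rw [← (ampCoeff_mul θ z).1, Complex.ofReal_mul]
    rw [← this, norm_mul, mul_pow, Complex.norm_real, Real.norm_eq_abs, sq_abs]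
  have hDc : ‖D‖ ^ 2 * Real.cos θ ^ 2 =
      ‖phaseCoeff n (fun z => (Real.cos ((2 * z + 1) * θ) : ℂ)) y‖ ^ 2 := by
    have : D * (Real.cos θ : ℂ) = phaseCoeff n (fun z => (Real.cos ((2 * z + 1) * θ) : ℂ)) y := by
      rw [hD, hmul]
      congr 1
      ext z
      rw [← (ampCoeff_mul θ z).2, Complex.ofReal_mul]
    rw [← this, norm_mul, mul_pow, Complex.norm_real, Real.norm_eq_abs, sq_abs]
  simp only [hx]
  rw [sum_add_distrib, ← mul_sum, ← mul_sum, hθ, hcos, hCs, hDc, phaseCoeff_sin_cos]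

/-- One run of amplitude estimation errs by more than `8 / (n + 1)` with probability at most
`1 / 4`. -/
theorem sum_ampEstState_err_le (hO : IsGenerativeModel M s₀ j₀ O) (u : ℝ) (v : S → ℝ) (n : ℕ)
    (s : S) (a : A) {θ ε : ℝ}
    (hθ : (∑ x, if x.2 = true then ‖prepState O s₀ j₀ u v s a x‖ ^ 2 else 0) =
      Real.sin θ ^ 2) (hε : 8 / (n + 1 : ℝ) ≤ ε) :
    (∑ X : PrepReg S A J × Fin (n + 1),
      if ε < |Real.sin (Real.pi * (X.2.val : ℝ) / (n + 1)) ^ 2 - Real.sin θ ^ 2| then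
        ‖ampEstState O s₀ j₀ u v n s a X‖ ^ 2 else 0) ≤ 1 / 4 := by
  rw [Fintype.sum_prod_type_right]
  have h : ∀ y : Fin (n + 1), (∑ x : PrepReg S A J,
      if ε < |Real.sin (Real.pi * (y.val : ℝ) / (n + 1)) ^ 2 - Real.sin θ ^ 2| then
        ‖ampEstState O s₀ j₀ u v n s a (x, y)‖ ^ 2 else 0) =
      if ε < |Real.sin (Real.pi * (y.val : ℝ) / (n + 1)) ^ 2 - Real.sin θ ^ 2| then
        (‖phaseAmp n ((n + 1) * θ / Real.pi) y‖ ^ 2 +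
          ‖phaseAmp n ((n + 1) * (-θ) / Real.pi) y‖ ^ 2) / 2 else 0 := by
    intro y
    split_ifs
    · exact sum_norm_ampEstState_sq hO u v n s a hθ y
    · exact sum_const_zero
  simp only [h]
  rw [← sum_filter, ← sum_div, sum_add_distrib]
  have h1 := sum_norm_phaseAmp_sq_le n ((n + 1) * θ / Real.pi) (univ.filter fun y : Fin (n + 1) =>
    ε < |Real.sin (Real.pi * (y.val : ℝ) / (n + 1)) ^ 2 - Real.sin θ ^ 2|) (fun y hy k =>
      five_half_lt_of_sin_sq n θ ε hε y (mem_filter.1 hy).2 k)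
  have h2 := sum_norm_phaseAmp_sq_le n ((n + 1) * (-θ) / Real.pi)
    (univ.filter fun y : Fin (n + 1) =>
    ε < |Real.sin (Real.pi * (y.val : ℝ) / (n + 1)) ^ 2 - Real.sin θ ^ 2|) (fun y hy k =>
      five_half_lt_of_sin_sq n (-θ) ε hε y (by
        rw [Real.sin_neg, neg_sq]; exact (mem_filter.1 hy).2) k)
  linarith

end MeanEstimation

end QMDP

end

/-! ### The median of independent runs -/

noncomputable section

namespace QMDP

open Finset Matrix

/-- If the median is off on one side, then so are the `m + 1` entries from it outwards in sorted
order, a majority. -/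
theorem abs_median_sub_le {m : ℕ} (x : Fin (2 * m + 1) → ℝ) (μ η : ℝ)
    (h : (univ.filter fun i => η < |x i - μ|).card ≤ m) : |median x - μ| ≤ η := by
  by_contra! hlt
  set σ := Tuple.sort x
  have hmono : Monotone (x ∘ σ) := Tuple.monotone_sort x
  set c : Fin (2 * m + 1) := ⟨m, by omega⟩ with hc
  have hmed : median x = x (σ c) := rfl
  rw [hmed] at hlt
  suffices ∃ T : Finset (Fin (2 * m + 1)), m + 1 ≤ T.card ∧ ∀ i ∈ T, η < |x (σ i) - μ| by
    obtain ⟨T, hT, hT'⟩ := this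
    have h1 : T.image σ ⊆ univ.filter fun i => η < |x i - μ| := by
      intro i hi
      obtain ⟨j, hj, rfl⟩ := mem_image.1 hi
      exact mem_filter.2 ⟨mem_univ _, hT' j hj⟩
    have h2 := card_le_card h1
    rw [card_image_of_injective _ σ.injective] at h2
    omega
  rcases lt_abs.1 hlt with h1 | h1
  · refine ⟨Ici c, ?_, fun i hi => ?_⟩
    · rw [Fin.card_Ici, hc]; simp; omega
    · have : x (σ c) ≤ x (σ i) := hmono (mem_Ici.1 hi)
      exact lt_abs.2 (Or.inl (by linarith))
  · refine ⟨Iic c, ?_, fun i hi => ?_⟩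
    · rw [Fin.card_Iic, hc]
    · have : x (σ i) ≤ x (σ c) := hmono (mem_Iic.1 hi)
      exact lt_abs.2 (Or.inr (by linarith))

/-- If a single run fails with probability at most `1/4`, then the majority of `2m + 1` independent
runs fails with exponentially small probability. -/
theorem sum_majority_le {κ : Type*} [Fintype κ] (D : κ → ℝ) (hD : ∀ x, 0 ≤ D x)
    (hD1 : ∑ x, D x = 1) (bad : κ → Prop) [DecidablePred bad]
    (hbad : (∑ x, if bad x then D x else 0) ≤ 1 / 4) (m : ℕ) :
    (∑ w : Fin (2 * m + 1) → κ, if m < (univ.filter fun i => bad (w i)).card then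
      ∏ i, D (w i) else 0) ≤ (3 / 4 : ℝ) ^ m := by
  -- Exponential Markov inequality with weight `3` per bad run. One run has mean weight at most `1 +
  -- 2/4 = 3/2`, a bad majority has weight at least `3 ^ (m + 1)`, and `(3/2) ^ (2m+1) / 3 ^ (m+1) =
  -- (3/4) ^ m / 2`.
  have h1 : ∀ w : Fin (2 * m + 1) → κ,
      3 ^ (m + 1) * (if m < (univ.filter fun i => bad (w i)).card then ∏ i, D (w i) else 0) ≤
        ∏ i, (D (w i) * if bad (w i) then 3 else 1) := by
    intro w
    have h0 : 0 ≤ ∏ i, D (w i) := prod_nonneg fun i _ => hD _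
    rw [prod_mul_distrib, prod_ite, prod_const, prod_const_one, mul_one, mul_comm]
    split_ifs with h
    · exact mul_le_mul_of_nonneg_left (pow_le_pow_right₀ (by norm_num) h) h0
    · rw [zero_mul]; positivity
  have h2 : ∑ w : Fin (2 * m + 1) → κ, ∏ i, (D (w i) * if bad (w i) then 3 else 1) =
      (∑ x, D x * if bad x then 3 else 1) ^ (2 * m + 1) := by
    rw [Fintype.sum_pow]
  have h3 : (∑ x, D x * if bad x then (3 : ℝ) else 1) ≤ 3 / 2 := by
    have : ∀ x, D x * (if bad x then (3 : ℝ) else 1) = D x + 2 * if bad x then D x else 0 := by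
      intro x; split_ifs <;> ring
    simp only [this]
    rw [sum_add_distrib, ← mul_sum, hD1]
    linarith
  have h4 : 0 ≤ ∑ x, D x * if bad x then (3 : ℝ) else 1 :=
    sum_nonneg fun x _ => mul_nonneg (hD x) (by split_ifs <;> norm_num)
  have h5 := sum_le_sum fun w (_ : w ∈ univ) => h1 w
  rw [← mul_sum, h2] at h5
  have h6 := h5.trans (pow_le_pow_left₀ h4 h3 (2 * m + 1))
  have h7 : (3 / 2 : ℝ) ^ (2 * m + 1) = 3 ^ (m + 1) * ((3 / 4) ^ m * (1 / 2)) := by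
    rw [pow_succ, pow_mul, show ((3 : ℝ) / 2) ^ 2 = 3 * (3 / 4) by norm_num, mul_pow]
    ring
  rw [h7] at h6
  have h8 := le_of_mul_le_mul_left h6 (by positivity)
  have : (0 : ℝ) ≤ (3 / 4) ^ m := by positivity
  linarith

theorem pow_numRuns_le {f : ℝ} (hf : 0 < f) (hf1 : f ≤ 1) : (3 / 4 : ℝ) ^ numRuns f ≤ f := by
  have hlog : 0 ≤ Real.log (1 / f) := Real.log_nonneg (by rwa [le_div_iff₀ hf, one_mul])
  -- With this base the constant `18` leaves room: `18 / 4` already exceeds the factor `1` that is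
  -- needed.
  have h1 : (3 / 4 : ℝ) ≤ Real.exp (-(1 / 4)) := by
    have := Real.add_one_le_exp (-(1 / 4 : ℝ)); linarith
  have h2 : 18 * Real.log (1 / f) ≤ numRuns f := Nat.le_ceil _
  calc (3 / 4 : ℝ) ^ numRuns f ≤ Real.exp (-(1 / 4)) ^ numRuns f := by gcongr
    _ = Real.exp (numRuns f * -(1 / 4)) := (Real.exp_nat_mul _ _).symm
    _ ≤ Real.exp (-Real.log (1 / f)) := by
        apply Real.exp_le_exp.2; nlinarith
    _ = f := by rw [one_div, Real.log_inv, neg_neg, Real.exp_log hf]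

section MeanEstimation

variable {S A J : Type*} [Fintype S] [DecidableEq S] [Fintype A] [DecidableEq A]
  [Fintype J] [DecidableEq J]
variable {M : MDP S A} {s₀ : S} {j₀ : J} {O : Matrix.unitaryGroup (S × A × S × J) ℂ}

theorem exists_angle (u : ℝ) (v : S → ℝ) (s : S) (a : A) :
    ∃ θ, (∑ x, if x.2 = true then ‖prepState O s₀ j₀ u v s a x‖ ^ 2 else 0) =
      Real.sin θ ^ 2 := by
  set p := ∑ x, if x.2 = true then ‖prepState O s₀ j₀ u v s a x‖ ^ 2 else 0 with hp
  have h0 : 0 ≤ p := sum_nonneg fun x _ => by split_ifs <;> positivity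
  have h1 : p ≤ 1 := by
    rw [← show ∑ x, ‖prepState O s₀ j₀ u v s a x‖ ^ 2 = 1 from isState_prepState u v s a]
    exact sum_le_sum fun x _ => by split_ifs <;> [rfl; positivity]
  refine ⟨Real.arcsin √p, ?_⟩
  rw [Real.sin_arcsin (by linarith [Real.sqrt_nonneg p]) (Real.sqrt_le_one.2 h1), Real.sq_sqrt h0]

theorem ampEstState_eq_zero (hO : IsGenerativeModel M s₀ j₀ O) (u : ℝ) (v : S → ℝ) (n : ℕ) (s : S)
    (a : A) (X : PrepReg S A J × Fin (n + 1)) (hX : ¬ (X.1.1.2.1 = a ∧ X.1.1.1 = s)) :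
    ampEstState O s₀ j₀ u v n s a X = 0 := by
  obtain ⟨θ, hθ⟩ := exists_angle (O := O) (s₀ := s₀) (j₀ := j₀) u v s a
  rw [ampEstState_apply hO u v n s a hθ, prepState_eq_zero hO _ _ _ _ _ fun h => hX h.symm,
    mul_zero]

/-- The state of the workspace of one run of amplitude estimation for the pair `(s, a)`. -/
def runState (O : Matrix.unitaryGroup (S × A × S × J) ℂ) (s₀ : S) (j₀ : J) (u : ℝ) (v : S → ℝ)
    (n : ℕ) (s : S) (a : A) : RunReg S J n → ℂ :=
  fun w => ampEstState O s₀ j₀ u v n s a (((s, a, w.1.1, w.1.2), w.2.1), w.2.2)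

theorem sum_runState (hO : IsGenerativeModel M s₀ j₀ O) (u : ℝ) (v : S → ℝ) (n : ℕ) (s : S)
    (a : A) (c : Fin (n + 1) → Prop) [DecidablePred c] :
    (∑ w : RunReg S J n, if c w.2.2 then ‖runState O s₀ j₀ u v n s a w‖ ^ 2 else 0) =
      ∑ X : PrepReg S A J × Fin (n + 1),
        if c X.2 then ‖ampEstState O s₀ j₀ u v n s a X‖ ^ 2 else 0 := by
  symm
  simp only [Fintype.sum_prod_type]
  rw [Fintype.sum_eq_single s, Fintype.sum_eq_single a]
  · rfl
  · intro a' ha'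
    refine sum_eq_zero fun _ _ => sum_eq_zero fun _ _ => sum_eq_zero fun _ _ =>
      sum_eq_zero fun _ _ => ?_
    rw [ampEstState_eq_zero hO _ _ _ _ _ _ fun h => ha' h.1]
    simp
  · intro s' hs'
    refine sum_eq_zero fun _ _ => sum_eq_zero fun _ _ => sum_eq_zero fun _ _ =>
      sum_eq_zero fun _ _ => sum_eq_zero fun _ _ => ?_
    rw [ampEstState_eq_zero hO _ _ _ _ _ _ fun h => hs' h.2]
    simp

theorem isState_runState (hO : IsGenerativeModel M s₀ j₀ O) (u : ℝ) (v : S → ℝ) (n : ℕ) (s : S)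
    (a : A) : IsState (runState O s₀ j₀ u v n s a) := by
  have h := sum_runState hO u v n s a fun _ => True
  simp only [if_true] at h
  rw [IsState, h]
  exact isState_ampEstState u v n s a

/-- The state of the estimation registers for the pair `(s, a)` after the runs in `l`. -/
def estState (O : Matrix.unitaryGroup (S × A × S × J) ℂ) (s₀ : S) (j₀ : J) (u : ℝ) (v : S → ℝ)
    (n m : ℕ) (s : S) (a : A) (l : List (Fin (2 * m + 1))) : A × EstReg S J n m → ℂ :=
  fun X => if X.1 = a ∧ X.2.1 = s then
    ∏ i, (if i ∈ l then runState O s₀ j₀ u v n s a (X.2.2 i)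
      else if X.2.2 i = ((s₀, j₀), false, 0) then 1 else 0) else 0

/-- With the workspaces of the other runs fixed, the state is a multiple of the initial basis vector
of run `i`. As the run keeps `s` and `a`, the product form survives and the runs can be added one at
a time. -/
theorem onReg_runEquiv_mulVec_estState (hO : IsGenerativeModel M s₀ j₀ O) (u : ℝ) (v : S → ℝ)
    (n m : ℕ) (s : S) (a : A) (i : Fin (2 * m + 1)) (l : List (Fin (2 * m + 1))) (hi : i ∉ l) :
    (onReg (runEquiv n m i) (ampEst O s₀ j₀ u v n)).1 *ᵥ estState O s₀ j₀ u v n m s a l =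
      estState O s₀ j₀ u v n m s a (i :: l) := by
  ext X
  rw [onReg_mulVec_apply]
  set F : Fin (2 * m + 1) → ℂ := fun j => if j ∈ l then runState O s₀ j₀ u v n s a (X.2.2 j)
      else if X.2.2 j = ((s₀, j₀), false, 0) then 1 else 0 with hF
  have h1 : (fun x => estState O s₀ j₀ u v n m s a l
      ((runEquiv n m i).symm (x, (runEquiv n m i X).2))) =
      (∏ j : {j // j ≠ i}, F j) • Pi.single (((s, a, s₀, j₀), false), 0) 1 := by
    ext ⟨⟨⟨s', a', t, j⟩, b⟩, y⟩
    simp only [estState, runEquiv, Equiv.coe_fn_symm_mk, Equiv.coe_fn_mk]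
    rw [Fintype.prod_eq_mul_prod_subtype_ne _ i]
    have h2 : ∀ k : {k // k ≠ i}, (Equiv.funSplitAt i (RunReg S J n)).symm
        (((t, j), b, y), fun k => X.2.2 k.1) k.1 = X.2.2 k.1 := by
      intro k
      rw [Equiv.funSplitAt_symm_apply, dif_neg k.2]
    simp only [h2, hi, if_false]
    have h7 : (Equiv.funSplitAt i (RunReg S J n)).symm
        (((t, j), b, y), fun k => X.2.2 k.1) i = ((t, j), b, y) := by
      rw [Equiv.funSplitAt_symm_apply, dif_pos rfl]
    simp only [h7, Pi.smul_apply, Pi.single_apply, smul_eq_mul, Prod.mk.injEq]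
    by_cases h3 : a' = a <;> by_cases h4 : s' = s <;> by_cases h5 : t = s₀ <;>
      by_cases h6 : j = j₀ <;> simp [h3, h4, h5, h6, hF]
  rw [h1, mulVec_smul, Pi.smul_apply, smul_eq_mul]
  change _ * ampEstState O s₀ j₀ u v n s a _ = _
  simp only [estState, runEquiv, Equiv.coe_fn_mk]
  split_ifs with h
  · obtain ⟨h2, h3⟩ := h
    rw [Fintype.prod_eq_mul_prod_subtype_ne _ i, mul_comm, h2, h3]
    congr 1
    · simp [runState]
    · refine Fintype.prod_congr _ _ fun j => ?_
      simp [hF, j.2]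
  · rw [ampEstState_eq_zero hO _ _ _ _ _ _ h, mul_zero]

theorem estCircuit_mulVec_single (hO : IsGenerativeModel M s₀ j₀ O) (u : ℝ) (v : S → ℝ)
    (n m : ℕ) (s : S) (a : A) (X : A × EstReg S J n m) :
    ((estCircuit O s₀ j₀ u v n m).1 *ᵥ Pi.single (a, s, fun _ => ((s₀, j₀), false, 0)) 1) X =
      if X.1 = a ∧ X.2.1 = s then ∏ i, runState O s₀ j₀ u v n s a (X.2.2 i) else 0 := by
  have h : ∀ l : List (Fin (2 * m + 1)), l.Nodup →
      ((l.map fun i => onReg (runEquiv n m i) (ampEst O s₀ j₀ u v n)).prod).1 *ᵥ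
        estState O s₀ j₀ u v n m s a [] = estState O s₀ j₀ u v n m s a l := by
    intro l
    induction l with
    | nil => intro _; simp
    | cons i l ih =>
      intro hl
      rw [List.nodup_cons] at hl
      rw [List.map_cons, List.prod_cons, Matrix.UnitaryGroup.mul_val, ← mulVec_mulVec, ih hl.2,
        onReg_runEquiv_mulVec_estState hO _ _ _ _ _ _ _ _ hl.1]
  have h0 : (Pi.single (a, s, fun _ => ((s₀, j₀), false, 0)) 1 : A × EstReg S J n m → ℂ) =
      estState O s₀ j₀ u v n m s a [] := by
    ext ⟨a', s', w⟩
    simp only [estState, Pi.single_apply, Prod.mk.injEq, List.not_mem_nil, if_false,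
      prod_ite_zero, prod_const_one, mem_univ, forall_true_left, funext_iff]
    by_cases h1 : a' = a <;> by_cases h2 : s' = s <;> simp [h1, h2]
  rw [h0, estCircuit, List.ofFn_eq_map, h _ (List.nodup_finRange _)]
  simp [estState]

end MeanEstimation

end QMDP

end

/-! ### Measurement laws of the oracles -/

noncomputable section

namespace QMDP

open Finset Matrix

namespace ValueOracle

variable {A : Type*} [Fintype A] [DecidableEq A]

/-- The probability of the label `y` when `U |start⟩` is measured. -/
def law (Q : ValueOracle A) (y : A × Q.W) : ℝ := ‖(Q.U.1 *ᵥ Q.start) y‖ ^ 2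

theorem law_nonneg (Q : ValueOracle A) (y : A × Q.W) : 0 ≤ Q.law y := by
  unfold law; positivity

theorem law_eq (Q : ValueOracle A) (y : A × Q.W) :
    Q.law y = (1 / Fintype.card A) * ‖∑ a, (Q.U.1 *ᵥ Pi.single (a, Q.init) 1) y‖ ^ 2 := by
  have h : Q.start = (1 / (Real.sqrt (Fintype.card A) : ℂ)) • ∑ a, Pi.single (a, Q.init) 1 := by
    ext ⟨a, w⟩
    simp only [start, Pi.smul_apply, Finset.sum_apply, Pi.single_apply, Prod.mk.injEq, smul_eq_mul]
    by_cases hw : w = Q.init <;> simp [hw]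
  rw [law, h, mulVec_smul, Pi.smul_apply, smul_eq_mul, mulVec_sum, Finset.sum_apply, norm_mul,
    mul_pow, norm_div, norm_one, Complex.norm_real, Real.norm_of_nonneg (Real.sqrt_nonneg _),
    div_pow, one_pow, Real.sq_sqrt (Nat.cast_nonneg _)]

/-- The probability of a value above `t` when `U |start⟩` is measured. -/
def mass (Q : ValueOracle A) (t : ℝ) : ℝ := ∑ y, if t < Q.val y then Q.law y else 0

theorem mass_nonneg (Q : ValueOracle A) (t : ℝ) : 0 ≤ Q.mass t :=
  sum_nonneg fun y _ => by split_ifs <;> [exact Q.law_nonneg y; rfl]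

variable [Nonempty A]

theorem sum_law (Q : ValueOracle A) : ∑ y, Q.law y = 1 := Q.isState_start.mulVec Q.U

theorem mass_le_one (Q : ValueOracle A) (t : ℝ) : Q.mass t ≤ 1 := by
  rw [← Q.sum_law]
  exact sum_le_sum fun y _ => by split_ifs <;> [rfl; exact Q.law_nonneg y]

theorem groverMeasure_apply (Q : ValueOracle A) (t : ℝ) (j : ℕ) {θ : ℝ}
    (hθ : Q.mass t = Real.sin θ ^ 2) (y : A × Q.W) :
    Q.groverMeasure t j y = ENNReal.ofReal
      ((if t < Q.val y then (ampCoeff θ j).1 ^ 2 else (ampCoeff θ j).2 ^ 2) * Q.law y) := by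
  set ψ := Q.U.1 *ᵥ Q.start with hψ
  have hR : ∀ φ, (Q.U * reflection Q.start Q.isState_start * Q.U⁻¹).1 *ᵥ φ =
      (2 * (star ψ ⬝ᵥ φ)) • ψ - φ := by
    intro φ
    rw [Matrix.UnitaryGroup.mul_val, Matrix.UnitaryGroup.mul_val, ← mulVec_mulVec, ← mulVec_mulVec,
      reflection_mulVec, mulVec_sub, mulVec_smul, mulVec_inv_mulVec, star_dotProduct_inv_mulVec]
  have h1 : (Q.U * reflection Q.start Q.isState_start * Q.U⁻¹).1 *ᵥ ψ = ψ := by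
    rw [hR, isState_iff.1 (Q.isState_start.mulVec Q.U)]
    ext i; simp; ring
  have h2 : (Q.U * reflection Q.start Q.isState_start * Q.U⁻¹).1 *ᵥ
      (fun y => if t < Q.val y then ψ y else 0) = ((2 * Real.sin θ ^ 2 : ℝ) : ℂ) • ψ -
        fun y => if t < Q.val y then ψ y else 0 := by
    rw [hR, star_dotProduct_marked, ← hθ]
    simp only [mass, law, Complex.ofReal_mul, Complex.ofReal_ofNat, hψ]
  have h3 := pow_mulVec_of_reflection (P := fun y => t < Q.val y) h1 h2 j
  have h4 : (Q.grover t ^ j * Q.U).1 *ᵥ Q.start =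
      ((Q.U * reflection Q.start Q.isState_start * Q.U⁻¹).1 *
        (flip fun y => t < Q.val y).1) ^ j *ᵥ ψ := by
    rw [Matrix.UnitaryGroup.mul_val, ← mulVec_mulVec, ← Matrix.UnitaryGroup.mul_val]
    rfl
  rw [h3] at h4
  change ENNReal.ofReal (‖((Q.grover t ^ j * Q.U).1 *ᵥ Q.start) y‖ ^ 2) = _
  rw [h4]
  congr 1
  simp only [law]
  split_ifs <;> rw [norm_mul, mul_pow, Complex.norm_real, Real.norm_eq_abs, sq_abs]

end ValueOracle

section Oracle

variable {S A J : Type*} [Fintype S] [DecidableEq S] [Fintype A] [DecidableEq A]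
  [Fintype J] [DecidableEq J]
variable {M : MDP S A} {s₀ : S} {j₀ : J} {O : Matrix.unitaryGroup (S × A × S × J) ℂ}

/-- The branches of different actions have disjoint supports, so only `a = y.1` contributes to the
amplitude at `y`. Hence measuring the uniform superposition amounts to a uniform action followed by
independent runs for it. -/
theorem law_qOracle (hO : IsGenerativeModel M s₀ j₀ O) (η f : ℝ) (v : S → ℝ) (s : S)
    (y : A × EstReg S J (numPoints M.horizon η) (numRuns f)) :
    (qOracle M O s₀ j₀ η f v s).law y = if y.2.1 = s then
      (1 / Fintype.card A) * ∏ i, ‖runState O s₀ j₀ M.horizon v (numPoints M.horizon η) s y.1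
        (y.2.2 i)‖ ^ 2 else 0 := by
  refine (ValueOracle.law_eq (qOracle M O s₀ j₀ η f v s) y).trans ?_
  change _ * ‖∑ a, ((estCircuit O s₀ j₀ M.horizon v _ _).1 *ᵥ Pi.single (a, s, fun _ => _) 1) y‖ ^ 2
    = _
  simp only [estCircuit_mulVec_single hO]
  rw [Fintype.sum_eq_single y.1 fun a ha => if_neg fun h => ha h.1.symm]
  by_cases h : y.2.1 = s
  · rw [if_pos ⟨rfl, h⟩, if_pos h, norm_prod, prod_pow]
  · rw [if_neg fun h' => h h'.2, if_neg h]
    simp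

theorem sum_law_qOracle (hO : IsGenerativeModel M s₀ j₀ O) (η f : ℝ) (v : S → ℝ) (s : S) (a : A)
    (c : EstReg S J (numPoints M.horizon η) (numRuns f) → Prop) [DecidablePred c] :
    (∑ y : A × EstReg S J (numPoints M.horizon η) (numRuns f),
      if y.1 = a ∧ c y.2 then (qOracle M O s₀ j₀ η f v s).law y else 0) =
      (1 / Fintype.card A) * ∑ w : Fin (2 * numRuns f + 1) → RunReg S J (numPoints M.horizon η),
        if c (s, w) then
          ∏ i, ‖runState O s₀ j₀ M.horizon v (numPoints M.horizon η) s a (w i)‖ ^ 2 else 0 := by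
  simp only [law_qOracle hO]
  rw [Fintype.sum_prod_type, Fintype.sum_eq_single a, Fintype.sum_prod_type,
    Fintype.sum_eq_single s, mul_sum]
  · refine sum_congr rfl fun w _ => ?_
    by_cases h : c (s, w) <;> simp [h]
  · intro s' hs'
    refine sum_eq_zero fun w _ => ?_
    simp [hs']
  · intro a' ha'
    refine sum_eq_zero fun w _ => ?_
    simp [ha']

theorem sum_law_qOracle_action (hO : IsGenerativeModel M s₀ j₀ O) (η f : ℝ) (v : S → ℝ) (s : S)
    (a : A) :
    (∑ y : A × EstReg S J (numPoints M.horizon η) (numRuns f),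
      if y.1 = a then (qOracle M O s₀ j₀ η f v s).law y else 0) = 1 / Fintype.card A := by
  have h := sum_law_qOracle hO η f v s a fun _ => True
  simp only [and_true, if_true] at h
  rw [h, ← Fintype.sum_pow
    (fun w => ‖runState O s₀ j₀ M.horizon v (numPoints M.horizon η) s a w‖ ^ 2),
    show ∑ w, ‖runState O s₀ j₀ M.horizon v (numPoints M.horizon η) s a w‖ ^ 2
    = 1 from isState_runState hO _ _ _ _ _, one_pow, mul_one]

/-- Mean estimation fails with probability at most `f`. -/
theorem sum_law_qOracle_err_le (hO : IsGenerativeModel M s₀ j₀ O) {η f : ℝ} (hη : 0 < η)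
    (hf : 0 < f) (hf1 : f ≤ 1) {v : S → ℝ} (hv0 : ∀ t, 0 ≤ v t) (hv : ∀ t, v t ≤ M.horizon)
    (s : S) (a : A) :
    (∑ y : A × EstReg S J (numPoints M.horizon η) (numRuns f),
      if y.1 = a ∧ η < |estimate M.horizon y.2 - M.stepMean s a v| then
        (qOracle M O s₀ j₀ η f v s).law y else 0) ≤ 1 / Fintype.card A * f := by
  have hΓ := M.horizon_pos
  rw [sum_law_qOracle hO η f v s a fun w => η < |estimate M.horizon w - M.stepMean s a v|]
  refine mul_le_mul_of_nonneg_left ?_ (by positivity)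
  set n := numPoints M.horizon η with hn
  obtain ⟨θ, hθ⟩ := exists_angle (O := O) (s₀ := s₀) (j₀ := j₀) M.horizon v s a
  have hμ : M.stepMean s a v = M.horizon * Real.sin θ ^ 2 := by
    rw [← hθ, sum_flag_prepState hO hΓ hv0 hv, mul_div_cancel₀ _ hΓ.ne']
  -- The amplitude is the mean divided by the range, so an error `η` of the mean is an error `η / Γ`
  -- of the amplitude; `numPoints` is chosen for this accuracy.
  have hε : 8 / (n + 1 : ℝ) ≤ η / M.horizon := by
    rw [div_le_div_iff₀ (by positivity) hΓ]
    have h1 : 8 * M.horizon / η ≤ n := Nat.le_ceil _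
    rw [div_le_iff₀ hη] at h1
    nlinarith
  have hbad := sum_ampEstState_err_le hO M.horizon v n s a hθ hε
  rw [← sum_runState hO M.horizon v n s a fun y : Fin (n + 1) => η / M.horizon <
    |Real.sin (Real.pi * (y.val : ℝ) / (n + 1)) ^ 2 - Real.sin θ ^ 2|] at hbad
  have hmaj := sum_majority_le (fun w => ‖runState O s₀ j₀ M.horizon v n s a w‖ ^ 2)
    (fun w => by positivity) (isState_runState hO _ _ _ _ _)
    (fun w : RunReg S J n => η / M.horizon <
      |Real.sin (Real.pi * (w.2.2.val : ℝ) / (n + 1)) ^ 2 - Real.sin θ ^ 2|) hbad (numRuns f)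
  refine le_trans (sum_le_sum fun w _ => ?_) (hmaj.trans (pow_numRuns_le hf hf1))
  have h0 : 0 ≤ ∏ i, ‖runState O s₀ j₀ M.horizon v n s a (w i)‖ ^ 2 :=
    prod_nonneg fun i _ => by positivity
  split_ifs with h1 h2 h2
  · exact le_rfl
  · exfalso
    refine absurd (abs_median_sub_le (fun i => M.horizon *
      Real.sin (Real.pi * ((w i).2.2.val : ℝ) / (n + 1)) ^ 2) (M.stepMean s a v) η ?_) (not_le.2 h1)
    rw [not_lt] at h2
    refine le_trans (card_le_card fun i hi => ?_) h2
    obtain ⟨-, hi⟩ := mem_filter.1 hi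
    refine mem_filter.2 ⟨mem_univ _, ?_⟩
    rw [hμ, ← mul_sub, abs_mul, abs_of_pos hΓ] at hi
    rw [div_lt_iff₀ hΓ, mul_comm]
    exact hi
  · exact h0
  · exact le_rfl

end Oracle

end QMDP

end

/-! ### Expectations, and maximum finding rarely returns unlikely labels -/

noncomputable section

namespace QMDP

open Finset
open scoped ENNReal

/-- The expectation of a nonnegative function. -/
def expect {α : Type*} (P : PMF α) (F : α → ℝ≥0∞) : ℝ≥0∞ := ∑' x, P x * F x

theorem expect_pure {α : Type*} (a : α) (F : α → ℝ≥0∞) : expect (PMF.pure a) F = F a := by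
  rw [expect, tsum_eq_single a]
  · simp
  · intro b hb
    simp [hb]

theorem expect_bind {α β : Type*} (P : PMF α) (K : α → PMF β) (F : β → ℝ≥0∞) :
    expect (P.bind K) F = expect P fun x => expect (K x) F := by
  simp only [expect, PMF.bind_apply, ← ENNReal.tsum_mul_right, ← ENNReal.tsum_mul_left]
  rw [ENNReal.tsum_comm]
  simp only [mul_assoc]

theorem expect_map {α β : Type*} (P : PMF α) (g : α → β) (F : β → ℝ≥0∞) :
    expect (P.map g) F = expect P fun x => F (g x) := by
  rw [PMF.map, expect_bind]
  simp only [Function.comp_apply, expect_pure]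

theorem expect_mono {α : Type*} (P : PMF α) {F G : α → ℝ≥0∞} (h : ∀ x, F x ≤ G x) :
    expect P F ≤ expect P G :=
  ENNReal.tsum_le_tsum fun x => mul_le_mul_right (h x) _

theorem expect_const {α : Type*} (P : PMF α) (c : ℝ≥0∞) : expect P (fun _ => c) = c := by
  rw [expect, ENNReal.tsum_mul_right, P.tsum_coe, one_mul]

theorem expect_add {α : Type*} (P : PMF α) (F G : α → ℝ≥0∞) :
    expect P (fun x => F x + G x) = expect P F + expect P G := by
  simp only [expect, mul_add, ENNReal.tsum_add]

theorem toOuterMeasure_eq_expect {α : Type*} (P : PMF α) (s : Set α) :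
    P.toOuterMeasure s = expect P (s.indicator 1) := by
  rw [PMF.toOuterMeasure_apply, expect]
  refine tsum_congr fun x => ?_
  by_cases hx : x ∈ s <;> simp [hx]

theorem toOuterMeasure_le_expect {α : Type*} (P : PMF α) {s : Set α} {F : α → ℝ≥0∞}
    (h : ∀ x ∈ s, 1 ≤ F x) : P.toOuterMeasure s ≤ expect P F := by
  rw [toOuterMeasure_eq_expect]
  refine expect_mono P fun x => ?_
  by_cases hx : x ∈ s
  · rw [Set.indicator_of_mem hx]; exact h x hx
  · rw [Set.indicator_of_notMem hx]; exact zero_le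

theorem one_sub_le_toOuterMeasure {α : Type*} (P : PMF α) {s : Set α} {δ : ℝ} (hδ : 0 ≤ δ)
    (h : P.toOuterMeasure sᶜ ≤ ENNReal.ofReal δ) :
    ENNReal.ofReal (1 - δ) ≤ P.toOuterMeasure s := by
  have h1 : P.toOuterMeasure s + P.toOuterMeasure sᶜ = 1 := by
    rw [toOuterMeasure_eq_expect, toOuterMeasure_eq_expect, ← expect_add]
    rw [← expect_const P 1]
    congr 1
    ext x
    by_cases hx : x ∈ s <;> simp [hx]
  rw [ENNReal.ofReal_sub _ hδ, ENNReal.ofReal_one, tsub_le_iff_right, ← h1]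
  gcongr

theorem expect_le_ofReal {α : Type*} [Fintype α] (P : PMF α) (μ : α → ℝ)
    (hP : ∀ x, P x = ENNReal.ofReal (μ x)) (hμ : ∀ x, 0 ≤ μ x) {F : α → ℝ≥0∞} {G : α → ℝ}
    (hG : ∀ x, 0 ≤ G x) (hF : ∀ x, F x ≤ ENNReal.ofReal (G x)) {r : ℝ}
    (hr : ∑ x, μ x * G x ≤ r) : expect P F ≤ ENNReal.ofReal r := by
  refine (expect_mono P hF).trans ?_
  rw [expect, tsum_fintype]
  refine le_trans (le_of_eq ?_) (ENNReal.ofReal_le_ofReal hr)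
  rw [ENNReal.ofReal_sum_of_nonneg fun x _ => mul_nonneg (hμ x) (hG x)]
  refine sum_congr rfl fun x _ => ?_
  rw [hP, ENNReal.ofReal_mul (hμ x)]

theorem expect_uniformOfFinset_range {N : ℕ} (hN : (range N).Nonempty) (F : ℕ → ℝ≥0∞) {w : ℕ → ℝ}
    {r : ℝ} (hw : ∀ j < N, 0 ≤ w j) (hF : ∀ j < N, F j ≤ ENNReal.ofReal (w j))
    (hr : ∑ j ∈ range N, w j ≤ N * r) :
    expect (PMF.uniformOfFinset (range N) hN) F ≤ ENNReal.ofReal r := by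
  have hN0 : 0 < N := Nat.pos_of_ne_zero (nonempty_range_iff.1 hN)
  have hN' : (0 : ℝ) < N := by exact_mod_cast hN0
  rw [expect, tsum_eq_sum (s := range N) fun j hj => by
    rw [PMF.uniformOfFinset_apply_of_notMem hN hj, zero_mul]]
  calc ∑ j ∈ range N, PMF.uniformOfFinset (range N) hN j * F j
      ≤ ∑ j ∈ range N, (N : ℝ≥0∞)⁻¹ * ENNReal.ofReal (w j) := by
        refine sum_le_sum fun j hj => ?_
        rw [PMF.uniformOfFinset_apply_of_mem hN hj, card_range]
        exact mul_le_mul_right (hF j (mem_range.1 hj)) _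
    _ = ENNReal.ofReal ((N : ℝ)⁻¹ * ∑ j ∈ range N, w j) := by
        rw [← mul_sum, ← ENNReal.ofReal_sum_of_nonneg fun j hj => hw j (mem_range.1 hj),
          ENNReal.ofReal_mul (by positivity), ENNReal.ofReal_inv_of_pos hN', ENNReal.ofReal_natCast]
    _ ≤ ENNReal.ofReal r := by
        apply ENNReal.ofReal_le_ofReal
        rw [inv_mul_le_iff₀ hN']
        exact hr

theorem abs_sin_nat_mul_le (n : ℕ) (x : ℝ) : |Real.sin (n * x)| ≤ n * |Real.sin x| := by
  induction n with
  | zero => simp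
  | succ n ih =>
    rw [Nat.cast_succ, add_mul, one_mul, Real.sin_add]
    calc _ ≤ |Real.sin (n * x) * Real.cos x| + |Real.cos (n * x) * Real.sin x| := abs_add_le _ _
      _ ≤ |Real.sin (n * x)| * 1 + 1 * |Real.sin x| := by
          rw [abs_mul, abs_mul]
          exact add_le_add
            (mul_le_mul_of_nonneg_left (Real.abs_cos_le_one _) (abs_nonneg _))
            (mul_le_mul_of_nonneg_right (Real.abs_cos_le_one _) (abs_nonneg _))
      _ ≤ _ := by linarith

namespace ValueOracle

variable {A : Type*} [Fintype A] [DecidableEq A] [Nonempty A]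

/-- The angle whose squared sine is the probability of a value above `t`. -/
def angle (Q : ValueOracle A) (t : ℝ) : ℝ := Real.arcsin √(Q.mass t)

theorem sin_angle (Q : ValueOracle A) (t : ℝ) : Real.sin (Q.angle t) = √(Q.mass t) :=
  Real.sin_arcsin (by linarith [Real.sqrt_nonneg (Q.mass t)])
    (Real.sqrt_le_one.2 (Q.mass_le_one t))

theorem mass_eq (Q : ValueOracle A) (t : ℝ) : Q.mass t = Real.sin (Q.angle t) ^ 2 := by
  rw [sin_angle, Real.sq_sqrt (Q.mass_nonneg t)]

/-- The Born probabilities of `groverMeasure`. -/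
def groverLaw (Q : ValueOracle A) (t : ℝ) (j : ℕ) (y : A × Q.W) : ℝ :=
  (if t < Q.val y then (ampCoeff (Q.angle t) j).1 ^ 2 else (ampCoeff (Q.angle t) j).2 ^ 2) * Q.law y

omit [Nonempty A] in
theorem groverLaw_nonneg (Q : ValueOracle A) (t : ℝ) (j : ℕ) (y : A × Q.W) :
    0 ≤ Q.groverLaw t j y :=
  mul_nonneg (by split_ifs <;> positivity) (Q.law_nonneg y)

theorem groverMeasure_eq (Q : ValueOracle A) (t : ℝ) (j : ℕ) (y : A × Q.W) :
    Q.groverMeasure t j y = ENNReal.ofReal (Q.groverLaw t j y) :=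
  Q.groverMeasure_apply t j (Q.mass_eq t) y

omit [Nonempty A] in
theorem groverLaw_zero (Q : ValueOracle A) (t : ℝ) (y : A × Q.W) : Q.groverLaw t 0 y = Q.law y := by
  simp [groverLaw, ampCoeff]

theorem sum_groverLaw (Q : ValueOracle A) (t : ℝ) (j : ℕ) : ∑ y, Q.groverLaw t j y = 1 := by
  have h := (Q.groverMeasure t j).tsum_coe
  rw [tsum_fintype] at h
  simp only [groverMeasure_eq] at h
  rw [← ENNReal.ofReal_sum_of_nonneg fun y _ => Q.groverLaw_nonneg t j y,
    ENNReal.ofReal_eq_one] at h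
  exact h

omit [Nonempty A] in
theorem sum_groverLaw_success (Q : ValueOracle A) (t : ℝ) (j : ℕ) (F : A × Q.W → ℝ) :
    (∑ y, if t < Q.val y then Q.groverLaw t j y * F y else 0) =
      (ampCoeff (Q.angle t) j).1 ^ 2 * ∑ y, if t < Q.val y then Q.law y * F y else 0 := by
  rw [mul_sum]
  refine sum_congr rfl fun y _ => ?_
  by_cases h : t < Q.val y
  · simp only [groverLaw, h, if_true, mul_assoc]
  · simp [h]

theorem sum_groverLaw_success_one (Q : ValueOracle A) (t : ℝ) (j : ℕ) :
    (∑ y, if t < Q.val y then Q.groverLaw t j y else 0) =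
      Real.sin ((2 * j + 1) * Q.angle t) ^ 2 := by
  have h := Q.sum_groverLaw_success t j fun _ => 1
  simp only [mul_one] at h
  rw [h, ← (ampCoeff_mul (Q.angle t) j).1, mul_pow, ← mass_eq, mass]

/-- Amplitude amplification with `j` iterations raises probabilities by at most `(2j + 1)²`. -/
theorem groverLaw_le (Q : ValueOracle A) (t : ℝ) (j : ℕ) (y : A × Q.W) (hy : t < Q.val y) :
    Q.groverLaw t j y ≤ (2 * j + 1) ^ 2 * Q.law y := by
  rw [groverLaw, if_pos hy]
  -- If the marked mass vanishes, its coefficient is not controlled by the sine, but then every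
  -- marked label has law `0`.
  by_cases h0 : Real.sin (Q.angle t) = 0
  · have h1 : Q.mass t = 0 := by rw [mass_eq, h0]; norm_num
    have h2 : Q.law y = 0 := by
      have h3 := (sum_eq_zero_iff_of_nonneg fun y _ => by
        split_ifs <;> [exact Q.law_nonneg y; rfl]).1 h1 y (mem_univ y)
      rwa [if_pos hy] at h3
    rw [h2, mul_zero, mul_zero]
  · refine mul_le_mul_of_nonneg_right ?_ (Q.law_nonneg y)
    have h1 := abs_sin_nat_mul_le (2 * j + 1) (Q.angle t)
    push_cast at h1
    rw [← (ampCoeff_mul (Q.angle t) j).1, abs_mul] at h1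
    have h2 := le_of_mul_le_mul_right h1 (abs_pos.2 h0)
    rw [← sq_abs]
    exact pow_le_pow_left₀ (abs_nonneg _) h2 2

theorem expect_searchStep (Q : ValueOracle A) (B : ℝ) (x : A × Q.W) (k c : ℕ)
    (F : (A × Q.W) × ℕ × ℕ → ℝ≥0∞) :
    expect (Q.searchStep B (x, k, c)) F =
      expect (PMF.uniformOfFinset (range ⌈searchBound A k⌉₊) (range_searchBound_nonempty k))
        fun j => if B < ((c + (2 * j + 1) : ℕ) : ℝ) then F (x, k, c + (2 * j + 1))
          else expect (Q.groverMeasure (Q.val x) j) fun y =>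
            if Q.val x < Q.val y then F (y, 0, c + (2 * j + 1))
            else F (x, k + 1, c + (2 * j + 1)) := by
  rw [searchStep, expect_bind]
  congr 1
  ext j
  split_ifs
  · rw [expect_pure]
  · rw [expect_map]
    congr 1
    ext y
    split_ifs <;> rfl

/-- A supermartingale argument for the search loop. -/
theorem expect_searchLoop_le (Q : ValueOracle A) (B : ℝ) (F : (A × Q.W) × ℕ × ℕ → ℝ≥0∞)
    (hF : ∀ σ, expect (Q.searchStep B σ) F ≤ F σ) (n : ℕ) (σ : (A × Q.W) × ℕ × ℕ) :
    expect (Q.searchLoop B n σ) F ≤ F σ := by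
  induction n generalizing σ with
  | zero => rw [searchLoop, expect_pure]
  | succ n ih =>
    rw [searchLoop, expect_bind]
    exact (expect_mono _ ih).trans (hF σ)

theorem one_le_sqrt_card (A : Type*) [Fintype A] [Nonempty A] : 1 ≤ √(Fintype.card A : ℝ) :=
  Real.one_le_sqrt.2 (by exact_mod_cast Fintype.card_pos)

omit [DecidableEq A] in
theorem queries_le {k j : ℕ} (hj : j < ⌈searchBound A k⌉₊) :
    2 * (j : ℝ) + 1 ≤ 3 * √(Fintype.card A : ℝ) := by
  have h1 : (j : ℝ) < searchBound A k := Nat.lt_ceil.1 hj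
  have h2 : searchBound A k ≤ √(Fintype.card A : ℝ) := min_le_right _ _
  linarith [one_le_sqrt_card A]

/-- Maximum finding returns labels from a set of small probability only with small probability. -/
theorem qArgmax_bad_le (Q : ValueOracle A) (f : ℝ) (hB : 1 ≤ queryBudget A f)
    (bad : A × Q.W → Prop) [DecidablePred bad] {p : ℝ}
    (hp : (∑ y, if bad y then Q.law y else 0) ≤ p) :
    (qArgmax Q f).toOuterMeasure {y | bad y} ≤
      ENNReal.ofReal (p * (3 * √(Fintype.card A : ℝ)) * queryBudget A f) := by
  set B := queryBudget A f with hBdef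
  set K := 3 * √(Fintype.card A : ℝ) with hK
  have hK1 : 1 ≤ K := by linarith [one_le_sqrt_card A]
  have hp0 : 0 ≤ p := le_trans (sum_nonneg fun y _ => by
    split_ifs <;> [exact Q.law_nonneg y; rfl]) hp
  -- The potential pays in advance for the amplification of bad labels. A round with `j` iterations
  -- finds one with probability at most `(2j+1)² p ≤ (2j+1) K p`, which is exactly what its `2j + 1`
  -- queries release from the second term.
  set G : A × Q.W → ℕ → ℝ := fun x c => (if bad x then 1 else 0) + p * K * max (B - c) 0 with hG
  have hG0 : ∀ x c, 0 ≤ G x c := by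
    intro x c
    have : 0 ≤ p * K * max (B - c) 0 := by positivity
    simp only [hG]
    split_ifs <;> linarith
  set F : (A × Q.W) × ℕ × ℕ → ℝ≥0∞ := fun σ => ENNReal.ofReal (G σ.1 σ.2.2) with hF
  have hstep : ∀ σ, expect (Q.searchStep B σ) F ≤ F σ := by
    rintro ⟨x, k, c⟩
    rw [expect_searchStep]
    refine expect_uniformOfFinset_range _ _ (w := fun _ => G x c) (fun _ _ => hG0 _ _)
      (fun j hj => ?_) (by rw [sum_const, card_range, nsmul_eq_mul])
    split_ifs with hb
    · apply ENNReal.ofReal_le_ofReal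
      simp only [hG]
      have : max (B - ((c + (2 * j + 1) : ℕ) : ℝ)) 0 ≤ max (B - c) 0 := by
        apply max_le_max _ le_rfl
        push_cast
        have : (0 : ℝ) ≤ j := Nat.cast_nonneg j
        linarith
      have := mul_le_mul_of_nonneg_left this (mul_nonneg hp0 (by linarith : 0 ≤ K))
      linarith
    · rw [not_lt] at hb
      have hcK : 2 * (j : ℝ) + 1 ≤ K := queries_le hj
      have hc' : max (B - ((c + (2 * j + 1) : ℕ) : ℝ)) 0 = B - c - (2 * j + 1) := by
        rw [max_eq_left (by linarith)]; push_cast; ring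
      have hc : max (B - (c : ℝ)) 0 = B - c := by
        apply max_eq_left
        push_cast at hb
        have : (0 : ℝ) ≤ j := Nat.cast_nonneg j
        linarith
      refine expect_le_ofReal _ (Q.groverLaw (Q.val x) j) (Q.groverMeasure_eq _ _)
        (Q.groverLaw_nonneg _ _) (G := fun y => if Q.val x < Q.val y then G y (c + (2 * j + 1))
          else G x (c + (2 * j + 1))) (fun y => by split_ifs <;> exact hG0 _ _)
        (fun y => by split_ifs <;> exact le_rfl) ?_
      have hy : ∀ y, Q.groverLaw (Q.val x) j y * (if Q.val x < Q.val y then G y (c + (2 * j + 1))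
          else G x (c + (2 * j + 1))) ≤ Q.groverLaw (Q.val x) j y *
            ((if bad x then 1 else 0) + p * K * (B - c - (2 * j + 1))) +
            (2 * j + 1) ^ 2 * (if bad y then Q.law y else 0) := by
        intro y
        have h0 := Q.groverLaw_nonneg (Q.val x) j y
        have h1 := Q.law_nonneg y
        have h2 : 0 ≤ (2 * (j : ℝ) + 1) ^ 2 * (if bad y then Q.law y else 0) :=
          mul_nonneg (sq_nonneg _) (by split_ifs <;> [exact h1; rfl])
        by_cases hval : Q.val x < Q.val y
        · rw [if_pos hval]
          simp only [hG, hc']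
          have h3 : 0 ≤ Q.groverLaw (Q.val x) j y * (if bad x then 1 else 0) :=
            mul_nonneg h0 (by split_ifs <;> norm_num)
          by_cases hby : bad y
          · have := Q.groverLaw_le _ j y hval
            simp only [if_pos hby]
            linarith
          · simp only [if_neg hby, mul_zero]
            linarith
        · rw [if_neg hval]
          simp only [hG, hc']
          linarith
      refine (sum_le_sum fun y _ => hy y).trans ?_
      rw [sum_add_distrib, ← sum_mul, ← mul_sum, sum_groverLaw, one_mul]
      simp only [hG, hc]
      have hsum0 : 0 ≤ ∑ y, if bad y then Q.law y else 0 :=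
        sum_nonneg fun y _ => by split_ifs <;> [exact Q.law_nonneg y; rfl]
      have h1 : (2 * (j : ℝ) + 1) ^ 2 * (∑ y, if bad y then Q.law y else 0) ≤
          (2 * j + 1) * K * p := by
        rw [sq]
        have h2 : 0 ≤ 2 * (j : ℝ) + 1 := by positivity
        exact mul_le_mul (mul_le_mul_of_nonneg_left hcK h2) hp hsum0 (by positivity)
      linarith
  have hfinal : expect ((Q.groverMeasure 0 0).bind fun x => Q.searchLoop B ⌈B⌉₊ (x, 0, 1)) F ≤
      ENNReal.ofReal (p * K * B) := by
    rw [expect_bind]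
    refine (expect_mono _ fun x => Q.expect_searchLoop_le B F hstep _ _).trans ?_
    refine expect_le_ofReal _ (Q.groverLaw 0 0) (Q.groverMeasure_eq _ _)
        (Q.groverLaw_nonneg _ _) (G := fun x => G x 1) (fun y => hG0 _ _) (fun y => le_rfl) ?_
    simp only [groverLaw_zero, hG, mul_add, sum_add_distrib, mul_ite, mul_one, mul_zero]
    rw [← sum_mul, sum_law, one_mul, max_eq_left (by push_cast; linarith)]
    push_cast
    nlinarith
  rw [qArgmax, ← hBdef]
  refine le_trans (toOuterMeasure_le_expect _ (F := fun y => if bad y then 1 else 0)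
    fun y hy => ?_) (le_trans ?_ hfinal)
  · rw [if_pos (show bad y from hy)]
  · rw [expect_map]
    refine expect_mono _ fun σ => ?_
    simp only [hF, hG]
    have : 0 ≤ p * K * max (B - (σ.2.2 : ℝ)) 0 := by positivity
    split_ifs
    · rw [← ENNReal.ofReal_one]
      exact ENNReal.ofReal_le_ofReal (by linarith)
    · exact zero_le

end ValueOracle

end QMDP

end

/-! ### Expected cost of exponential Grover search -/

noncomputable section

namespace QMDP

open Finset

theorem two_mul_sum_cos (θ : ℝ) (N : ℕ) :
    2 * Real.sin (2 * θ) * ∑ j ∈ range N, Real.cos ((4 * j + 2) * θ) = Real.sin (4 * N * θ) := by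
  induction N with
  | zero => simp
  | succ N ih =>
    rw [sum_range_succ, mul_add, ih]
    have h1 : 4 * ((N + 1 : ℕ) : ℝ) * θ = (4 * N + 2) * θ + 2 * θ := by push_cast; ring
    have h2 : 4 * (N : ℝ) * θ = (4 * N + 2) * θ - 2 * θ := by ring
    rw [h1, h2, Real.sin_add, Real.sin_sub]
    ring

theorem sum_sin_sq (θ : ℝ) (N : ℕ) :
    ∑ j ∈ range N, Real.sin ((2 * j + 1) * θ) ^ 2 =
      N / 2 - (∑ j ∈ range N, Real.cos ((4 * j + 2) * θ)) / 2 := by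
  have h : ∀ j : ℕ, Real.sin ((2 * j + 1) * θ) ^ 2 = 1 / 2 - Real.cos ((4 * j + 2) * θ) / 2 := by
    intro j
    rw [Real.sin_sq_eq_half_sub, show 2 * ((2 * (j : ℝ) + 1) * θ) = (4 * j + 2) * θ by ring]
  simp only [h]
  rw [sum_sub_distrib, sum_const, card_range, nsmul_eq_mul, sum_div]
  ring

/-- A random number of Grover iterations below `N` succeeds with probability at least `1/4` once
`N ≥ 1 / (√2 sin θ)`. -/
theorem quarter_le_sum_sin_sq {θ : ℝ} (h0 : 0 < θ) (h1 : θ ≤ Real.pi / 2) {N : ℕ}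
    (hN : 1 ≤ √2 * N * Real.sin θ) :
    (N : ℝ) / 4 ≤ ∑ j ∈ range N, Real.sin ((2 * j + 1) * θ) ^ 2 := by
  have hpi := Real.pi_pos
  have hs2 : 0 ≤ Real.sin (2 * θ) := Real.sin_nonneg_of_nonneg_of_le_pi (by linarith) (by linarith)
  have hsum := two_mul_sum_cos θ N
  have hN0 : (0 : ℝ) ≤ N := Nat.cast_nonneg N
  rw [sum_sin_sq]
  set C := ∑ j ∈ range N, Real.cos ((4 * j + 2) * θ) with hC
  suffices C ≤ N / 2 by linarith
  -- Here the closed form `C = sin (4Nθ) / (2 sin 2θ)` is at most `N / 2`. Otherwise `θ > π/4`,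
  -- because `2 cos θ ≥ √2` would contradict `hN`.
  by_cases hcase : 1 ≤ N * Real.sin (2 * θ)
  · have h2 : 2 * Real.sin (2 * θ) * C ≤ 1 := hsum ▸ Real.sin_le_one _
    by_contra! hlt
    nlinarith
  · rw [not_le] at hcase
    have hθ : Real.pi / 4 < θ := by
      by_contra! hle
      have hcos : √2 / 2 ≤ Real.cos θ := by
        rw [← Real.cos_pi_div_four]
        exact Real.cos_le_cos_of_nonneg_of_le_pi h0.le (by linarith) hle
      have hsin : 0 ≤ Real.sin θ := Real.sin_nonneg_of_nonneg_of_le_pi h0.le (by linarith)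
      rw [Real.sin_two_mul] at hcase
      have := mul_le_mul_of_nonneg_left hcos (mul_nonneg hN0 hsin)
      nlinarith
    -- Reflection at `π/2` changes the sign of every cosine. Since `N sin 2β < 1`, Jordan's
    -- inequality gives `4Nβ ≤ π`, so the reflected sum is nonnegative and `C ≤ 0`.
    set β := Real.pi / 2 - θ with hβ
    have hC' : C = -∑ j ∈ range N, Real.cos ((4 * j + 2) * β) := by
      rw [hC, ← sum_neg_distrib]
      refine sum_congr rfl fun j _ => ?_
      rw [show (4 * (j : ℝ) + 2) * θ = Real.pi - (4 * j + 2) * β + j * (2 * Real.pi) by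
        rw [hβ]; ring, Real.cos_add_nat_mul_two_pi, Real.cos_pi_sub]
    have hsum' := two_mul_sum_cos β N
    have hβ0 : 0 ≤ β := by linarith
    have h2β : Real.sin (2 * β) = Real.sin (2 * θ) := by
      rw [show 2 * β = Real.pi - 2 * θ by rw [hβ]; ring, Real.sin_pi_sub]
    have hle := Real.mul_le_sin (x := 2 * β) (by linarith) (by linarith)
    rw [h2β] at hle hsum'
    have hNβ : 4 * N * β ≤ Real.pi := by
      have h3 : N * (2 / Real.pi * (2 * β)) ≤ N * Real.sin (2 * θ) :=
        mul_le_mul_of_nonneg_left hle hN0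
      have h4 : N * (2 / Real.pi * (2 * β)) = 4 * N * β / Real.pi := by ring
      rw [h4] at h3
      have h5 : 4 * N * β / Real.pi < 1 := by linarith
      rw [div_lt_one hpi] at h5
      exact h5.le
    suffices 0 ≤ ∑ j ∈ range N, Real.cos ((4 * j + 2) * β) by
      rw [hC']
      linarith
    rcases hs2.lt_or_eq with hpos | hzero
    · by_contra! hneg
      have h6 : 0 ≤ Real.sin (4 * N * β) := Real.sin_nonneg_of_nonneg_of_le_pi (by positivity) hNβ
      rw [← hsum'] at h6
      nlinarith
    · have hβz : β = 0 := by
        rw [← hzero] at hle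
        have : 2 / Real.pi * (2 * β) = 4 / Real.pi * β := by ring
        rw [this] at hle
        have h7 : 0 < 4 / Real.pi := by positivity
        nlinarith
      rw [hβz]
      simp

/-- A bound on the expected number of queries until the next success of exponential search, where
`τ` is the number of iterations from which on every round is successful with probability at least
`1/4`, and `m` bounds the number of iterations in the current round. -/
def roundCost (τ m : ℝ) : ℝ := if τ ≤ m then 20 * m else 36 * τ - 10 * m

theorem roundCost_nonneg {τ m : ℝ} (hm : 0 ≤ m) : 0 ≤ roundCost τ m := by
  unfold roundCost
  split_ifs <;> linarith

theorem roundCost_le {τ m c : ℝ} (hm : 0 ≤ m) (hτ : τ ≤ c) (hmc : m ≤ c) :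
    roundCost τ m ≤ 36 * c := by
  unfold roundCost
  split_ifs <;> linarith

namespace ValueOracle

theorem one_le_searchBound (A : Type*) [Fintype A] [Nonempty A] (k : ℕ) : 1 ≤ searchBound A k :=
  le_min (one_le_pow₀ (by norm_num)) (one_le_sqrt_card A)

theorem searchBound_le (A : Type*) [Fintype A] (k : ℕ) : searchBound A k ≤ √(Fintype.card A : ℝ) :=
  min_le_right _ _

theorem searchBound_succ_le (A : Type*) [Fintype A] (k : ℕ) :
    searchBound A (k + 1) ≤ 6 / 5 * searchBound A k := by
  have h0 : 0 ≤ √(Fintype.card A : ℝ) := Real.sqrt_nonneg _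
  rw [searchBound, searchBound, mul_min_of_nonneg _ _ (by norm_num), pow_succ']
  exact min_le_min le_rfl (by linarith)

theorem searchBound_succ (A : Type*) [Fintype A] (k : ℕ)
    (h : searchBound A (k + 1) < √(Fintype.card A : ℝ)) :
    searchBound A (k + 1) = 6 / 5 * searchBound A k := by
  have h1 : searchBound A (k + 1) = (6 / 5) ^ (k + 1) := by
    rcases min_choice ((6 / 5 : ℝ) ^ (k + 1)) √(Fintype.card A : ℝ) with h2 | h2
    · exact h2
    · rw [searchBound, h2] at h; exact absurd h (lt_irrefl _)
  have h2 : (6 / 5 : ℝ) ^ k ≤ (6 / 5) ^ (k + 1) := pow_le_pow_right₀ (by norm_num) (Nat.le_succ k)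
  rw [h1] at h ⊢
  rw [searchBound, min_eq_left (by linarith), pow_succ']

/-- A round with bound `m` uses `⌈m⌉ ≤ 2m` queries on average, as `∑_{j<N} (2j+1) = N²`. Beyond `τ`
failures have probability at most `3/4` and the bound grows by at most `6/5`, so the constant `20`
solves `2 + (3/4)(6/5)·20 = 20`. Before `τ` no success is assumed: `-10m` balances `2m - 12m`, and
`36` makes the two regimes fit, `2m + 24m ≤ 36τ - 10m` for `m ≤ τ`. -/
theorem roundCost_step (A : Type*) [Fintype A] [Nonempty A] (k : ℕ) {τ s : ℝ} (hs0 : 0 ≤ s)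
    (hs1 : s ≤ 1) (hτ : τ ≤ √(Fintype.card A : ℝ)) (hs : τ ≤ searchBound A k → 1 / 4 ≤ s) :
    ⌈searchBound A k⌉₊ + (1 - s) * roundCost τ (searchBound A (k + 1)) ≤
      roundCost τ (searchBound A k) := by
  have h1 := one_le_searchBound A k
  have h2 := one_le_searchBound A (k + 1)
  have h3 := searchBound_succ_le A k
  have h4 : (⌈searchBound A k⌉₊ : ℝ) ≤ 2 * searchBound A k := by
    have := Nat.ceil_lt_add_one (show 0 ≤ searchBound A k by linarith)
    linarith
  have h5 : searchBound A k ≤ searchBound A (k + 1) :=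
    min_le_min (pow_le_pow_right₀ (by norm_num) (Nat.le_succ k)) le_rfl
  have h6 := roundCost_nonneg (τ := τ) (m := searchBound A (k + 1)) (by linarith)
  by_cases hm : τ ≤ searchBound A k
  · have h7 := hs hm
    rw [roundCost, roundCost, if_pos hm, if_pos (hm.trans h5)]
    nlinarith
  · have h7 : (1 - s) * roundCost τ (searchBound A (k + 1)) ≤ roundCost τ (searchBound A (k + 1)) := by
      nlinarith
    rw [not_le] at hm
    have h8 : roundCost τ (searchBound A k) = 36 * τ - 10 * searchBound A k := if_neg (not_le.2 hm)
    rw [h8]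
    by_cases hm' : τ ≤ searchBound A (k + 1)
    · rw [roundCost, if_pos hm'] at h7 ⊢
      linarith
    · rw [not_le] at hm'
      -- A next bound below `τ ≤ √A` is not yet cut off at `√A`, so the growth is by exactly `6/5`.
      have h9 := searchBound_succ A k (hm'.trans_le hτ)
      rw [roundCost, if_neg (not_le.2 hm')] at h7 ⊢
      linarith

variable {A : Type*} [Fintype A] [DecidableEq A] [Nonempty A]

omit [Nonempty A] in
theorem le_mass (Q : ValueOracle A) {q p₀ t : ℝ}
    (hp : p₀ ≤ ∑ y, if q ≤ Q.val y then Q.law y else 0) (ht : t < q) : p₀ ≤ Q.mass t := by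
  refine hp.trans (sum_le_sum fun y _ => ?_)
  split_ifs with h1 h2 h2
  · exact le_rfl
  · exact absurd (ht.trans_le h1) h2
  · exact Q.law_nonneg y
  · exact le_rfl

omit [Nonempty A] in
/-- A discrete form of `∫_{p₀}^p (72 p₀^(-1/2) - 36 x^(-1/2)) dx = 72 p p₀^(-1/2) - 72 p^(1/2)`. -/
theorem sum_law_mul_le (Q : ValueOracle A) {q p₀ : ℝ} (hp₀ : 0 < p₀)
    (hp : p₀ ≤ ∑ y, if q ≤ Q.val y then Q.law y else 0) (n : ℕ) (t : ℝ) (ht : t < q)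
    (hn : (univ.filter fun y => t < Q.val y ∧ Q.val y < q).card ≤ n) :
    (∑ y, if t < Q.val y ∧ Q.val y < q then
      Q.law y * (72 / √p₀ - 36 / √(Q.mass (Q.val y))) else 0) ≤
      72 / √p₀ * Q.mass t - 72 * √(Q.mass t) := by
  have hbase : ∀ p, p₀ ≤ p → 0 ≤ 72 / √p₀ * p - 72 * √p := by
    intro p hpp
    have hs0 : 0 < √p₀ := Real.sqrt_pos.2 hp₀
    have hs : √p₀ ≤ √p := Real.sqrt_le_sqrt hpp
    have h1 : 72 / √p₀ * p = 72 * √p * (√p / √p₀) := by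
      nth_rewrite 1 [← Real.mul_self_sqrt (hp₀.le.trans hpp)]; ring
    have h2 : 1 ≤ √p / √p₀ := (one_le_div hs0).2 hs
    have h3 : 0 ≤ √p := Real.sqrt_nonneg p
    rw [h1]
    nlinarith
  induction n generalizing t with
  | zero =>
    have hempty := card_eq_zero.1 (Nat.le_zero.1 hn)
    rw [sum_eq_zero fun y _ => if_neg fun h => ?_]
    · exact hbase _ (Q.le_mass hp ht)
    · have : y ∈ univ.filter fun y => t < Q.val y ∧ Q.val y < q := mem_filter.2 ⟨mem_univ y, h⟩
      rw [hempty] at this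
      exact absurd this (notMem_empty y)
  | succ n ih =>
    rcases (univ.filter fun y => t < Q.val y ∧ Q.val y < q).eq_empty_or_nonempty with hempty | hne
    · exact ih t ht (by rw [hempty]; exact Nat.zero_le _)
    -- The lowest value above `t` is removed together with all labels sharing it; their mass is `d`.
    obtain ⟨y₀, hy₀, hmin⟩ := exists_min_image _ Q.val hne
    obtain ⟨-, hy₁, hy₂⟩ := mem_filter.1 hy₀
    have hmin' : ∀ y, t < Q.val y → Q.val y₀ ≤ Q.val y := by
      intro y hy
      by_cases h : Q.val y < q
      · exact hmin y (mem_filter.2 ⟨mem_univ y, hy, h⟩)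
      · linarith
    have hrec := ih (Q.val y₀) hy₂ (by
      have : (univ.filter fun y => Q.val y₀ < Q.val y ∧ Q.val y < q).card <
          (univ.filter fun y => t < Q.val y ∧ Q.val y < q).card := by
        refine card_lt_card ⟨fun y hy => ?_, fun h => ?_⟩
        · obtain ⟨-, h1, h2⟩ := mem_filter.1 hy
          exact mem_filter.2 ⟨mem_univ y, hy₁.trans h1, h2⟩
        · exact lt_irrefl _ (mem_filter.1 (h hy₀)).2.1
      omega)
    set d := ∑ y, if Q.val y = Q.val y₀ then Q.law y else 0 with hd
    set p := Q.mass (Q.val y₀) with hpdef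
    have hpp : p₀ ≤ p := Q.le_mass hp hy₂
    have hd0 : 0 ≤ d := sum_nonneg fun y _ => by split_ifs <;> [exact Q.law_nonneg y; rfl]
    have hmass : Q.mass t = d + p := by
      rw [hd, hpdef, mass, mass, ← sum_add_distrib]
      refine sum_congr rfl fun y _ => ?_
      by_cases h1 : t < Q.val y
      · rcases (hmin' y h1).lt_or_eq with h2 | h2
        · rw [if_pos h1, if_neg h2.ne', if_pos h2, zero_add]
        · rw [if_pos h1, if_pos h2.symm, if_neg (by rw [h2]; exact lt_irrefl _), add_zero]
      · rw [if_neg h1, if_neg (by rintro h; exact h1 (h ▸ hy₁)),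
          if_neg fun h => h1 (hy₁.trans h), add_zero]
    have hsplit : (∑ y, if t < Q.val y ∧ Q.val y < q then
        Q.law y * (72 / √p₀ - 36 / √(Q.mass (Q.val y))) else 0) =
        d * (72 / √p₀ - 36 / √p) + ∑ y, if Q.val y₀ < Q.val y ∧ Q.val y < q then
        Q.law y * (72 / √p₀ - 36 / √(Q.mass (Q.val y))) else 0 := by
      rw [hd, sum_mul, ← sum_add_distrib]
      refine sum_congr rfl fun y _ => ?_
      by_cases h1 : t < Q.val y
      · rcases (hmin' y h1).lt_or_eq with h2 | h2
        · simp only [h1, h2, h2.ne', true_and, if_false, zero_mul, zero_add]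
        · simp only [← h2, hy₁, hy₂, true_and, if_true, lt_irrefl, false_and, if_false, add_zero,
            hpdef]
      · rw [if_neg fun h => h1 h.1, if_neg (by rintro h; exact h1 (h ▸ hy₁)),
          if_neg fun h => h1 (hy₁.trans h.1)]
        simp
    have hsp : 0 < √p := Real.sqrt_pos.2 (hp₀.trans_le hpp)
    -- Concavity of the square root plays the role of comparing the sum with the integral.
    have hconc : √(d + p) ≤ √p + d / (2 * √p) := by
      rw [Real.sqrt_le_left (by positivity)]
      have h1 : (√p + d / (2 * √p)) ^ 2 = √p ^ 2 + d + (d / (2 * √p)) ^ 2 := by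
        field_simp
        ring
      rw [h1, Real.sq_sqrt (hp₀.le.trans hpp)]
      nlinarith [sq_nonneg (d / (2 * √p))]
    rw [hsplit, hmass]
    have h2 : d * (36 / √p) = 72 * (d / (2 * √p)) := by field_simp; ring
    nlinarith

/-- A bound on the expected number of queries until maximum finding exceeds a threshold reached by
labels of probability `p₀`, when the best value so far is `t` and the last `k` rounds failed. -/
def searchCost (Q : ValueOracle A) (p₀ t : ℝ) (k : ℕ) : ℝ :=
  72 / √p₀ - 72 / √(Q.mass t) + roundCost (1 / √(2 * Q.mass t)) (searchBound A k)

/-- After a success the bound is back at `1`, so the next success costs at most `36 / √mass`. This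
turns `searchCost` into the integrand summed in `sum_law_mul_le`: conditioned on success, the new
label follows the original law restricted to values above `t`, whatever `j` was. -/
theorem searchCost_zero_le (Q : ValueOracle A) {p₀ t : ℝ} (hp₀ : 0 < p₀) (hp : p₀ ≤ Q.mass t) :
    Q.searchCost p₀ t 0 ≤ 72 / √p₀ - 36 / √(Q.mass t) := by
  have hs : 0 < √(Q.mass t) := Real.sqrt_pos.2 (hp₀.trans_le hp)
  have h1 : √(Q.mass t) ≤ 1 := Real.sqrt_le_one.2 (Q.mass_le_one t)
  have h2 : 1 / √(2 * Q.mass t) ≤ 1 / √(Q.mass t) :=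
    one_div_le_one_div_of_le hs (Real.sqrt_le_sqrt (by linarith))
  have h3 : searchBound A 0 ≤ 1 / √(Q.mass t) := by
    rw [le_div_iff₀ hs]
    have : searchBound A 0 ≤ 1 := (min_le_left _ _).trans (by norm_num)
    nlinarith [one_le_searchBound A 0]
  have h4 := roundCost_le (by linarith [one_le_searchBound A 0]) h2 h3
  have h5 : 36 * (1 / √(Q.mass t)) = 72 / √(Q.mass t) - 36 / √(Q.mass t) := by ring
  rw [searchCost]
  linarith

/-- The expected cost after a round with `j` Grover iterations, plus `c` if the search has not
reached the threshold `q`. -/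
theorem sum_groverLaw_searchCost_le (Q : ValueOracle A) {q p₀ t c : ℝ} (hp₀ : 0 < p₀)
    (hp : p₀ ≤ ∑ y, if q ≤ Q.val y then Q.law y else 0) (ht : t < q) (hc : 0 ≤ c) (k j : ℕ) :
    (∑ y, Q.groverLaw t j y * if t < Q.val y then
        if Q.val y < q then c + Q.searchCost p₀ (Q.val y) 0 else 0
      else c + Q.searchCost p₀ t (k + 1)) ≤
      c + (72 / √p₀ - 72 / √(Q.mass t)) + (1 - Real.sin ((2 * j + 1) * Q.angle t) ^ 2) *
        roundCost (1 / √(2 * Q.mass t)) (searchBound A (k + 1)) := by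
  set s := Real.sin ((2 * j + 1) * Q.angle t) ^ 2 with hs
  set a := (ampCoeff (Q.angle t) j).1 with ha
  have hpm : 0 < Q.mass t := hp₀.trans_le (Q.le_mass hp ht)
  have hsm : 0 < √(Q.mass t) := Real.sqrt_pos.2 hpm
  have has : a ^ 2 * Q.mass t = s := by
    rw [hs, ← (ampCoeff_mul (Q.angle t) j).1, mul_pow, ← mass_eq]
  have hsucc := Q.sum_groverLaw_success_one t j
  have hfail : (∑ y, if t < Q.val y then 0 else Q.groverLaw t j y) = 1 - s := by
    rw [hs, ← hsucc, ← Q.sum_groverLaw t j, ← sum_sub_distrib]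
    refine sum_congr rfl fun y _ => ?_
    split_ifs <;> ring
  have hterm : ∀ y, (Q.groverLaw t j y * if t < Q.val y then
        if Q.val y < q then c + Q.searchCost p₀ (Q.val y) 0 else 0
      else c + Q.searchCost p₀ t (k + 1)) ≤
      c * (if t < Q.val y then Q.groverLaw t j y else 0) +
      a ^ 2 * (if t < Q.val y ∧ Q.val y < q then
        Q.law y * (72 / √p₀ - 36 / √(Q.mass (Q.val y))) else 0) +
      (c + Q.searchCost p₀ t (k + 1)) * (if t < Q.val y then 0 else Q.groverLaw t j y) := by
    intro y
    have h0 := Q.groverLaw_nonneg t j y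
    by_cases h1 : t < Q.val y
    · by_cases h2 : Q.val y < q
      · simp only [h1, h2, and_self, if_true, mul_zero, add_zero]
        have h3 := Q.searchCost_zero_le hp₀ (Q.le_mass hp h2)
        have h4 : Q.groverLaw t j y = a ^ 2 * Q.law y := by rw [groverLaw, if_pos h1]
        have h5 : 0 ≤ a ^ 2 * Q.law y := mul_nonneg (sq_nonneg _) (Q.law_nonneg y)
        rw [h4]
        nlinarith
      · simp only [h1, h2, and_false, if_true, if_false, mul_zero, add_zero]
        positivity
    · simp only [h1, false_and, if_false, mul_zero, zero_add]
      linarith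
  refine (sum_le_sum fun y _ => hterm y).trans ?_
  rw [sum_add_distrib, sum_add_distrib, ← mul_sum, ← mul_sum, ← mul_sum, hsucc, hfail]
  have h1 := mul_le_mul_of_nonneg_left (Q.sum_law_mul_le hp₀ hp _ t ht le_rfl) (sq_nonneg a)
  have h2 : a ^ 2 * (72 / √p₀ * Q.mass t - 72 * √(Q.mass t)) =
      s * (72 / √p₀ - 72 / √(Q.mass t)) := by
    have h3 : √(Q.mass t) = Q.mass t / √(Q.mass t) := by
      rw [eq_div_iff hsm.ne', Real.mul_self_sqrt hpm.le]
    rw [← has]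
    linear_combination (-72 * a ^ 2) * h3
  rw [searchCost]
  nlinarith

/-- Averaged over `j`, the expected cost drops by at least `N = ⌈searchBound A k⌉`, the mean number
of queries of the round. Hypothesis `hA` ensures that a bound capped at `√A` still reaches the
threshold `1 / √(2 mass)`. -/
theorem searchCost_step (Q : ValueOracle A) {q p₀ t c : ℝ} (hp₀ : 0 < p₀)
    (hp : p₀ ≤ ∑ y, if q ≤ Q.val y then Q.law y else 0) (ht : t < q) (k : ℕ)
    (hA : 1 / √(2 * p₀) ≤ √(Fintype.card A : ℝ)) :
    (∑ j ∈ range ⌈searchBound A k⌉₊,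
      (c + (72 / √p₀ - 72 / √(Q.mass t)) + (1 - Real.sin ((2 * j + 1) * Q.angle t) ^ 2) *
        roundCost (1 / √(2 * Q.mass t)) (searchBound A (k + 1)))) ≤
      ⌈searchBound A k⌉₊ * (c + Q.searchCost p₀ t k - ⌈searchBound A k⌉₊) := by
  set N := ⌈searchBound A k⌉₊ with hN
  set τ := 1 / √(2 * Q.mass t) with hτ
  have hpm : p₀ ≤ Q.mass t := Q.le_mass hp ht
  have hpm0 : 0 < Q.mass t := hp₀.trans_le hpm
  have hNm : searchBound A k ≤ N := Nat.le_ceil _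
  have hN0 : (0 : ℝ) < N := by linarith [one_le_searchBound A k]
  set T := ∑ j ∈ range N, Real.sin ((2 * j + 1) * Q.angle t) ^ 2 with hT
  have hT0 : 0 ≤ T := sum_nonneg fun j _ => sq_nonneg _
  have hT1 : T ≤ N := by
    calc T ≤ ∑ j ∈ range N, (1 : ℝ) := sum_le_sum fun j _ => Real.sin_sq_le_one _
      _ = N := by simp
  have hτA : τ ≤ √(Fintype.card A : ℝ) :=
    (one_div_le_one_div_of_le (Real.sqrt_pos.2 (by linarith))
      (Real.sqrt_le_sqrt (by linarith))).trans hA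
  have hstep := roundCost_step A k (τ := τ) (s := T / N) (by positivity)
    ((div_le_one hN0).2 hT1) hτA (fun hm => by
      rw [le_div_iff₀ hN0]
      have hq := quarter_le_sum_sin_sq (θ := Q.angle t) (N := N)
        (Real.arcsin_pos.2 (Real.sqrt_pos.2 hpm0)) (Real.arcsin_le_pi_div_two _) (by
          rw [sin_angle]
          have h1 : √(2 * Q.mass t) = √2 * √(Q.mass t) := Real.sqrt_mul (by norm_num) _
          have h2 : τ ≤ N := hm.trans hNm
          rw [hτ, h1, div_le_iff₀ (by positivity)] at h2
          linarith)
      linarith)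
  rw [sum_add_distrib, sum_const, card_range, nsmul_eq_mul, ← sum_mul, sum_sub_distrib, sum_const,
    card_range, nsmul_eq_mul, mul_one, ← hT, searchCost]
  have h3 : (N - T) * roundCost τ (searchBound A (k + 1)) =
      N * ((1 - T / N) * roundCost τ (searchBound A (k + 1))) := by field_simp
  rw [h3]
  have h4 := mul_le_mul_of_nonneg_left hstep hN0.le
  linarith

end ValueOracle

end QMDP

end

/-! ### Exponential tail for the search time -/

noncomputable section

namespace QMDP

open Finset
open scoped ENNReal

theorem expect_le_of_le {α : Type*} (P : PMF α) {F : α → ℝ≥0∞} {c : ℝ≥0∞} (h : ∀ x, F x ≤ c) :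
    expect P F ≤ c :=
  (expect_mono P h).trans (expect_const P c).le

theorem expect_const_mul {α : Type*} (P : PMF α) (c : ℝ≥0∞) (F : α → ℝ≥0∞) :
    expect P (fun x => c * F x) = c * expect P F := by
  simp only [expect, mul_left_comm, ENNReal.tsum_mul_left]

namespace ValueOracle

variable {A : Type*} [Fintype A] [DecidableEq A] [Nonempty A]

/-- Every round costs at least one query. -/
theorem expect_searchLoop_mono (Q : ValueOracle A) (B : ℝ) {F G : (A × Q.W) × ℕ × ℕ → ℝ≥0∞} (n : ℕ)
    (σ : (A × Q.W) × ℕ × ℕ) (h : ∀ σ', σ.2.2 + n ≤ σ'.2.2 → F σ' ≤ G σ') :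
    expect (Q.searchLoop B n σ) F ≤ expect (Q.searchLoop B n σ) G := by
  induction n generalizing σ with
  | zero =>
    rw [searchLoop, expect_pure, expect_pure]
    exact h σ le_rfl
  | succ n ih =>
    obtain ⟨x, k, c⟩ := σ
    have ih' : ∀ x' k' j, expect (Q.searchLoop B n (x', k', c + (2 * j + 1))) F ≤
        expect (Q.searchLoop B n (x', k', c + (2 * j + 1))) G := fun x' k' j =>
      ih _ fun σ' hσ' => h σ' (by simp only at hσ' ⊢; omega)
    rw [searchLoop, expect_bind, expect_bind, expect_searchStep, expect_searchStep]
    refine expect_mono _ fun j => ?_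
    split_ifs
    · exact ih' _ _ _
    · refine expect_mono _ fun y => ?_
      split_ifs <;> exact ih' _ _ _

theorem searchCost_nonneg (Q : ValueOracle A) {p₀ t : ℝ} (hp₀ : 0 < p₀) (hp : p₀ ≤ Q.mass t)
    (k : ℕ) : 0 ≤ Q.searchCost p₀ t k := by
  have h1 : 72 / √(Q.mass t) ≤ 72 / √p₀ :=
    div_le_div_of_nonneg_left (by norm_num) (Real.sqrt_pos.2 hp₀) (Real.sqrt_le_sqrt hp)
  have h2 := roundCost_nonneg (τ := 1 / √(2 * Q.mass t)) (m := searchBound A k)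
    (by linarith [one_le_searchBound A k])
  rw [searchCost]
  linarith

theorem searchCost_le (Q : ValueOracle A) {t : ℝ} (hp : 1 / (2 * Fintype.card A) ≤ Q.mass t)
    (k : ℕ) : Q.searchCost (1 / (2 * Fintype.card A)) t k ≤ 144 * √(Fintype.card A : ℝ) := by
  have hA : (0 : ℝ) < Fintype.card A := by exact_mod_cast Fintype.card_pos
  have h0 : (0 : ℝ) < 1 / (2 * Fintype.card A) := by positivity
  have h1 : 72 / √(1 / (2 * Fintype.card A)) ≤ 108 * √(Fintype.card A : ℝ) := by
    rw [Real.sqrt_div zero_le_one, Real.sqrt_one, div_div_eq_mul_div, div_one,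
      Real.sqrt_mul (by norm_num)]
    have : √2 ≤ 3 / 2 := (Real.sqrt_le_left (by norm_num)).2 (by norm_num)
    have := mul_le_mul_of_nonneg_right this (Real.sqrt_nonneg (Fintype.card A : ℝ))
    linarith
  have h2 : 1 / √(2 * Q.mass t) ≤ √(Fintype.card A : ℝ) := by
    rw [div_le_iff₀ (Real.sqrt_pos.2 (by linarith)), ← Real.sqrt_mul hA.le]
    apply Real.one_le_sqrt.2
    rw [div_le_iff₀ (by positivity)] at hp
    linarith
  have h3 := roundCost_le (m := searchBound A k) (by linarith [one_le_searchBound A k]) h2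
    (searchBound_le A k)
  have h4 : 0 ≤ 72 / √(Q.mass t) := by positivity
  rw [searchCost]
  linarith

/-- Maximum finding reaches values that are attained with probability at least `1 / (2 A)`. -/
theorem qArgmax_lt_le (Q : ValueOracle A) (f q : ℝ)
    (hq : 1 / (2 * Fintype.card A) ≤ ∑ y, if q ≤ Q.val y then Q.law y else 0) :
    (qArgmax Q f).toOuterMeasure {y | Q.val y < q} ≤
      ENNReal.ofReal (2 * Real.exp ((1 + 3 * √(Fintype.card A : ℝ) - queryBudget A f) /
        (576 * √(Fintype.card A : ℝ)))) := by
  set B := queryBudget A f with hB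
  set R := √(Fintype.card A : ℝ) with hR
  set p₀ : ℝ := 1 / (2 * Fintype.card A) with hp₀def
  have hA : (0 : ℝ) < Fintype.card A := by exact_mod_cast Fintype.card_pos
  have hR1 : 1 ≤ R := one_le_sqrt_card A
  have hR0 : 0 < R := by linarith
  have hp₀ : 0 < p₀ := by positivity
  have hp₀R : 1 / √(2 * p₀) ≤ R := by
    have : 2 * p₀ = 1 / Fintype.card A := by rw [hp₀def]; field_simp
    rw [this, Real.sqrt_div zero_le_one, Real.sqrt_one, one_div_one_div]
  -- `m` bounds `searchCost`, so the shifted cost `V = m + searchCost` lies between `m` and `2m`.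
  -- The rate `α = 1 / (4m)` is the largest for which the exponential correction below is covered by
  -- the drop of `V`.
  set m : ℝ := 144 * R with hm
  set K : ℝ := 3 * R with hK
  set α : ℝ := 1 / (576 * R) with hα
  have hα0 : 0 < α := by positivity
  have hαm : 4 * α * m = 1 := by rw [hα, hm]; field_simp; norm_num
  have hαK : α * K ≤ 1 := by
    have : α * K = 3 / 576 := by rw [hα, hK]; field_simp
    rw [this]; norm_num
  have hm0 : 0 < m := by positivity
  set V : ℝ → ℕ → ℝ := fun t k => m + Q.searchCost p₀ t k with hV
  have hcost0 : ∀ t k, t < q → m ≤ V t k := fun t k ht => by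
    have := Q.searchCost_nonneg hp₀ (Q.le_mass hq ht) k
    simp only [hV]; linarith
  have hcost1 : ∀ t k, t < q → V t k ≤ 2 * m := fun t k ht => by
    have := Q.searchCost_le (Q.le_mass hq ht) k
    simp only [hV]; linarith
  -- Exponential supermartingale `exp (α c) V`, zero once `q` is reached. It is frozen beyond `B -
  -- K`: a round needs at most `K` queries, so before that point the budget never interferes.
  set G : ℝ → ℕ → ℕ → ℝ := fun t k c => if t < q then
    if c ≤ B - K then Real.exp (α * c) * V t k else Real.exp (α * (B - K)) * m else 0 with hG
  have hG0 : ∀ t k c, 0 ≤ G t k c := by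
    intro t k c
    simp only [hG]
    split_ifs with h1 h2
    · exact mul_nonneg (Real.exp_pos _).le (hm0.le.trans (hcost0 t k h1))
    · positivity
    · exact le_rfl
  have hGle : ∀ t k c, t < q → G t k c ≤ Real.exp (α * c) * V t k := by
    intro t k c ht
    simp only [hG, if_pos ht]
    split_ifs with h2
    · exact le_rfl
    · refine mul_le_mul (Real.exp_le_exp.2 ?_) (hcost0 t k ht) hm0.le (Real.exp_pos _).le
      exact mul_le_mul_of_nonneg_left (not_le.1 h2).le hα0.le
  set F : (A × Q.W) × ℕ × ℕ → ℝ≥0∞ := fun σ => ENNReal.ofReal (G (Q.val σ.1) σ.2.1 σ.2.2) with hF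
  have hstep : ∀ σ, expect (Q.searchStep B σ) F ≤ F σ := by
    rintro ⟨x, k, c⟩
    by_cases ht : Q.val x < q
    swap
    · have hz : ∀ t k c, ¬ t < q → ENNReal.ofReal (G t k c) = 0 := by
        intro t k c h
        simp only [hG, if_neg h, ENNReal.ofReal_zero]
      rw [expect_searchStep, show F (x, k, c) = 0 from hz _ _ _ ht]
      refine expect_le_of_le _ fun j => ?_
      split_ifs
      · exact (hz _ _ _ ht).le
      · refine expect_le_of_le _ fun y => ?_
        split_ifs with h
        · exact (hz _ _ _ fun h' => ht (h.trans h')).le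
        · exact (hz _ _ _ ht).le
    by_cases hc : (c : ℝ) ≤ B - K
    swap
    · have hz : ∀ t k' (j : ℕ), ENNReal.ofReal (G t k' (c + j)) ≤ F (x, k, c) := by
        intro t k' j
        apply ENNReal.ofReal_le_ofReal
        have hj : ¬ ((c + j : ℕ) : ℝ) ≤ B - K := by
          push_cast
          have : (0 : ℝ) ≤ j := Nat.cast_nonneg j
          intro h; exact hc (by linarith)
        simp only [hG, if_pos ht, if_neg hc, if_neg hj]
        split_ifs
        · exact le_rfl
        · positivity
      rw [expect_searchStep]
      refine expect_le_of_le _ fun j => ?_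
      split_ifs
      · exact hz (Q.val x) k (2 * j + 1)
      · refine expect_le_of_le _ fun y => ?_
        split_ifs
        · exact hz (Q.val y) 0 (2 * j + 1)
        · exact hz (Q.val x) (k + 1) (2 * j + 1)
    set D : ℕ → ℝ := fun j => m + (72 / √p₀ - 72 / √(Q.mass (Q.val x))) +
      (1 - Real.sin ((2 * j + 1) * Q.angle (Q.val x)) ^ 2) *
        roundCost (1 / √(2 * Q.mass (Q.val x))) (searchBound A (k + 1)) with hD
    set Y : ℕ → ℝ := fun j => ∑ y, Q.groverLaw (Q.val x) j y * if Q.val x < Q.val y then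
        if Q.val y < q then V (Q.val y) 0 else 0 else V (Q.val x) (k + 1) with hY
    have hYD : ∀ j, Y j ≤ D j := fun j =>
      Q.sum_groverLaw_searchCost_le hp₀ hq ht hm0.le k j
    have hV0 : ∀ y, 0 ≤ if Q.val x < Q.val y then
        if Q.val y < q then V (Q.val y) 0 else 0 else V (Q.val x) (k + 1) := by
      intro y
      split_ifs with h1 h2
      · exact hm0.le.trans (hcost0 _ _ h2)
      · exact le_rfl
      · exact hm0.le.trans (hcost0 _ _ ht)
    have hY0 : ∀ j, 0 ≤ Y j := fun j =>
      sum_nonneg fun y _ => mul_nonneg (Q.groverLaw_nonneg _ _ _) (hV0 y)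
    have hYm : ∀ j, Y j ≤ 2 * m := by
      intro j
      calc Y j ≤ ∑ y, Q.groverLaw (Q.val x) j y * (2 * m) := by
            refine sum_le_sum fun y _ => mul_le_mul_of_nonneg_left ?_ (Q.groverLaw_nonneg _ _ _)
            split_ifs with h1 h2
            · exact hcost1 _ _ h2
            · linarith
            · exact hcost1 _ _ ht
        _ = 2 * m := by rw [← sum_mul, sum_groverLaw, one_mul]
    rw [expect_searchStep]
    refine expect_uniformOfFinset_range _ _
      (w := fun j => Real.exp (α * c) * (D j + (2 * j + 1)))
      (fun j _ => mul_nonneg (Real.exp_pos _).le (by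
        have h1 : (0 : ℝ) ≤ j := Nat.cast_nonneg j
        linarith [hY0 j, hYD j])) (fun j hj => ?_) ?_
    · have hjK : 2 * (j : ℝ) + 1 ≤ K := queries_le hj
      rw [if_neg (by push_cast; linarith)]
      -- `exp x ≤ 1 + 2x` for `0 ≤ x ≤ 1`; the hypothesis is met because `α K ≤ 1`.
      have hexp : Real.exp (α * ((c + (2 * j + 1) : ℕ) : ℝ)) ≤
          Real.exp (α * c) * (1 + 2 * (α * (2 * j + 1))) := by
        push_cast
        rw [mul_add, Real.exp_add]
        refine mul_le_mul_of_nonneg_left ?_ (Real.exp_pos _).le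
        have h1 : 0 ≤ α * (2 * (j : ℝ) + 1) := by positivity
        have h2 : α * (2 * (j : ℝ) + 1) ≤ 1 := (mul_le_mul_of_nonneg_left hjK hα0.le).trans hαK
        have h3 := Real.abs_exp_sub_one_le (x := α * (2 * (j : ℝ) + 1)) (by rwa [abs_of_nonneg h1])
        rw [abs_of_nonneg h1] at h3
        linarith [le_abs_self (Real.exp (α * (2 * (j : ℝ) + 1)) - 1)]
      refine expect_le_ofReal _ (Q.groverLaw (Q.val x) j) (Q.groverMeasure_eq _ _)
        (Q.groverLaw_nonneg _ _) (G := fun y => Real.exp (α * ((c + (2 * j + 1) : ℕ) : ℝ)) *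
          if Q.val x < Q.val y then if Q.val y < q then V (Q.val y) 0 else 0
          else V (Q.val x) (k + 1))
        (fun y => mul_nonneg (Real.exp_pos _).le (hV0 y)) (fun y => ?_) ?_
      · split_ifs with h1 h2
        · exact ENNReal.ofReal_le_ofReal (hGle _ _ _ h2)
        · simp only [hF, hG, if_neg h2, ENNReal.ofReal_zero]
          exact zero_le
        · exact ENNReal.ofReal_le_ofReal (hGle _ _ _ ht)
      · calc _ = Real.exp (α * ((c + (2 * j + 1) : ℕ) : ℝ)) * Y j := by
              simp only [hY, mul_sum]
              exact sum_congr rfl fun y _ => by ring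
          _ ≤ Real.exp (α * c) * (1 + 2 * (α * (2 * j + 1))) * Y j :=
              mul_le_mul_of_nonneg_right hexp (hY0 j)
          _ = Real.exp (α * c) * (Y j + 2 * (α * (2 * j + 1)) * Y j) := by ring
          _ ≤ Real.exp (α * c) * (D j + 2 * (α * (2 * j + 1)) * (2 * m)) := by
              refine mul_le_mul_of_nonneg_left (add_le_add (hYD j) ?_) (Real.exp_pos _).le
              exact mul_le_mul_of_nonneg_left (hYm j) (by positivity)
          -- As `4 α m = 1`, the correction is exactly the number of queries. Its average over `j`
          -- is `N`, the drop provided by `searchCost_step`.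
          _ = Real.exp (α * c) * (D j + (2 * j + 1)) := by
              congr 2
              linear_combination (2 * (j : ℝ) + 1) * hαm
    · rw [← mul_sum, sum_add_distrib]
      have h1 := Q.searchCost_step (c := m) hp₀ hq ht k hp₀R
      have h2 : ∀ N : ℕ, ∑ j ∈ range N, (2 * (j : ℝ) + 1) = N * N := by
        intro N
        induction N with
        | zero => simp
        | succ N ih => rw [sum_range_succ, ih]; push_cast; ring
      rw [h2]
      have h3 : G (Q.val x) k c = Real.exp (α * c) * V (Q.val x) k := by
        simp only [hG, if_pos ht, if_pos hc]
      simp only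
      rw [h3, mul_left_comm]
      refine mul_le_mul_of_nonneg_left ?_ (Real.exp_pos _).le
      simp only [hV]
      linarith
  -- Markov's inequality at level `E`: the loop has `⌈B⌉₊` rounds, each counting at least one query,
  -- so at its end the count exceeds `B - K` and an unsuccessful search has potential exactly `E`.
  set E : ℝ := Real.exp (α * (B - K)) * m with hE
  have hE0 : 0 < E := by positivity
  rw [qArgmax, ← hB]
  refine le_trans (toOuterMeasure_le_expect _ (F := fun y => if Q.val y < q then 1 else 0)
    fun y hy => by rw [if_pos (show Q.val y < q from hy)]) ?_
  rw [expect_map, expect_bind]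
  have hloop : ∀ x, expect (Q.searchLoop B ⌈B⌉₊ (x, 0, 1))
      (fun σ => if Q.val σ.1 < q then 1 else 0) ≤
      ENNReal.ofReal E⁻¹ * F (x, 0, 1) := by
    intro x
    calc _ ≤ expect (Q.searchLoop B ⌈B⌉₊ (x, 0, 1)) fun σ => ENNReal.ofReal E⁻¹ * F σ := by
          refine Q.expect_searchLoop_mono B _ _ fun σ hσ => ?_
          split_ifs with h
          · have hc : ¬ ((σ.2.2 : ℕ) : ℝ) ≤ B - K := by
              have h1 : ((1 + ⌈B⌉₊ : ℕ) : ℝ) ≤ (σ.2.2 : ℕ) := by exact_mod_cast hσ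
              have h2 := Nat.le_ceil B
              push_cast at h1
              rw [not_le]; linarith
            simp only [hF, hG, if_pos h, if_neg hc]
            rw [← ENNReal.ofReal_mul (by positivity), inv_mul_cancel₀ hE0.ne', ENNReal.ofReal_one]
          · exact zero_le
      _ ≤ ENNReal.ofReal E⁻¹ * F (x, 0, 1) := by
          rw [expect_const_mul]
          exact mul_le_mul_right (Q.expect_searchLoop_le B F hstep _ _) _
  refine (expect_mono _ hloop).trans (expect_le_of_le _ fun x => ?_)
  have hinit : G (Q.val x) 0 1 ≤ Real.exp α * (2 * m) := by
    by_cases h : Q.val x < q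
    · refine (hGle _ _ _ h).trans ?_
      rw [Nat.cast_one, mul_one]
      exact mul_le_mul_of_nonneg_left (hcost1 _ _ h) (Real.exp_pos _).le
    · simp only [hG, if_neg h]
      positivity
  rw [← ENNReal.ofReal_mul (by positivity)]
  apply ENNReal.ofReal_le_ofReal
  calc E⁻¹ * G (Q.val x) 0 1 ≤ E⁻¹ * (Real.exp α * (2 * m)) :=
        mul_le_mul_of_nonneg_left hinit (by positivity)
    _ = 2 * Real.exp (α - α * (B - K)) := by
        rw [hE, Real.exp_sub]; field_simp
    _ = 2 * Real.exp ((1 + K - B) / (576 * R)) := by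
        congr 2; rw [hα]; field_simp; ring

end ValueOracle

end QMDP

end

/-! ### From single calls to the whole algorithm -/

noncomputable section

namespace QMDP

open Finset
open scoped ENNReal

/-! ### Union bounds -/

theorem expect_indep {ι : Type*} [Fintype ι] [DecidableEq ι] {β : ι → Type*} [∀ i, Fintype (β i)]
    (P : ∀ i, PMF (β i)) (i : ι) (F : β i → ℝ≥0∞) :
    expect (indep P) (fun x => F (x i)) = expect (P i) F := by
  classical
  let G : ∀ j, β j → ℝ≥0∞ := fun j y => if h : j = i then P j y * F (h ▸ y) else P j y
  have h1 : ∀ x : ∀ j, β j, (∏ j, P j (x j)) * F (x i) = ∏ j, G j (x j) := by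
    intro x
    rw [← mul_prod_erase univ _ (mem_univ i), ← mul_prod_erase univ (fun j => G j (x j)) (mem_univ i)]
    have : ∏ j ∈ univ.erase i, G j (x j) = ∏ j ∈ univ.erase i, P j (x j) :=
      prod_congr rfl fun j hj => dif_neg (ne_of_mem_erase hj)
    rw [this]
    simp only [G, dif_pos]
    ring
  have h2 : ∀ j, ∑ y, G j y = if j = i then expect (P i) F else 1 := by
    intro j
    by_cases h : j = i
    · subst h
      simp only [G, dif_pos, if_true, expect, tsum_fintype]
    · simp only [G, dif_neg h, if_neg h]
      rw [← tsum_fintype (L := .unconditional _), (P j).tsum_coe]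
  rw [expect, tsum_fintype]
  calc ∑ x, indep P x * F (x i) = ∑ x : ∀ j, β j, ∏ j, G j (x j) :=
        sum_congr rfl fun x _ => h1 x
    _ = ∏ j, ∑ y, G j y := by
        rw [prod_univ_sum, Fintype.piFinset_univ]
    _ = expect (P i) F := by
        simp only [h2, prod_ite_eq', mem_univ, if_true]

theorem indep_exists_le {ι : Type*} [Fintype ι] [DecidableEq ι] {β : ι → Type*}
    [∀ i, Fintype (β i)] (P : ∀ i, PMF (β i)) (B : ∀ i, Set (β i)) :
    (indep P).toOuterMeasure {x | ∃ i, x i ∈ B i} ≤ ∑ i, (P i).toOuterMeasure (B i) := by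
  have h : {x : ∀ i, β i | ∃ i, x i ∈ B i} = ⋃ i, {x | x i ∈ B i} := by
    ext x; simp
  rw [h]
  refine (MeasureTheory.measure_iUnion_fintype_le _ _).trans (sum_le_sum fun i _ => ?_)
  rw [toOuterMeasure_eq_expect, toOuterMeasure_eq_expect, ← expect_indep P i]
  exact le_rfl

theorem toOuterMeasure_bind_le {α β : Type*} (P : PMF α) (K : α → PMF β) (s : Set α) (t : Set β)
    {b c : ℝ≥0∞} (hP : P.toOuterMeasure s ≤ b) (hK : ∀ x ∉ s, (K x).toOuterMeasure t ≤ c) :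
    (P.bind K).toOuterMeasure t ≤ b + c := by
  rw [toOuterMeasure_eq_expect, expect_bind]
  calc _ ≤ expect P fun x => s.indicator 1 x + c := by
        refine expect_mono P fun x => ?_
        rw [← toOuterMeasure_eq_expect]
        by_cases hx : x ∈ s
        · rw [Set.indicator_of_mem hx]
          refine le_trans ?_ le_self_add
          rw [toOuterMeasure_eq_expect]
          refine expect_le_of_le _ fun y => ?_
          by_cases hy : y ∈ t <;> simp [hy]
        · rw [Set.indicator_of_notMem hx, zero_add]
          exact hK x hx
    _ ≤ b + c := by
        rw [expect_add, expect_const, ← toOuterMeasure_eq_expect]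
        gcongr

/-! ### One call of maximum finding -/

section Solve

variable {S A J : Type*} [Fintype S] [DecidableEq S] [Fintype A] [DecidableEq A] [Nonempty A]
  [Fintype J] [DecidableEq J]
  {M : MDP S A} {s₀ : S} {j₀ : J} {O : Matrix.unitaryGroup (S × A × S × J) ℂ}

/-- Subtracting `η` in the oracle makes every accurate label an underestimate, so only inaccurate
labels can overshoot. Each action contributes at most `f / A` to their mass. -/
theorem qArgmax_qOracle_over_le (hO : IsGenerativeModel M s₀ j₀ O) {η f : ℝ} (hη : 0 < η)
    (hf : 0 < f) (hf1 : f ≤ 1) (hB : 1 ≤ queryBudget A f) {v : S → ℝ} (hv0 : ∀ t, 0 ≤ v t)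
    (hv : ∀ t, v t ≤ M.horizon) (s : S) :
    (qArgmax (qOracle M O s₀ j₀ η f v s) f).toOuterMeasure
      {x | M.r s x.1 + M.γ * M.stepMean s x.1 v < (qOracle M O s₀ j₀ η f v s).val x} ≤
      ENNReal.ofReal (f * (3 * √(Fintype.card A : ℝ)) * queryBudget A f) := by
  classical
  have hA : (0 : ℝ) < Fintype.card A := by exact_mod_cast Fintype.card_pos
  set Q := qOracle M O s₀ j₀ η f v s with hQ
  refine le_trans ?_ (Q.qArgmax_bad_le f hB
    (fun y => η < |estimate M.horizon (J := J) (n := numPoints M.horizon η) (m := numRuns f) y.2 -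
      M.stepMean s y.1 v|) (p := f) ?_)
  · refine MeasureTheory.measure_mono fun x hx => ?_
    by_contra hbad
    refine not_le_of_gt (show M.r s x.1 + M.γ * M.stepMean s x.1 v < Q.val x from hx) (max_le ?_ ?_)
    · refine add_le_add le_rfl (mul_le_mul_of_nonneg_left ?_ M.γ_nonneg)
      have hbad' : |estimate M.horizon (J := J) (n := numPoints M.horizon η) (m := numRuns f) x.2 -
          M.stepMean s x.1 v| ≤ η := not_lt.1 fun h => hbad h
      linarith [(abs_le.1 hbad').2]
    · have := mul_nonneg M.γ_nonneg (M.stepMean_nonneg s x.1 hv0)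
      linarith [M.r_nonneg s x.1]
  · have h : ∀ y : A × Q.W, (if η < |estimate M.horizon (J := J) (n := numPoints M.horizon η)
        (m := numRuns f) y.2 - M.stepMean s y.1 v| then Q.law y else 0) =
        ∑ a, if y.1 = a ∧ η < |estimate M.horizon (J := J) (n := numPoints M.horizon η)
          (m := numRuns f) y.2 - M.stepMean s a v| then Q.law y else 0 := by
      intro y
      rw [sum_eq_single y.1 (fun a _ ha => if_neg fun h => ha h.1.symm) (by simp)]
      simp
    rw [sum_congr rfl fun y _ => h y, sum_comm]
    calc _ ≤ ∑ _a : A, 1 / (Fintype.card A : ℝ) * f :=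
          sum_le_sum fun a _ => sum_law_qOracle_err_le hO hη hf hf1 hv0 hv s a
      _ = f := by
          rw [sum_const, card_univ, nsmul_eq_mul]; field_simp

/-- It suffices to reach the target of the best action `a`. An accurate label of `a` loses at most
`2η`: one `η` from the estimate and one from the shift. Such labels have mass at least `(1 - f) / A
≥ 1 / (2A)`. -/
theorem qArgmax_qOracle_under_le (hO : IsGenerativeModel M s₀ j₀ O) {η f : ℝ} (hη : 0 < η)
    (hf : 0 < f) (hf1 : f ≤ 1 / 2) {v : S → ℝ} (hv0 : ∀ t, 0 ≤ v t)
    (hv : ∀ t, v t ≤ M.horizon) (s : S) :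
    (qArgmax (qOracle M O s₀ j₀ η f v s) f).toOuterMeasure
      {x | ∃ a, (qOracle M O s₀ j₀ η f v s).val x < M.r s a + M.γ * (M.stepMean s a v - 2 * η)} ≤
      ENNReal.ofReal (2 * Real.exp ((1 + 3 * √(Fintype.card A : ℝ) - queryBudget A f) /
        (576 * √(Fintype.card A : ℝ)))) := by
  classical
  have hA : (0 : ℝ) < Fintype.card A := by exact_mod_cast Fintype.card_pos
  set Q := qOracle M O s₀ j₀ η f v s with hQ
  obtain ⟨a, ha⟩ := Finite.exists_max fun a => M.r s a + M.γ * (M.stepMean s a v - 2 * η)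
  refine le_trans ?_ (Q.qArgmax_lt_le f (M.r s a + M.γ * (M.stepMean s a v - 2 * η)) ?_)
  · exact MeasureTheory.measure_mono fun x ⟨b, hb⟩ => hb.trans_le (ha b)
  · have h1 : (∑ y, if y.1 = a then Q.law y else 0) = 1 / Fintype.card A :=
      sum_law_qOracle_action hO η f v s a
    have h2 : (∑ y : A × Q.W, if y.1 = a ∧ η < |estimate M.horizon (J := J)
        (n := numPoints M.horizon η) (m := numRuns f) y.2 - M.stepMean s a v|
        then Q.law y else 0) ≤ 1 / Fintype.card A * f :=
      sum_law_qOracle_err_le hO hη hf (by linarith) hv0 hv s a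
    have h3 : ∀ y : A × Q.W, (if y.1 = a then Q.law y else 0) ≤
        (if M.r s a + M.γ * (M.stepMean s a v - 2 * η) ≤ Q.val y then Q.law y else 0) +
        if y.1 = a ∧ η < |estimate M.horizon (J := J)
          (n := numPoints M.horizon η) (m := numRuns f) y.2 - M.stepMean s a v|
          then Q.law y else 0 := by
      intro y
      have hl := Q.law_nonneg y
      by_cases hy : y.1 = a
      swap
      · rw [if_neg hy]
        exact add_nonneg (by split_ifs <;> [exact hl; exact le_rfl])
          (by split_ifs <;> [exact hl; exact le_rfl])
      by_cases he : η < |estimate M.horizon (J := J)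
        (n := numPoints M.horizon η) (m := numRuns f) y.2 - M.stepMean s a v|
      · have hc := And.intro hy he
        rw [if_pos hy, if_pos hc]
        exact le_add_of_nonneg_left (by split_ifs <;> [exact hl; exact le_rfl])
      · have hval : M.r s a + M.γ * (M.stepMean s a v - 2 * η) ≤ Q.val y := by
          refine le_trans ?_ (le_max_left _ _)
          rw [hy]
          refine add_le_add le_rfl (mul_le_mul_of_nonneg_left ?_ M.γ_nonneg)
          linarith [(abs_le.1 (not_lt.1 he)).1]
        rw [if_pos hy, if_pos hval]
        exact le_add_of_nonneg_right (by split_ifs <;> [exact hl; exact le_rfl])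
    have h4 := sum_le_sum fun y (_ : y ∈ univ) => h3 y
    rw [h1, sum_add_distrib] at h4
    have h5 : 1 / (Fintype.card A : ℝ) * f ≤ 1 / Fintype.card A * (1 / 2) :=
      mul_le_mul_of_nonneg_left hf1 (by positivity)
    have h6 : 1 / (2 * (Fintype.card A : ℝ)) = 1 / Fintype.card A - 1 / Fintype.card A * (1 / 2) := by
      field_simp; norm_num
    rw [h6]
    linarith

/-! ### The iteration -/

/-- What holds after `l` iterations if no call of maximum finding has failed. -/
structure Sound (M : MDP S A) (η : ℝ) (l : ℕ) (vπ : (S → ℝ) × (S → A)) : Prop where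
  nonneg : ∀ s, 0 ≤ vπ.1 s
  le_update : ∀ s, vπ.1 s ≤ M.r s (vπ.2 s) + M.γ * M.stepMean s (vπ.2 s) vπ.1
  optValue_sub_le : ∀ s, M.optValue s - vπ.1 s ≤ M.γ ^ (l - 1) * M.horizon + 2 * η * M.horizon

omit [DecidableEq S] [Fintype A] [DecidableEq A] [Nonempty A] in
theorem Sound.le_value {η : ℝ} {l : ℕ} {vπ : (S → ℝ) × (S → A)} (h : Sound M η l vπ) (s : S) :
    vπ.1 s ≤ M.value vπ.2 s :=
  M.le_value_of_le_update _ _ h.le_update s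

omit [DecidableEq S] [Fintype A] [DecidableEq A] [Nonempty A] in
theorem Sound.le_horizon {η : ℝ} {l : ℕ} {vπ : (S → ℝ) × (S → A)} (h : Sound M η l vπ) (s : S) :
    vπ.1 s ≤ M.horizon :=
  (h.le_value s).trans (M.value_le_horizon _ s)

omit [DecidableEq S] [Fintype A] [DecidableEq A] in
theorem optValue_sub_le_horizon (η : ℝ) (hη : 0 ≤ η) {c : ℝ} (hc : 0 ≤ c) (s : S) :
    M.optValue s - c ≤ M.horizon + 2 * η * M.horizon := by
  have h1 : M.optValue s ≤ M.horizon := M.optValue_le fun π => M.value_le_horizon π s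
  have h2 := mul_nonneg (mul_nonneg zero_le_two hη) M.horizon_pos.le
  linarith

/-- The values found by maximum finding in iteration `l + 1`, together with the corresponding
actions, are neither too large nor too small. -/
def IsGood (M : MDP S A) (η : ℝ) (l : ℕ) (v : S → ℝ) (s : S) (a : A) (w : ℝ) : Prop :=
  w ≤ M.r s a + M.γ * M.stepMean s a v ∧
    (l ≠ 0 → ∀ b, M.r s b + M.γ * (M.stepMean s b v - 2 * η) ≤ w)

omit [DecidableEq S] [DecidableEq A] in
-- In states that keep their action, `le_update` survives because the right-hand side is monotone in
-- the increasing vector. The error `2ηΓ` is stable since `γ (2ηΓ + 2η) ≤ 2ηΓ`. The first round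
-- reads the zero oracle and gains nothing, which explains the exponent `l - 1`.
theorem Sound.succ {η : ℝ} (hη : 0 ≤ η) {l : ℕ} {v : S → ℝ} {π : S → A} (h : Sound M η l (v, π))
    {w : S → ℝ} {a : S → A} (hw : ∀ s, IsGood M η l v s (a s) (w s)) :
    Sound M η (l + 1)
      (fun s => if v s ≤ w s then w s else v s, fun s => if v s ≤ w s then a s else π s) := by
  have hle : ∀ s, v s ≤ if v s ≤ w s then w s else v s := fun s => by
    split_ifs with h1 <;> [exact h1; exact le_rfl]
  have hwle : ∀ s, w s ≤ if v s ≤ w s then w s else v s := fun s => by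
    split_ifs with h1 <;> [exact le_rfl; exact (not_le.1 h1).le]
  have h0 : ∀ s, 0 ≤ if v s ≤ w s then w s else v s := fun s => (h.nonneg s).trans (hle s)
  refine ⟨h0, fun s => ?_, fun s => ?_⟩
  · have hmono := fun b => mul_le_mul_of_nonneg_left (M.stepMean_mono s b hle) M.γ_nonneg
    have h1 := (hw s).1
    have h2 := h.le_update s
    dsimp only at h2 ⊢
    by_cases hs : v s ≤ w s
    · rw [if_pos hs, if_pos hs]
      linarith [hmono (a s)]
    · rw [if_neg hs, if_neg hs]
      linarith [hmono (π s)]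
  · rcases l with _ | l
    · rw [zero_add, Nat.sub_self, pow_zero, one_mul]
      exact optValue_sub_le_horizon (M := M) η hη (h0 s) s
    · have h1 := M.optValue_sub_le (A := A) (v := v) (e := 2 * η)
        (w := fun s => if v s ≤ w s then w s else v s) h.optValue_sub_le
        (fun s b => ((hw s).2 (Nat.succ_ne_zero l) b).trans (hwle s)) s
      refine h1.trans ?_
      simp only [Nat.add_sub_cancel, pow_succ]
      have h2 := M.one_sub_mul_horizon
      have h3 : 0 ≤ 2 * η * (1 - M.γ) := mul_nonneg (by linarith) (by linarith [M.γ_lt_one])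
      have h4 : M.γ * (2 * η * M.horizon + 2 * η) = 2 * η * M.horizon - 2 * η * (1 - M.γ) := by
        linear_combination (-2 * η) * h2
      linarith

omit [DecidableEq S] [Fintype A] [DecidableEq A] in
theorem sound_zero {η : ℝ} (hη : 0 ≤ η) (π : S → A) : Sound M η 0 (fun _ => 0, π) := by
  refine ⟨fun _ => le_rfl, fun s => ?_, fun s => ?_⟩
  · have := mul_nonneg M.γ_nonneg (M.stepMean_nonneg s (π s) (g := fun _ => 0) fun _ => le_rfl)
    dsimp only
    linarith [M.r_nonneg s (π s)]
  · rw [Nat.zero_sub, pow_zero, one_mul]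
    exact optValue_sub_le_horizon η hη le_rfl s

/-- A bound on the failure probability of one call of maximum finding. -/
def callError (A : Type*) [Fintype A] (f : ℝ) : ℝ :=
  f * (3 * √(Fintype.card A : ℝ)) * queryBudget A f +
    2 * Real.exp ((1 + 3 * √(Fintype.card A : ℝ) - queryBudget A f) /
      (576 * √(Fintype.card A : ℝ)))

theorem qArgmax_oracleAt_le (hO : IsGenerativeModel M s₀ j₀ O) {η f : ℝ} (hη : 0 < η)
    (hf : 0 < f) (hf1 : f ≤ 1 / 2) (hB : 1 ≤ queryBudget A f) {l : ℕ} {v : S → ℝ}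
    (hv0 : ∀ t, 0 ≤ v t) (hv : ∀ t, v t ≤ M.horizon) (s : S) :
    (qArgmax (oracleAt M O s₀ j₀ η f l v s) f).toOuterMeasure
      {x | ¬ IsGood M η l v s x.1 ((oracleAt M O s₀ j₀ η f l v s).val x)} ≤
      ENNReal.ofReal (callError A f) := by
  rcases l with _ | l
  · have : {x : A × (oracleAt M O s₀ j₀ η f 0 v s).W |
        ¬ IsGood M η 0 v s x.1 ((oracleAt M O s₀ j₀ η f 0 v s).val x)} = ∅ := by
      refine Set.eq_empty_of_forall_notMem fun x hx => hx ⟨?_, fun h => absurd rfl h⟩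
      change (0 : ℝ) ≤ _
      have := mul_nonneg M.γ_nonneg (M.stepMean_nonneg s x.1 hv0)
      linarith [M.r_nonneg s x.1]
    rw [this, MeasureTheory.measure_empty]
    exact zero_le
  · have h1 := qArgmax_qOracle_over_le hO hη hf (by linarith) hB hv0 hv s
    have h2 := qArgmax_qOracle_under_le hO hη hf hf1 hv0 hv s
    rw [callError, ENNReal.ofReal_add (by positivity) (by positivity)]
    refine le_trans ?_ (add_le_add h1 h2)
    refine le_trans (MeasureTheory.measure_mono fun x hx => ?_) (MeasureTheory.measure_union_le _ _)
    by_contra hx'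
    refine hx ⟨not_lt.1 fun h => hx' (Or.inl h), fun _ b => not_lt.1 fun h => hx' (Or.inr ⟨b, h⟩)⟩

/-- The bounds `0 ≤ v ≤ Γ` required by mean estimation are themselves consequences of soundness, so
each round is bounded only after sound predecessors. -/
theorem iterate_not_sound_le (hO : IsGenerativeModel M s₀ j₀ O) {η f : ℝ} (hη : 0 < η)
    (hf : 0 < f) (hf1 : f ≤ 1 / 2) (hB : 1 ≤ queryBudget A f) (π₀ : S → A) (l : ℕ) :
    (iterate M O s₀ j₀ η f π₀ l).toOuterMeasure {vπ | ¬ Sound M η l vπ} ≤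
      l * (Fintype.card S * ENNReal.ofReal (callError A f)) := by
  induction l with
  | zero =>
    rw [iterate, toOuterMeasure_eq_expect, expect_pure, Set.indicator_of_notMem]
    · exact zero_le
    · exact fun h => h (sound_zero hη.le π₀)
  | succ l ih =>
    rw [iterate, Nat.cast_succ, add_one_mul]
    refine toOuterMeasure_bind_le _ _ _ _ ih fun ⟨v, π⟩ hvπ => ?_
    have hs : Sound M η l (v, π) := not_not.1 hvπ
    rw [PMF.toOuterMeasure_map_apply]
    calc _ ≤ (indep fun s => qArgmax (oracleAt M O s₀ j₀ η f l v s) f).toOuterMeasure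
          {x | ∃ s, x s ∈ {y : A × (oracleAt M O s₀ j₀ η f l v s).W |
            ¬ IsGood M η l v s y.1 ((oracleAt M O s₀ j₀ η f l v s).val y)}} := by
          refine MeasureTheory.measure_mono fun x hx => ?_
          by_contra hgood
          simp only [Set.mem_ofPred_eq, not_exists, not_not] at hgood
          exact hx (hs.succ hη.le hgood)
      _ ≤ ∑ s : S, ENNReal.ofReal (callError A f) :=
          (indep_exists_le _ _).trans (sum_le_sum fun s _ =>
            qArgmax_oracleAt_le hO hη hf hf1 hB hs.nonneg hs.le_horizon s)
      _ = _ := by rw [sum_const, card_univ, nsmul_eq_mul]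

/-! ### The parameters -/

/-- From `log √x ≤ √x - 1` and `(√x - 2)² ≥ 0`. -/
theorem log_le_half {x : ℝ} (hx : 0 < x) : Real.log x ≤ x / 2 := by
  have h1 := Real.log_le_sub_one_of_pos (Real.sqrt_pos.2 hx)
  rw [Real.log_sqrt hx.le] at h1
  nlinarith [sq_nonneg (√x - 2), Real.sq_sqrt hx.le]

omit [DecidableEq A] in
/-- The parameter `f = 1 / (2 X log X)` for `X = 4 c_max N A^(3/2) / δ`. -/
theorem callError_le {X f N δ : ℝ} (hN : 1 ≤ N) (hδ : 0 < δ) (hδ1 : δ < 1)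
    (hX : X = 40000 * N * (Fintype.card A : ℝ) ^ (3 / 2 : ℝ) / δ)
    (hf : f = 1 / (X * (2 * Real.log X))) :
    0 < f ∧ f ≤ 1 / 2 ∧ 1 ≤ queryBudget A f ∧ callError A f ≤ δ / N := by
  set R := √(Fintype.card A : ℝ) with hR
  have hR1 : 1 ≤ R := ValueOracle.one_le_sqrt_card A
  have hA0 : (0 : ℝ) ≤ Fintype.card A := Nat.cast_nonneg _
  have hR3 : (Fintype.card A : ℝ) ^ (3 / 2 : ℝ) = R ^ 3 := by
    rw [hR, Real.sqrt_eq_rpow, ← Real.rpow_natCast, ← Real.rpow_mul hA0]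
    norm_num
  rw [hR3] at hX
  have hR31 : 1 ≤ R ^ 3 := one_le_pow₀ hR1
  have hXδ : X * δ = 40000 * N * R ^ 3 := by rw [hX]; field_simp
  have hX1 : 40000 ≤ X := by
    rw [hX, le_div_iff₀ hδ]
    nlinarith [mul_le_mul hN hR31 zero_le_one (by linarith)]
  have hX0 : 0 < X := by linarith
  have hlog1 : 1 ≤ Real.log X := by
    rw [Real.le_log_iff_exp_le hX0]
    linarith [Real.exp_one_lt_d9]
  have hlog2 := log_le_half hX0
  set ℓ := Real.log (1 / f) with hℓ
  have hinv : 1 / f = X * (2 * Real.log X) := by rw [hf, one_div_one_div]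
  have hf0 : 0 < f := by rw [hf]; positivity
  have hℓ1 : 1 ≤ ℓ := by
    rw [hℓ, hinv, Real.le_log_iff_exp_le (by positivity)]
    nlinarith [Real.exp_one_lt_d9]
  -- This inequality, which rests on `2 log X ≤ X`, is the reason for the factor `2 log X` in `f`:
  -- it gives `f log (1/f) ≤ 1 / X`.
  have hℓ2 : ℓ ≤ 2 * Real.log X := by
    rw [hℓ, hinv, Real.log_mul hX0.ne' (by positivity), two_mul (Real.log X)]
    gcongr
    linarith
  have hfℓ : f * ℓ ≤ 1 / X := by
    rw [hf, div_mul_eq_mul_div, one_mul, div_le_div_iff₀ (by positivity) hX0]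
    nlinarith
  have hfX : f ≤ 1 / (2 * X) := by
    rw [hf]
    apply one_div_le_one_div_of_le (by positivity)
    nlinarith
  have hB : queryBudget A f = 10000 * R * ℓ := rfl
  have hXinv : 1 / X = δ / (40000 * N * R ^ 3) := by rw [hX, one_div_div]
  refine ⟨hf0, hfX.trans ?_, ?_, ?_⟩
  · exact one_div_le_one_div_of_le two_pos (by linarith)
  · rw [hB]; nlinarith
  · have h1 : f * (3 * R) * queryBudget A f ≤ 3 / 4 * (δ / N) := by
      calc f * (3 * R) * queryBudget A f = 30000 * R ^ 2 * (f * ℓ) := by rw [hB]; ring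
        _ ≤ 30000 * R ^ 2 * (1 / X) := by gcongr
        _ = 3 / 4 * (δ / N) / R := by rw [hXinv]; field_simp; norm_num
        _ ≤ 3 / 4 * (δ / N) := div_le_self (by positivity) hR1
    -- The budget `10000 R ℓ` exceeds `576 R ℓ + 1 + 3 R`, as `R, ℓ ≥ 1`; hence the tail is at most
    -- `exp (-ℓ) = f`.
    have h2 : Real.exp ((1 + 3 * R - queryBudget A f) / (576 * R)) ≤ f := by
      refine (Real.le_log_iff_exp_le hf0).1 ?_
      have : Real.log f = -ℓ := by rw [hℓ, one_div, Real.log_inv, neg_neg]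
      rw [this, hB, div_le_iff₀ (by positivity)]
      nlinarith
    have h3 : 2 * f ≤ 1 / 4 * (δ / N) := by
      calc 2 * f ≤ 2 * (1 / (2 * X)) := by linarith
        _ = 1 / X := by field_simp
        _ = 1 / 40000 * (δ / N) / R ^ 3 := by rw [hXinv]; field_simp
        _ ≤ 1 / 40000 * (δ / N) := div_le_self (by positivity) hR31
        _ ≤ 1 / 4 * (δ / N) := by gcongr; norm_num
    rw [callError]
    linarith

omit [Fintype S] [DecidableEq S] [Fintype A] [DecidableEq A] [Nonempty A] in
-- `γ ≤ exp (-(1 - γ))`, and `L - 1 ≥ Γ log (4Γ/ε)` cancels the factor `1 - γ`.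
theorem pow_numIter_le (M : MDP S A) {ε : ℝ} (hε : 0 < ε) :
    M.γ ^ (numIter M ε - 1) * M.horizon ≤ ε / 4 := by
  have hΓ := M.horizon_pos
  set n := numIter M ε - 1 with hn
  have hn1 : M.horizon * Real.log (4 * M.horizon / ε) ≤ n :=
    (mul_le_mul_of_nonneg_left (Int.le_ceil _) hΓ.le).trans (Nat.le_ceil _)
  have hγ : M.γ ≤ Real.exp (-(1 - M.γ)) := by linarith [Real.add_one_le_exp (-(1 - M.γ))]
  have h1 : M.γ ^ n ≤ Real.exp (-Real.log (4 * M.horizon / ε)) := by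
    refine (pow_le_pow_left₀ M.γ_nonneg hγ n).trans ?_
    rw [← Real.exp_nat_mul]
    apply Real.exp_le_exp.2
    have h2 := mul_le_mul_of_nonneg_left hn1 (sub_nonneg.2 M.γ_lt_one.le)
    rw [← mul_assoc, M.one_sub_mul_horizon, one_mul] at h2
    linarith
  rw [Real.exp_neg, Real.exp_log (by positivity), inv_div] at h1
  calc M.γ ^ n * M.horizon ≤ ε / (4 * M.horizon) * M.horizon :=
        mul_le_mul_of_nonneg_right h1 hΓ.le
    _ = ε / 4 := by field_simp

end Solve

end QMDP

end

/-! ### The main theorem -/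

theorem mainTheorem3 {S A J : Type*} [Fintype S] [DecidableEq S] [Fintype A] [DecidableEq A]
    [Nonempty A] [Fintype J] [DecidableEq J]
    (M : QMDP.MDP S A) (s₀ : S) (j₀ : J) (O : Matrix.unitaryGroup (S × A × S × J) ℂ)
    (hO : QMDP.IsGenerativeModel M s₀ j₀ O)
    (ε : ℝ) (hε : 0 < ε) (hεΓ : ε ≤ M.horizon)
    (δ : ℝ) (hδ : 0 < δ) (hδ1 : δ < 1) (π₀ : S → A) :
    ENNReal.ofReal (1 - δ) ≤
      (QMDP.solveMdp2 M O s₀ j₀ ε δ π₀).toOuterMeasure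
        {out | ∀ s, M.optValue s - ε ≤ out.1 s ∧ out.1 s ≤ M.value out.2 s ∧
          M.value out.2 s ≤ M.optValue s} := by
  have hγ : 0 < 1 - M.γ := sub_pos.2 M.γ_lt_one
  have hη : 0 < QMDP.estError M ε := by unfold QMDP.estError; positivity
  have hS : (1 : ℝ) ≤ Fintype.card S := by
    exact_mod_cast Nat.succ_le_of_lt (Fintype.card_pos_iff.2 ⟨s₀⟩)
  have hL : (1 : ℝ) ≤ QMDP.numIter M ε := by
    exact_mod_cast Nat.succ_le_of_lt (Nat.succ_pos _)
  have hN : (1 : ℝ) ≤ QMDP.numIter M ε * Fintype.card S := one_le_mul_of_one_le_of_one_le hL hS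
  obtain ⟨hf0, hf1, hB, herr⟩ := QMDP.callError_le (A := A) (f := QMDP.failProb M ε δ) hN hδ hδ1
    rfl (by
      unfold QMDP.failProb QMDP.cMax
      rw [show (4 * 10000 : ℝ) = 40000 by norm_num, mul_assoc (40000 : ℝ), one_div, mul_inv,
        inv_div, ← div_eq_mul_inv, div_div])
  apply QMDP.one_sub_le_toOuterMeasure _ hδ.le
  rw [QMDP.solveMdp2]
  refine (MeasureTheory.measure_mono fun out hout => ?_).trans
    ((QMDP.iterate_not_sound_le hO hη hf0 hf1 hB π₀ (QMDP.numIter M ε)).trans ?_)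
  · intro h
    refine hout fun s => ⟨?_, h.le_value s, M.value_le_optValue _ s⟩
    have h1 := h.optValue_sub_le s
    have h2 := QMDP.pow_numIter_le M hε
    -- The accumulated estimation error takes `ε/2` and the truncation of the iteration `ε/4`.
    have h3 : 2 * QMDP.estError M ε * M.horizon = ε / 2 := by
      unfold QMDP.estError
      linear_combination (ε / 2) * M.one_sub_mul_horizon
    linarith
  · rw [← ENNReal.ofReal_natCast, ← ENNReal.ofReal_natCast, ← ENNReal.ofReal_mul (by positivity),
      ← ENNReal.ofReal_mul (by positivity), ← mul_assoc]
    apply ENNReal.ofReal_le_ofReal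
    rwa [le_div_iff₀ (by linarith), mul_comm] at herr
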